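/- Let $k$ be a field of characteristic $0$. A *stable vertex* consists of a genus $g\ge 0$ and a finite set of $n$ labelled legs with $2g-2+n>0$. A (dg, non-unital) *modular operad* $P$ assigns to every stable vertex a cochain complex of $k$-vector spaces, functorially for bijections of legs, together with operations that contract an edge between two vertices and a loop at a vertex, equivariant and compatible with each other and with the differentials. In an *even* operad these operations have degree $0$ and commute; in an *odd* operad they have degree $1$ and any two of them anticommute (odd modular operads are the $\mathfrak K$-twisted modular operads). An even or odd *cyclic operad* is the same kind of object with vertices of genus $0$ only (hence $n\ge 3$ and no loop contractions). An operad is *of finite type* if each of its complexes is finite dimensional in every degree, and either all of these complexes are bounded below or all of them are bounded above. For a cyclic or modular operad $P$ of finite type, the *Feynman transform* $D(P)$ is the operad of the same kind and of opposite parity that is freely generated, as a graded operad, by the linear dual of $P$; its differential is the sum (with the usual signs) of the dual of the differential of $P$ and of the dual of the one-edge contractions of $P$. It is a contravariant functor. Let $R$ be the restriction of modular operads to genus $0$, let $L$ (the *modular envelope*) be the left adjoint of $R$, which takes a cyclic operad to the modular operad generated by it in genus $0$ subject to all relations that hold in it, and let $L^!$ be the extension of cyclic operads by zero to higher genus. (All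 of them preserve parity.) Then, for both parities: 1. There is an isomorphism $DR\cong RD$ of contravariant functors from modular operads of finite type to cyclic operads of the opposite parity. 2. There is an isomorphism $DL^!\cong LD$ of contravariant functors from cyclic operads of finite type to modular operads of the opposite parity. 3. Let $\mathcal O=F(E)/\langle S\rangle$ be a quadratic cyclic operad: $F(E)$ is the free operad on a collection of complexes $E$ with actions of the bijections of legs, and $S$ is a subcollection, stable under the differential and these actions, of the span $F(E)^1$ of the one-edge trees. Assume that $E$ and $\mathcal O$ are of finite type. Let $\mathcal O^!=F(E^\ast)/\langle S^\perp\rangle$ be the quadratic dual, which has the opposite parity, and assume that $\mathcal O$ is Koszul, i.e. that the natural map $D(\mathcal O)\to\mathcal O^!$ is a quasi-isomorphism in every component. Then $D(L^!(\mathcal O))$ is a model for the derived modular envelope of $\mathcal O^!$. That is, in the model structures whose weak equivalences are the componentwise quasi-isomorphisms and whose fibrations are the componentwise surjections, $\mathcal O^!$ has a cofibrant replacement, and for every cofibrant cyclic operad $Q$ with a weak equivalence $Q\to\mathcal O^!$, the modular operads $L(Q)$ and $D(L^!(\mathcal O))$ are isomorphic in the localization of the category of modular operads (of the parity of $\mathcal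 O^!$) at the weak equivalences. -/

import Mathlib

open CategoryTheory

universe u

set_option linter.unusedVariables false

namespace GraphOperad

/-! ### Vertices and one-edge graphs -/

/-- The parity of an operad: structure operations of degree `0` (even operads) or of degree `1`
(odd operads; odd modular operads are the `𝔎`-twisted modular operads). -/
inductive Parity
  | even
  | odd

/-- The degree of the structure operations. -/
def Parity.deg : Parity → ℤ
  | .even => 0
  | .odd => 1

/-- The opposite parity. -/
def Parity.flip : Parity → Parity
  | .even => .odd
  | .odd => .even

theorem Parity.deg_flip (p : Parity) : p.deg + p.flip.deg = 1 := by
  cases p <;> rfl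

/-- Which vertices are used: cyclic operads only have vertices of genus zero, modular operads have
vertices of every genus. -/
inductive Kind
  | cyclic
  | modular

/-- The genera that are allowed for the vertices of a given kind. -/
def Kind.Allows : Kind → ℕ → Prop
  | .cyclic, g => g = 0
  | .modular, _ => True

/-- A stable vertex of genus `g` with a finite set of labelled legs, `2 g - 2 + n > 0`. Legs are
labelled by natural numbers; every finite set is in bijection with such a set of labels. -/
@[ext]
structure Vertex (t : Kind) where
  genus : ℕ
  legs : Finset ℕ
  stable : 2 < 2 * genus + legs.card
  allowed : t.Allows genus

/-- `σ` restricts to an isomorphism of vertices from `c` to `c'`. (Every bijection between finite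
sets of labels is the restriction of a permutation of `ℕ`.) -/
structure IsRelabel {t : Kind} (σ : Equiv.Perm ℕ) (c c' : Vertex t) : Prop where
  genus : c'.genus = c.genus
  legs : c'.legs = c.legs.map σ.toEmbedding

/-- `c` is the result of contracting an edge that joins the leg `a` of `c₁` to the leg `b`
of `c₂`. -/
structure IsGlue {t : Kind} (a b : ℕ) (c₁ c₂ c : Vertex t) : Prop where
  left_mem : a ∈ c₁.legs
  right_mem : b ∈ c₂.legs
  disjoint : Disjoint c₁.legs c₂.legs
  genus : c.genus = c₁.genus + c₂.genus
  legs : c.legs = c₁.legs.erase a ∪ c₂.legs.erase b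

/-- `c` is the result of contracting a loop that joins the legs `a` and `b` of `c₁`. As the genus
goes up, this never happens between vertices of genus zero. -/
structure IsLoop {t : Kind} (a b : ℕ) (c₁ c : Vertex t) : Prop where
  ne : a ≠ b
  left_mem : a ∈ c₁.legs
  right_mem : b ∈ c₁.legs
  genus : c.genus = c₁.genus + 1
  legs : c.legs = (c₁.legs.erase a).erase b

theorem IsRelabel.symm {t : Kind} {σ : Equiv.Perm ℕ} {c c' : Vertex t} (h : IsRelabel σ c c') :
    IsRelabel σ⁻¹ c' c := by
  refine ⟨h.genus.symm, ?_⟩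
  rw [h.legs, Finset.map_map]
  ext x
  simp

/-- The sign `(-1) ^ n`. -/
def sgn (k : Type u) [Field k] (n : ℤ) : k := ((n.negOnePow : ℤ) : k)

/-! ### Modules over the groupoid of vertices -/

/-- A dg module over the groupoid of vertices: for each vertex a cochain complex of `k`-vector
spaces, on which isomorphisms of vertices act. -/
structure VMod (k : Type u) [Field k] (t : Kind) where
  obj : Vertex t → ℤ → Type u
  [addCommGroup : ∀ c i, AddCommGroup (obj c i)]
  [module : ∀ c i, Module k (obj c i)]
  d : ∀ {c : Vertex t} {i j : ℤ}, i + 1 = j → (obj c i →ₗ[k] obj c j)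
  act : ∀ (σ : Equiv.Perm ℕ) {c c' : Vertex t}, IsRelabel σ c c' → ∀ {i : ℤ},
    obj c i →ₗ[k] obj c' i
  d_d : ∀ {c : Vertex t} {i j l : ℤ} (h : i + 1 = j) (h' : j + 1 = l) (x : obj c i),
    d h' (d h x) = 0
  act_id : ∀ (σ : Equiv.Perm ℕ) {c : Vertex t} (h : IsRelabel σ c c) {i : ℤ} (x : obj c i),
    (∀ m ∈ c.legs, σ m = m) → act σ h x = x
  act_act : ∀ (σ τ : Equiv.Perm ℕ) {c c' c'' : Vertex t} (h : IsRelabel σ c c')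
    (h' : IsRelabel τ c' c'') (h'' : IsRelabel (τ * σ) c c'') {i : ℤ} (x : obj c i),
    act τ h' (act σ h x) = act (τ * σ) h'' x
  act_d : ∀ (σ : Equiv.Perm ℕ) {c c' : Vertex t} (h : IsRelabel σ c c') {i j : ℤ}
    (hij : i + 1 = j) (x : obj c i), act σ h (d hij x) = d hij (act σ h x)

attribute [instance] VMod.addCommGroup VMod.module

/-- The linear dual of a dg module over the groupoid of vertices, with differential
`f ↦ -(-1)^|f| f ∘ d` and the contragredient action. -/
def VMod.dual {k : Type u} [Field k] {t : Kind} (E : VMod k t) : VMod k t where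
  obj c i := Module.Dual k (E.obj c (-i))
  d {c i j} h := (-(sgn k i)) • (E.d (c := c) (show -j + 1 = -i by omega)).dualMap
  act σ {_ _} h {_} := (E.act σ⁻¹ h.symm).dualMap
  d_d h h' f := by
    ext x
    simp [E.d_d]
  act_id σ {c} h {i} f hf := by
    ext x
    have : E.act σ⁻¹ h.symm x = x := E.act_id _ _ _ fun m hm => by
      rw [Equiv.Perm.inv_eq_iff_eq]; exact (hf m hm).symm
    simp [this]
  act_act σ τ {c c' c''} h h' h'' {i} f := by
    ext x
    have h3 : IsRelabel (σ⁻¹ * τ⁻¹) c'' c := by rw [← mul_inv_rev]; exact h''.symm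
    have := E.act_act τ⁻¹ σ⁻¹ h'.symm h.symm h3 x
    simp only [LinearMap.dualMap_apply, this]
    simp only [mul_inv_rev]
  act_d σ {c c'} h {i j} hij f := by
    ext x
    simp [E.act_d]

/-- The finiteness that linear duality requires: finite dimension in each degree, and boundedness
on one side. -/
structure VMod.IsFiniteType {k : Type u} [Field k] {t : Kind} (E : VMod k t) : Prop where
  finite : ∀ c i, Module.Finite k (E.obj c i)
  bounded : (∀ c, ∃ N : ℤ, ∀ i < N, Subsingleton (E.obj c i)) ∨
    (∀ c, ∃ N : ℤ, ∀ i > N, Subsingleton (E.obj c i))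

/-! ### Cyclic and modular operads -/

/-- A dg operad of the given kind and parity. For `t = modular` and `p = even` (resp. `odd`)
this is a modular operad (resp. a `𝔎`-twisted modular operad); for `t = cyclic` it is an
(odd) cyclic operad without units, and there are no instances of `loop`.

The operations are the evaluations at graphs with one edge. They have degree `p.deg`, and two edges
that are contracted in the two possible orders give results that agree up to `(-1) ^ p.deg`
(together with the Koszul sign). -/
structure Operad (k : Type u) [Field k] (t : Kind) (p : Parity) extends VMod k t where
  glue : ∀ (a b : ℕ) {c₁ c₂ c : Vertex t}, IsGlue a b c₁ c₂ c → ∀ {i j l : ℤ},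
    i + j + p.deg = l → (obj c₁ i →ₗ[k] obj c₂ j →ₗ[k] obj c l)
  loop : ∀ (a b : ℕ) {c₁ c : Vertex t}, IsLoop a b c₁ c → ∀ {i l : ℤ},
    i + p.deg = l → (obj c₁ i →ₗ[k] obj c l)
  act_glue : ∀ (σ : Equiv.Perm ℕ) {a b : ℕ} {c₁ c₂ c c₁' c₂' c' : Vertex t}
    (h : IsGlue a b c₁ c₂ c) (h' : IsGlue (σ a) (σ b) c₁' c₂' c') (h₁ : IsRelabel σ c₁ c₁')
    (h₂ : IsRelabel σ c₂ c₂') (h₀ : IsRelabel σ c c') {i j l : ℤ} (hl : i + j + p.deg = l)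
    (x : obj c₁ i) (y : obj c₂ j),
    act σ h₀ (glue a b h hl x y) = glue (σ a) (σ b) h' hl (act σ h₁ x) (act σ h₂ y)
  act_loop : ∀ (σ : Equiv.Perm ℕ) {a b : ℕ} {c₁ c c₁' c' : Vertex t}
    (h : IsLoop a b c₁ c) (h' : IsLoop (σ a) (σ b) c₁' c') (h₁ : IsRelabel σ c₁ c₁')
    (h₀ : IsRelabel σ c c') {i l : ℤ} (hl : i + p.deg = l) (x : obj c₁ i),
    act σ h₀ (loop a b h hl x) = loop (σ a) (σ b) h' hl (act σ h₁ x)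
  d_glue : ∀ {a b : ℕ} {c₁ c₂ c : Vertex t} (h : IsGlue a b c₁ c₂ c) {i j i' j' l l' : ℤ}
    (hl : i + j + p.deg = l) (hi : i + 1 = i') (hj : j + 1 = j') (hl' : l + 1 = l')
    (h₁ : i' + j + p.deg = l') (h₂ : i + j' + p.deg = l') (x : obj c₁ i) (y : obj c₂ j),
    d hl' (glue a b h hl x y) =
      sgn k p.deg • (glue a b h h₁ (d hi x) y + sgn k i • glue a b h h₂ x (d hj y))
  d_loop : ∀ {a b : ℕ} {c₁ c : Vertex t} (h : IsLoop a b c₁ c) {i i' l l' : ℤ}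
    (hl : i + p.deg = l) (hi : i + 1 = i') (hl' : l + 1 = l') (h₁ : i' + p.deg = l')
    (x : obj c₁ i), d hl' (loop a b h hl x) = sgn k p.deg • loop a b h h₁ (d hi x)
  glue_symm : ∀ {a b : ℕ} {c₁ c₂ c : Vertex t} (h : IsGlue a b c₁ c₂ c)
    (h' : IsGlue b a c₂ c₁ c) {i j l : ℤ} (hl : i + j + p.deg = l) (hl' : j + i + p.deg = l)
    (x : obj c₁ i) (y : obj c₂ j),
    glue b a h' hl' y x = sgn k (i * j) • glue a b h hl x y
  loop_symm : ∀ {a b : ℕ} {c₁ c : Vertex t} (h : IsLoop a b c₁ c) (h' : IsLoop b a c₁ c)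
    {i l : ℤ} (hl : i + p.deg = l) (x : obj c₁ i), loop b a h' hl x = loop a b h hl x
  /-- Two edges that form a path `x — y — z`. -/
  glue_glue : ∀ {a b u v : ℕ} {c₁ c₂ c₃ c₁₂ c₂₃ c : Vertex t} (h₁₂ : IsGlue a b c₁ c₂ c₁₂)
    (h₁ : IsGlue u v c₁₂ c₃ c) (h₂₃ : IsGlue u v c₂ c₃ c₂₃) (h₃ : IsGlue a b c₁ c₂₃ c)
    {i j l m n r : ℤ} (hm : i + j + p.deg = m) (hr : m + l + p.deg = r)
    (hn : j + l + p.deg = n) (hr' : i + n + p.deg = r)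
    (x : obj c₁ i) (y : obj c₂ j) (z : obj c₃ l),
    glue u v h₁ hr (glue a b h₁₂ hm x y) z =
      sgn k (p.deg * (i + 1)) • glue a b h₃ hr' x (glue u v h₂₃ hn y z)
  /-- Two loops at the same vertex. -/
  loop_loop : ∀ {a b u v : ℕ} {c c₁ c₂ c' : Vertex t} (h₁ : IsLoop a b c c₁)
    (h₁' : IsLoop u v c₁ c') (h₂ : IsLoop u v c c₂) (h₂' : IsLoop a b c₂ c')
    {i l r : ℤ} (hl : i + p.deg = l) (hr : l + p.deg = r) (x : obj c i),
    loop u v h₁' hr (loop a b h₁ hl x) = sgn k p.deg • loop a b h₂' hr (loop u v h₂ hl x)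
  /-- An edge between two vertices and a loop at the first of them. -/
  loop_glue : ∀ {a b u v : ℕ} {c₁ c₂ c₁₂ c₁' c : Vertex t} (h : IsGlue a b c₁ c₂ c₁₂)
    (h' : IsLoop u v c₁₂ c) (h₁ : IsLoop u v c₁ c₁') (h₁' : IsGlue a b c₁' c₂ c)
    {i j l m r : ℤ} (hl : i + j + p.deg = l) (hr : l + p.deg = r)
    (hm : i + p.deg = m) (hr' : m + j + p.deg = r) (x : obj c₁ i) (y : obj c₂ j),
    loop u v h' hr (glue a b h hl x y) =
      sgn k p.deg • glue a b h₁' hr' (loop u v h₁ hm x) y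
  /-- Two edges between the same two vertices. -/
  loop_glue' : ∀ {a b u v : ℕ} {c₁ c₂ c₁₂ c₁₂' c : Vertex t} (h : IsGlue a b c₁ c₂ c₁₂)
    (h₁ : IsLoop u v c₁₂ c) (h' : IsGlue u v c₁ c₂ c₁₂') (h₁' : IsLoop a b c₁₂' c)
    {i j l r : ℤ} (hl : i + j + p.deg = l) (hr : l + p.deg = r)
    (x : obj c₁ i) (y : obj c₂ j),
    loop u v h₁ hr (glue a b h hl x y) =
      sgn k p.deg • loop a b h₁' hr (glue u v h' hl x y)

/-- A morphism of operads: linear maps of degree zero that commute with the whole structure. -/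
@[ext]
structure Operad.Hom {k : Type u} [Field k] {t : Kind} {p : Parity} (P Q : Operad k t p) where
  app : ∀ (c : Vertex t) (i : ℤ), P.obj c i →ₗ[k] Q.obj c i
  app_d : ∀ {c : Vertex t} {i j : ℤ} (h : i + 1 = j) (x : P.obj c i),
    app c j (P.d h x) = Q.d h (app c i x)
  app_act : ∀ (σ : Equiv.Perm ℕ) {c c' : Vertex t} (h : IsRelabel σ c c') {i : ℤ}
    (x : P.obj c i), app c' i (P.act σ h x) = Q.act σ h (app c i x)
  app_glue : ∀ {a b : ℕ} {c₁ c₂ c : Vertex t} (h : IsGlue a b c₁ c₂ c) {i j l : ℤ}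
    (hl : i + j + p.deg = l) (x : P.obj c₁ i) (y : P.obj c₂ j),
    app c l (P.glue a b h hl x y) = Q.glue a b h hl (app c₁ i x) (app c₂ j y)
  app_loop : ∀ {a b : ℕ} {c₁ c : Vertex t} (h : IsLoop a b c₁ c) {i l : ℤ}
    (hl : i + p.deg = l) (x : P.obj c₁ i),
    app c l (P.loop a b h hl x) = Q.loop a b h hl (app c₁ i x)

instance Operad.category (k : Type u) [Field k] (t : Kind) (p : Parity) :
    Category (Operad k t p) where
  Hom := Operad.Hom
  id P :=
    { app := fun _ _ => LinearMap.id
      app_d := fun _ _ => rfl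
      app_act := fun _ _ _ _ _ _ => rfl
      app_glue := fun _ _ _ _ _ _ _ => rfl
      app_loop := fun _ _ _ _ _ => rfl }
  comp f g :=
    { app := fun c i => (g.app c i).comp (f.app c i)
      app_d := fun h x => by simp [f.app_d, g.app_d]
      app_act := fun σ _ _ h _ x => by simp [f.app_act, g.app_act]
      app_glue := fun h _ _ _ hl x y => by simp [f.app_glue, g.app_glue]
      app_loop := fun h _ _ hl x => by simp [f.app_loop, g.app_loop] }

theorem Operad.hom_ext {k : Type u} [Field k] {t : Kind} {p : Parity} {P Q : Operad k t p}
    {f g : P ⟶ Q} (h : ∀ c i (x : P.obj c i), f.app c i x = g.app c i x) : f = g :=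
  Operad.Hom.ext (funext fun c => funext fun i => LinearMap.ext (h c i))

theorem Operad.comp_app {k : Type u} [Field k] {t : Kind} {p : Parity} {P Q R : Operad k t p}
    (f : P ⟶ Q) (g : Q ⟶ R) (c : Vertex t) (i : ℤ) (x : P.obj c i) :
    (f ≫ g).app c i x = g.app c i (f.app c i x) := rfl

theorem Operad.id_app {k : Type u} [Field k] {t : Kind} {p : Parity} (P : Operad k t p)
    (c : Vertex t) (i : ℤ) (x : P.obj c i) : Operad.Hom.app (𝟙 P) c i x = x := rfl

/-! ### Free operads and quotients -/

section Free

variable {k : Type u} [Field k] {t : Kind}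

/-- Formal expressions in the operations of a dg operad, with generators in the graded vector
spaces underlying `E`. -/
inductive Term (E : VMod k t) (p : Parity) : Vertex t → ℤ → Type u
  | gen {c : Vertex t} {i : ℤ} (x : E.obj c i) : Term E p c i
  | zero {c : Vertex t} {i : ℤ} : Term E p c i
  | add {c : Vertex t} {i : ℤ} (x y : Term E p c i) : Term E p c i
  | smul {c : Vertex t} {i : ℤ} (r : k) (x : Term E p c i) : Term E p c i
  | d {c : Vertex t} {i j : ℤ} (h : i + 1 = j) (x : Term E p c i) : Term E p c j
  | act (σ : Equiv.Perm ℕ) {c c' : Vertex t} (h : IsRelabel σ c c') {i : ℤ}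
      (x : Term E p c i) : Term E p c' i
  | glue (a b : ℕ) {c₁ c₂ c : Vertex t} (h : IsGlue a b c₁ c₂ c) {i j l : ℤ}
      (hl : i + j + p.deg = l) (x : Term E p c₁ i) (y : Term E p c₂ j) : Term E p c l
  | loop (a b : ℕ) {c₁ c : Vertex t} (h : IsLoop a b c₁ c) {i l : ℤ}
      (hl : i + p.deg = l) (x : Term E p c₁ i) : Term E p c l

open Term in
/-- The congruence on formal expressions generated by the axioms of a dg operad, and by the
linearity and equivariance of the inclusion of generators. -/
inductive Term.Rel (E : VMod k t) (p : Parity) :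
    ∀ {c : Vertex t} {i : ℤ}, Term E p c i → Term E p c i → Prop
  -- equivalence relation
  | refl {c : Vertex t} {i : ℤ} (x : Term E p c i) : Rel E p x x
  | symm {c : Vertex t} {i : ℤ} {x y : Term E p c i} : Rel E p x y → Rel E p y x
  | trans {c : Vertex t} {i : ℤ} {x y z : Term E p c i} :
      Rel E p x y → Rel E p y z → Rel E p x z
  -- compatibility with the operations
  | add_congr {c : Vertex t} {i : ℤ} {x x' y y' : Term E p c i} :
      Rel E p x x' → Rel E p y y' → Rel E p (add x y) (add x' y')
  | smul_congr {c : Vertex t} {i : ℤ} (r : k) {x x' : Term E p c i} :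
      Rel E p x x' → Rel E p (smul r x) (smul r x')
  | d_congr {c : Vertex t} {i j : ℤ} (h : i + 1 = j) {x x' : Term E p c i} :
      Rel E p x x' → Rel E p (d h x) (d h x')
  | act_congr (σ : Equiv.Perm ℕ) {c c' : Vertex t} (h : IsRelabel σ c c') {i : ℤ}
      {x x' : Term E p c i} : Rel E p x x' → Rel E p (act σ h x) (act σ h x')
  | glue_congr (a b : ℕ) {c₁ c₂ c : Vertex t} (h : IsGlue a b c₁ c₂ c) {i j l : ℤ}
      (hl : i + j + p.deg = l) {x x' : Term E p c₁ i} {y y' : Term E p c₂ j} :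
      Rel E p x x' → Rel E p y y' → Rel E p (glue a b h hl x y) (glue a b h hl x' y')
  | loop_congr (a b : ℕ) {c₁ c : Vertex t} (h : IsLoop a b c₁ c) {i l : ℤ}
      (hl : i + p.deg = l) {x x' : Term E p c₁ i} :
      Rel E p x x' → Rel E p (loop a b h hl x) (loop a b h hl x')
  -- vector spaces
  | add_comm {c : Vertex t} {i : ℤ} (x y : Term E p c i) : Rel E p (add x y) (add y x)
  | add_assoc {c : Vertex t} {i : ℤ} (x y z : Term E p c i) :
      Rel E p (add (add x y) z) (add x (add y z))
  | zero_add {c : Vertex t} {i : ℤ} (x : Term E p c i) : Rel E p (add zero x) x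
  | neg_add {c : Vertex t} {i : ℤ} (x : Term E p c i) : Rel E p (add (smul (-1) x) x) zero
  | smul_add {c : Vertex t} {i : ℤ} (r : k) (x y : Term E p c i) :
      Rel E p (smul r (add x y)) (add (smul r x) (smul r y))
  | add_smul {c : Vertex t} {i : ℤ} (r s : k) (x : Term E p c i) :
      Rel E p (smul (r + s) x) (add (smul r x) (smul s x))
  | mul_smul {c : Vertex t} {i : ℤ} (r s : k) (x : Term E p c i) :
      Rel E p (smul (r * s) x) (smul r (smul s x))
  | one_smul {c : Vertex t} {i : ℤ} (x : Term E p c i) : Rel E p (smul 1 x) x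
  -- linearity of the generators and of the operations
  | gen_add {c : Vertex t} {i : ℤ} (x y : E.obj c i) :
      Rel E p (gen (x + y)) (add (gen x) (gen y))
  | gen_smul {c : Vertex t} {i : ℤ} (r : k) (x : E.obj c i) :
      Rel E p (gen (r • x)) (smul r (gen x))
  | d_add {c : Vertex t} {i j : ℤ} (h : i + 1 = j) (x y : Term E p c i) :
      Rel E p (d h (add x y)) (add (d h x) (d h y))
  | d_smul {c : Vertex t} {i j : ℤ} (h : i + 1 = j) (r : k) (x : Term E p c i) :
      Rel E p (d h (smul r x)) (smul r (d h x))
  | act_add (σ : Equiv.Perm ℕ) {c c' : Vertex t} (h : IsRelabel σ c c') {i : ℤ}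
      (x y : Term E p c i) : Rel E p (act σ h (add x y)) (add (act σ h x) (act σ h y))
  | act_smul (σ : Equiv.Perm ℕ) {c c' : Vertex t} (h : IsRelabel σ c c') {i : ℤ} (r : k)
      (x : Term E p c i) : Rel E p (act σ h (smul r x)) (smul r (act σ h x))
  | glue_add_left (a b : ℕ) {c₁ c₂ c : Vertex t} (h : IsGlue a b c₁ c₂ c) {i j l : ℤ}
      (hl : i + j + p.deg = l) (x x' : Term E p c₁ i) (y : Term E p c₂ j) :
      Rel E p (glue a b h hl (add x x') y) (add (glue a b h hl x y) (glue a b h hl x' y))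
  | glue_smul_left (a b : ℕ) {c₁ c₂ c : Vertex t} (h : IsGlue a b c₁ c₂ c) {i j l : ℤ}
      (hl : i + j + p.deg = l) (r : k) (x : Term E p c₁ i) (y : Term E p c₂ j) :
      Rel E p (glue a b h hl (smul r x) y) (smul r (glue a b h hl x y))
  | glue_add_right (a b : ℕ) {c₁ c₂ c : Vertex t} (h : IsGlue a b c₁ c₂ c) {i j l : ℤ}
      (hl : i + j + p.deg = l) (x : Term E p c₁ i) (y y' : Term E p c₂ j) :
      Rel E p (glue a b h hl x (add y y')) (add (glue a b h hl x y) (glue a b h hl x y'))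
  | glue_smul_right (a b : ℕ) {c₁ c₂ c : Vertex t} (h : IsGlue a b c₁ c₂ c) {i j l : ℤ}
      (hl : i + j + p.deg = l) (r : k) (x : Term E p c₁ i) (y : Term E p c₂ j) :
      Rel E p (glue a b h hl x (smul r y)) (smul r (glue a b h hl x y))
  | loop_add (a b : ℕ) {c₁ c : Vertex t} (h : IsLoop a b c₁ c) {i l : ℤ}
      (hl : i + p.deg = l) (x y : Term E p c₁ i) :
      Rel E p (loop a b h hl (add x y)) (add (loop a b h hl x) (loop a b h hl y))
  | loop_smul (a b : ℕ) {c₁ c : Vertex t} (h : IsLoop a b c₁ c) {i l : ℤ}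
      (hl : i + p.deg = l) (r : k) (x : Term E p c₁ i) :
      Rel E p (loop a b h hl (smul r x)) (smul r (loop a b h hl x))
  -- equivariance of the generators
  | act_gen (σ : Equiv.Perm ℕ) {c c' : Vertex t} (h : IsRelabel σ c c') {i : ℤ}
      (x : E.obj c i) : Rel E p (act σ h (gen x)) (gen (E.act σ h x))
  -- axioms of a dg operad
  | d_d {c : Vertex t} {i j l : ℤ} (h : i + 1 = j) (h' : j + 1 = l) (x : Term E p c i) :
      Rel E p (d h' (d h x)) zero
  | act_id (σ : Equiv.Perm ℕ) {c : Vertex t} (h : IsRelabel σ c c) {i : ℤ}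
      (x : Term E p c i) : (∀ m ∈ c.legs, σ m = m) → Rel E p (act σ h x) x
  | act_act (σ τ : Equiv.Perm ℕ) {c c' c'' : Vertex t} (h : IsRelabel σ c c')
      (h' : IsRelabel τ c' c'') (h'' : IsRelabel (τ * σ) c c'') {i : ℤ} (x : Term E p c i) :
      Rel E p (act τ h' (act σ h x)) (act (τ * σ) h'' x)
  | act_d (σ : Equiv.Perm ℕ) {c c' : Vertex t} (h : IsRelabel σ c c') {i j : ℤ}
      (hij : i + 1 = j) (x : Term E p c i) :
      Rel E p (act σ h (d hij x)) (d hij (act σ h x))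
  | act_glue (σ : Equiv.Perm ℕ) {a b : ℕ} {c₁ c₂ c c₁' c₂' c' : Vertex t}
      (h : IsGlue a b c₁ c₂ c) (h' : IsGlue (σ a) (σ b) c₁' c₂' c') (h₁ : IsRelabel σ c₁ c₁')
      (h₂ : IsRelabel σ c₂ c₂') (h₀ : IsRelabel σ c c') {i j l : ℤ} (hl : i + j + p.deg = l)
      (x : Term E p c₁ i) (y : Term E p c₂ j) :
      Rel E p (act σ h₀ (glue a b h hl x y))
        (glue (σ a) (σ b) h' hl (act σ h₁ x) (act σ h₂ y))
  | act_loop (σ : Equiv.Perm ℕ) {a b : ℕ} {c₁ c c₁' c' : Vertex t}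
      (h : IsLoop a b c₁ c) (h' : IsLoop (σ a) (σ b) c₁' c') (h₁ : IsRelabel σ c₁ c₁')
      (h₀ : IsRelabel σ c c') {i l : ℤ} (hl : i + p.deg = l) (x : Term E p c₁ i) :
      Rel E p (act σ h₀ (loop a b h hl x)) (loop (σ a) (σ b) h' hl (act σ h₁ x))
  | d_glue {a b : ℕ} {c₁ c₂ c : Vertex t} (h : IsGlue a b c₁ c₂ c) {i j i' j' l l' : ℤ}
      (hl : i + j + p.deg = l) (hi : i + 1 = i') (hj : j + 1 = j') (hl' : l + 1 = l')
      (h₁ : i' + j + p.deg = l') (h₂ : i + j' + p.deg = l') (x : Term E p c₁ i)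
      (y : Term E p c₂ j) :
      Rel E p (d hl' (glue a b h hl x y))
        (smul (sgn k p.deg)
          (add (glue a b h h₁ (d hi x) y) (smul (sgn k i) (glue a b h h₂ x (d hj y)))))
  | d_loop {a b : ℕ} {c₁ c : Vertex t} (h : IsLoop a b c₁ c) {i i' l l' : ℤ}
      (hl : i + p.deg = l) (hi : i + 1 = i') (hl' : l + 1 = l') (h₁ : i' + p.deg = l')
      (x : Term E p c₁ i) :
      Rel E p (d hl' (loop a b h hl x)) (smul (sgn k p.deg) (loop a b h h₁ (d hi x)))
  | glue_symm {a b : ℕ} {c₁ c₂ c : Vertex t} (h : IsGlue a b c₁ c₂ c)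
      (h' : IsGlue b a c₂ c₁ c) {i j l : ℤ} (hl : i + j + p.deg = l)
      (hl' : j + i + p.deg = l) (x : Term E p c₁ i) (y : Term E p c₂ j) :
      Rel E p (glue b a h' hl' y x) (smul (sgn k (i * j)) (glue a b h hl x y))
  | loop_symm {a b : ℕ} {c₁ c : Vertex t} (h : IsLoop a b c₁ c) (h' : IsLoop b a c₁ c)
      {i l : ℤ} (hl : i + p.deg = l) (x : Term E p c₁ i) :
      Rel E p (loop b a h' hl x) (loop a b h hl x)
  | glue_glue {a b u v : ℕ} {c₁ c₂ c₃ c₁₂ c₂₃ c : Vertex t} (h₁₂ : IsGlue a b c₁ c₂ c₁₂)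
      (h₁ : IsGlue u v c₁₂ c₃ c) (h₂₃ : IsGlue u v c₂ c₃ c₂₃) (h₃ : IsGlue a b c₁ c₂₃ c)
      {i j l m n r : ℤ} (hm : i + j + p.deg = m) (hr : m + l + p.deg = r)
      (hn : j + l + p.deg = n) (hr' : i + n + p.deg = r)
      (x : Term E p c₁ i) (y : Term E p c₂ j) (z : Term E p c₃ l) :
      Rel E p (glue u v h₁ hr (glue a b h₁₂ hm x y) z)
        (smul (sgn k (p.deg * (i + 1))) (glue a b h₃ hr' x (glue u v h₂₃ hn y z)))
  | loop_loop {a b u v : ℕ} {c c₁ c₂ c' : Vertex t} (h₁ : IsLoop a b c c₁)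
      (h₁' : IsLoop u v c₁ c') (h₂ : IsLoop u v c c₂) (h₂' : IsLoop a b c₂ c')
      {i l r : ℤ} (hl : i + p.deg = l) (hr : l + p.deg = r) (x : Term E p c i) :
      Rel E p (loop u v h₁' hr (loop a b h₁ hl x))
        (smul (sgn k p.deg) (loop a b h₂' hr (loop u v h₂ hl x)))
  | loop_glue {a b u v : ℕ} {c₁ c₂ c₁₂ c₁' c : Vertex t} (h : IsGlue a b c₁ c₂ c₁₂)
      (h' : IsLoop u v c₁₂ c) (h₁ : IsLoop u v c₁ c₁') (h₁' : IsGlue a b c₁' c₂ c)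
      {i j l m r : ℤ} (hl : i + j + p.deg = l) (hr : l + p.deg = r)
      (hm : i + p.deg = m) (hr' : m + j + p.deg = r) (x : Term E p c₁ i)
      (y : Term E p c₂ j) :
      Rel E p (loop u v h' hr (glue a b h hl x y))
        (smul (sgn k p.deg) (glue a b h₁' hr' (loop u v h₁ hm x) y))
  | loop_glue' {a b u v : ℕ} {c₁ c₂ c₁₂ c₁₂' c : Vertex t} (h : IsGlue a b c₁ c₂ c₁₂)
      (h₁ : IsLoop u v c₁₂ c) (h' : IsGlue u v c₁ c₂ c₁₂') (h₁' : IsLoop a b c₁₂' c)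
      {i j l r : ℤ} (hl : i + j + p.deg = l) (hr : l + p.deg = r)
      (x : Term E p c₁ i) (y : Term E p c₂ j) :
      Rel E p (loop u v h₁ hr (glue a b h hl x y))
        (smul (sgn k p.deg) (loop a b h₁' hr (glue u v h' hl x y)))

/-- Equality of formal expressions modulo the axioms. -/
def Term.setoid (E : VMod k t) (p : Parity) (c : Vertex t) (i : ℤ) : Setoid (Term E p c i) where
  r := Term.Rel E p
  iseqv := ⟨Rel.refl, Rel.symm, Rel.trans⟩

/-- The components of the dg operad freely generated by a graded module over the groupoid of
vertices. -/
def FreeObj (E : VMod k t) (p : Parity) (c : Vertex t) (i : ℤ) : Type u :=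
  Quotient (Term.setoid E p c i)

namespace FreeObj

variable {E : VMod k t} {p : Parity}

/-- The class of a formal expression. -/
def mk {c : Vertex t} {i : ℤ} (x : Term E p c i) : FreeObj E p c i :=
  Quotient.mk (Term.setoid E p c i) x

theorem sound {c : Vertex t} {i : ℤ} {x y : Term E p c i} (h : Term.Rel E p x y) :
    mk x = mk y :=
  Quotient.sound (s := Term.setoid E p c i) h

theorem ind {c : Vertex t} {i : ℤ} {motive : FreeObj E p c i → Prop}
    (h : ∀ x : Term E p c i, motive (mk x)) (x : FreeObj E p c i) : motive x :=
  Quotient.inductionOn x h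

instance (c : Vertex t) (i : ℤ) : Zero (FreeObj E p c i) := ⟨mk Term.zero⟩

instance (c : Vertex t) (i : ℤ) : Add (FreeObj E p c i) :=
  ⟨Quotient.map₂ Term.add fun _ _ h _ _ h' => Term.Rel.add_congr h h'⟩

instance (c : Vertex t) (i : ℤ) : SMul k (FreeObj E p c i) :=
  ⟨fun r => Quotient.map (Term.smul r) fun _ _ h => Term.Rel.smul_congr r h⟩

instance (c : Vertex t) (i : ℤ) : Neg (FreeObj E p c i) := ⟨fun x => (-1 : k) • x⟩

instance addCommGroup (c : Vertex t) (i : ℤ) : AddCommGroup (FreeObj E p c i) where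
  add_assoc := ind fun x => ind fun y => ind fun z => sound (.add_assoc x y z)
  zero_add := ind fun x => sound (.zero_add x)
  add_zero := ind fun x => sound (.trans (.add_comm _ _) (.zero_add x))
  add_comm := ind fun x => ind fun y => sound (.add_comm x y)
  neg_add_cancel := ind fun x => sound (.neg_add x)
  nsmul := nsmulRec
  zsmul := zsmulRec

instance module (c : Vertex t) (i : ℤ) : Module k (FreeObj E p c i) :=
  Module.ofMinimalAxioms (fun r => ind fun x => ind fun y => sound (.smul_add r x y))
    (fun r s => ind fun x => sound (.add_smul r s x))
    (fun r s => ind fun x => sound (.mul_smul r s x))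
    (ind fun x => sound (.one_smul x))

/-- The inclusion of the generators. -/
def gen (c : Vertex t) (i : ℤ) : E.obj c i →ₗ[k] FreeObj E p c i where
  toFun x := mk (.gen x)
  map_add' x y := sound (.gen_add x y)
  map_smul' r x := sound (.gen_smul r x)

end FreeObj

/-- The dg operad freely generated by the graded module over the groupoid of vertices that
underlies `E` (the differential of `E` is not used). -/
def freeDG (E : VMod k t) (p : Parity) : Operad k t p where
  obj := FreeObj E p
  d h :=
    { toFun := Quotient.map (Term.d h) fun _ _ r => .d_congr h r
      map_add' := FreeObj.ind fun x => FreeObj.ind fun y => FreeObj.sound (.d_add h x y)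
      map_smul' := fun r => FreeObj.ind fun x => FreeObj.sound (.d_smul h r x) }
  act σ {_ _} h {_} :=
    { toFun := Quotient.map (Term.act σ h) fun _ _ r => .act_congr σ h r
      map_add' := FreeObj.ind fun x => FreeObj.ind fun y => FreeObj.sound (.act_add σ h x y)
      map_smul' := fun r => FreeObj.ind fun x => FreeObj.sound (.act_smul σ h r x) }
  glue a b {_ _ _} h {_ _ _} hl :=
    LinearMap.mk₂ k
      (Quotient.map₂ (Term.glue a b h hl) fun _ _ r _ _ r' => .glue_congr a b h hl r r')
      (FreeObj.ind fun x => FreeObj.ind fun x' => FreeObj.ind fun y =>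
        FreeObj.sound (.glue_add_left a b h hl x x' y))
      (fun r => FreeObj.ind fun x => FreeObj.ind fun y =>
        FreeObj.sound (.glue_smul_left a b h hl r x y))
      (FreeObj.ind fun x => FreeObj.ind fun y => FreeObj.ind fun y' =>
        FreeObj.sound (.glue_add_right a b h hl x y y'))
      (fun r => FreeObj.ind fun x => FreeObj.ind fun y =>
        FreeObj.sound (.glue_smul_right a b h hl r x y))
  loop a b {_ _} h {_ _} hl :=
    { toFun := Quotient.map (Term.loop a b h hl) fun _ _ r => .loop_congr a b h hl r
      map_add' := FreeObj.ind fun x => FreeObj.ind fun y =>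
        FreeObj.sound (.loop_add a b h hl x y)
      map_smul' := fun r => FreeObj.ind fun x => FreeObj.sound (.loop_smul a b h hl r x) }
  d_d h h' := FreeObj.ind fun x => FreeObj.sound (.d_d h h' x)
  act_id σ {_} h {_} := FreeObj.ind fun x hσ => FreeObj.sound (.act_id σ h x hσ)
  act_act σ τ {_ _ _} h h' h'' {_} := FreeObj.ind fun x =>
    FreeObj.sound (.act_act σ τ h h' h'' x)
  act_d σ {_ _} h {_ _} hij := FreeObj.ind fun x => FreeObj.sound (.act_d σ h hij x)
  act_glue σ {_ _ _ _ _ _ _ _} h h' h₁ h₂ h₀ {_ _ _} hl := FreeObj.ind fun x =>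
    FreeObj.ind fun y => FreeObj.sound (.act_glue σ h h' h₁ h₂ h₀ hl x y)
  act_loop σ {_ _ _ _ _ _} h h' h₁ h₀ {_ _} hl := FreeObj.ind fun x =>
    FreeObj.sound (.act_loop σ h h' h₁ h₀ hl x)
  d_glue {_ _ _ _ _} h {_ _ _ _ _ _} hl hi hj hl' h₁ h₂ := FreeObj.ind fun x => FreeObj.ind fun y =>
    FreeObj.sound (.d_glue h hl hi hj hl' h₁ h₂ x y)
  d_loop {_ _ _ _} h {_ _ _ _} hl hi hl' h₁ := FreeObj.ind fun x =>
    FreeObj.sound (.d_loop h hl hi hl' h₁ x)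
  glue_symm {_ _ _ _ _} h h' {_ _ _} hl hl' := FreeObj.ind fun x => FreeObj.ind fun y =>
    FreeObj.sound (.glue_symm h h' hl hl' x y)
  loop_symm {_ _ _ _} h h' {_ _} hl := FreeObj.ind fun x => FreeObj.sound (.loop_symm h h' hl x)
  glue_glue {_ _ _ _ _ _ _ _ _ _} h₁₂ h₁ h₂₃ h₃ {_ _ _ _ _ _} hm hr hn hr' := FreeObj.ind fun x =>
    FreeObj.ind fun y => FreeObj.ind fun z =>
      FreeObj.sound (.glue_glue h₁₂ h₁ h₂₃ h₃ hm hr hn hr' x y z)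
  loop_loop {_ _ _ _ _ _ _ _} h₁ h₁' h₂ h₂' {_ _ _} hl hr := FreeObj.ind fun x =>
    FreeObj.sound (.loop_loop h₁ h₁' h₂ h₂' hl hr x)
  loop_glue {_ _ _ _ _ _ _ _ _} h h' h₁ h₁' {_ _ _ _ _} hl hr hm hr' := FreeObj.ind fun x =>
    FreeObj.ind fun y => FreeObj.sound (.loop_glue h h' h₁ h₁' hl hr hm hr' x y)
  loop_glue' {_ _ _ _ _ _ _ _ _} h h₁ h' h₁' {_ _ _ _} hl hr := FreeObj.ind fun x =>
    FreeObj.ind fun y => FreeObj.sound (.loop_glue' h h₁ h' h₁' hl hr x y)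

/-- The inclusion of the generators. -/
def freeDG.gen (E : VMod k t) (p : Parity) (c : Vertex t) (i : ℤ) :
    E.obj c i →ₗ[k] (freeDG E p).obj c i :=
  FreeObj.gen c i

theorem freeDG.act_gen (E : VMod k t) (p : Parity) (σ : Equiv.Perm ℕ) {c c' : Vertex t}
    (h : IsRelabel σ c c') {i : ℤ} (x : E.obj c i) :
    (freeDG E p).act σ h (freeDG.gen E p c i x) = freeDG.gen E p c' i (E.act σ h x) :=
  FreeObj.sound (.act_gen σ h x)

section Lift

variable {E : VMod k t} {p : Parity} {Q : Operad k t p}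

/-- The value of a formal expression, given values of the generators. -/
def Term.eval (γ : ∀ c i, E.obj c i →ₗ[k] Q.obj c i) :
    ∀ {c : Vertex t} {i : ℤ}, Term E p c i → Q.obj c i
  | _, _, .gen x => γ _ _ x
  | _, _, .zero => 0
  | _, _, .add x y => Term.eval γ x + Term.eval γ y
  | _, _, .smul r x => r • Term.eval γ x
  | _, _, .d h x => Q.d h (Term.eval γ x)
  | _, _, .act σ h x => Q.act σ h (Term.eval γ x)
  | _, _, .glue a b h hl x y => Q.glue a b h hl (Term.eval γ x) (Term.eval γ y)
  | _, _, .loop a b h hl x => Q.loop a b h hl (Term.eval γ x)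

theorem Term.eval_rel (γ : ∀ c i, E.obj c i →ₗ[k] Q.obj c i)
    (hγ : ∀ (σ : Equiv.Perm ℕ) {c c' : Vertex t} (h : IsRelabel σ c c') {i : ℤ}
      (x : E.obj c i), Q.act σ h (γ c i x) = γ c' i (E.act σ h x))
    {c : Vertex t} {i : ℤ} {x y : Term E p c i} (h : Term.Rel E p x y) :
    Term.eval γ x = Term.eval γ y := by
  induction h with
  | refl => rfl
  | symm _ ih => exact ih.symm
  | trans _ _ ih ih' => exact ih.trans ih'
  | add_congr _ _ ih ih' => simp only [Term.eval, ih, ih']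
  | smul_congr _ _ ih => simp only [Term.eval, ih]
  | d_congr _ _ ih => simp only [Term.eval, ih]
  | act_congr _ _ _ ih => simp only [Term.eval, ih]
  | glue_congr _ _ _ _ _ _ ih ih' => simp only [Term.eval, ih, ih']
  | loop_congr _ _ _ _ _ ih => simp only [Term.eval, ih]
  | add_comm => exact _root_.add_comm _ _
  | add_assoc => exact _root_.add_assoc _ _ _
  | zero_add => exact _root_.zero_add _
  | neg_add => simp [Term.eval]
  | smul_add => exact _root_.smul_add _ _ _
  | add_smul => exact _root_.add_smul _ _ _
  | mul_smul => exact SemigroupAction.mul_smul _ _ _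
  | one_smul => exact _root_.one_smul _ _
  | gen_add => simp [Term.eval]
  | gen_smul => simp [Term.eval]
  | d_add => simp [Term.eval]
  | d_smul => simp [Term.eval]
  | act_add => simp [Term.eval]
  | act_smul => simp [Term.eval]
  | glue_add_left => simp [Term.eval]
  | glue_smul_left => simp [Term.eval]
  | glue_add_right => simp [Term.eval]
  | glue_smul_right => simp [Term.eval]
  | loop_add => simp [Term.eval]
  | loop_smul => simp [Term.eval]
  | act_gen σ h x => exact hγ σ h x
  | d_d => exact Q.d_d _ _ _
  | act_id _ _ _ h => exact Q.act_id _ _ _ h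
  | act_act => exact Q.act_act _ _ _ _ _ _
  | act_d => exact Q.act_d _ _ _ _
  | act_glue => exact Q.act_glue _ _ _ _ _ _ _ _ _
  | act_loop => exact Q.act_loop _ _ _ _ _ _ _
  | d_glue => exact Q.d_glue _ _ _ _ _ _ _ _ _
  | d_loop => exact Q.d_loop _ _ _ _ _ _
  | glue_symm => exact Q.glue_symm _ _ _ _ _ _
  | loop_symm => exact Q.loop_symm _ _ _ _
  | glue_glue => exact Q.glue_glue _ _ _ _ _ _ _ _ _ _ _
  | loop_loop => exact Q.loop_loop _ _ _ _ _ _ _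
  | loop_glue => exact Q.loop_glue _ _ _ _ _ _ _ _ _ _
  | loop_glue' => exact Q.loop_glue' _ _ _ _ _ _ _ _

/-- The universal property of the free dg operad. -/
def freeDG.lift (γ : ∀ c i, E.obj c i →ₗ[k] Q.obj c i)
    (hγ : ∀ (σ : Equiv.Perm ℕ) {c c' : Vertex t} (h : IsRelabel σ c c') {i : ℤ}
      (x : E.obj c i), Q.act σ h (γ c i x) = γ c' i (E.act σ h x)) :
    freeDG E p ⟶ Q where
  app c i :=
    { toFun := Quotient.lift (s := Term.setoid E p c i) (Term.eval γ)
        fun _ _ r => Term.eval_rel γ hγ r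
      map_add' := FreeObj.ind fun _ => FreeObj.ind fun _ => rfl
      map_smul' := fun _ => FreeObj.ind fun _ => rfl }
  app_d _ := FreeObj.ind fun _ => rfl
  app_act _ _ _ _ _ := FreeObj.ind fun _ => rfl
  app_glue _ _ _ _ _ := FreeObj.ind fun _ => FreeObj.ind fun _ => rfl
  app_loop _ _ _ _ := FreeObj.ind fun _ => rfl

theorem freeDG.hom_ext {f g : freeDG E p ⟶ Q}
    (h : ∀ c i (x : E.obj c i), f.app c i (freeDG.gen E p c i x) =
      g.app c i (freeDG.gen E p c i x)) : f = g := by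
  apply Operad.hom_ext
  intro c i
  refine FreeObj.ind fun x => ?_
  induction x with
  | gen x => exact h _ _ x
  | zero => exact (map_zero (f.app _ _)).trans (map_zero (g.app _ _)).symm
  | add x y ih ih' =>
    exact ((map_add (f.app _ _) (FreeObj.mk x) (FreeObj.mk y)).trans
      (congrArg₂ (· + ·) ih ih')).trans (map_add (g.app _ _) (FreeObj.mk x) (FreeObj.mk y)).symm
  | smul r x ih =>
    exact ((map_smul (f.app _ _) r (FreeObj.mk x)).trans
      (congrArg (r • ·) ih)).trans (map_smul (g.app _ _) r (FreeObj.mk x)).symm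
  | d h x ih =>
    exact ((f.app_d h (FreeObj.mk x)).trans (congrArg (Q.d h) ih)).trans
      (g.app_d h (FreeObj.mk x)).symm
  | act σ h x ih =>
    exact ((f.app_act σ h (FreeObj.mk x)).trans (congrArg (Q.act σ h) ih)).trans
      (g.app_act σ h (FreeObj.mk x)).symm
  | glue a b h hl x y ih ih' =>
    exact ((f.app_glue h hl (FreeObj.mk x) (FreeObj.mk y)).trans
      (congrArg₂ (fun u v => Q.glue a b h hl u v) ih ih')).trans
      (g.app_glue h hl (FreeObj.mk x) (FreeObj.mk y)).symm
  | loop a b h hl x ih =>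
    exact ((f.app_loop h hl (FreeObj.mk x)).trans (congrArg (Q.loop a b h hl) ih)).trans
      (g.app_loop h hl (FreeObj.mk x)).symm

end Lift

end Free

section Quot

variable {k : Type u} [Field k] {t : Kind} {p : Parity}

/-- The elements of the dg ideal of `P` generated by the elements in `r`. -/
inductive Operad.InIdeal (P : Operad k t p) (r : ∀ c i, Set (P.obj c i)) :
    ∀ {c : Vertex t} {i : ℤ}, P.obj c i → Prop
  | of {c : Vertex t} {i : ℤ} {x : P.obj c i} : x ∈ r c i → InIdeal P r x
  | zero {c : Vertex t} {i : ℤ} : InIdeal P r (0 : P.obj c i)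
  | add {c : Vertex t} {i : ℤ} {x y : P.obj c i} :
      InIdeal P r x → InIdeal P r y → InIdeal P r (x + y)
  | smul {c : Vertex t} {i : ℤ} (s : k) {x : P.obj c i} : InIdeal P r x → InIdeal P r (s • x)
  | d {c : Vertex t} {i j : ℤ} (h : i + 1 = j) {x : P.obj c i} :
      InIdeal P r x → InIdeal P r (P.d h x)
  | act (σ : Equiv.Perm ℕ) {c c' : Vertex t} (h : IsRelabel σ c c') {i : ℤ} {x : P.obj c i} :
      InIdeal P r x → InIdeal P r (P.act σ h x)
  | glue_left {a b : ℕ} {c₁ c₂ c : Vertex t} (h : IsGlue a b c₁ c₂ c) {i j l : ℤ}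
      (hl : i + j + p.deg = l) {x : P.obj c₁ i} (y : P.obj c₂ j) :
      InIdeal P r x → InIdeal P r (P.glue a b h hl x y)
  | glue_right {a b : ℕ} {c₁ c₂ c : Vertex t} (h : IsGlue a b c₁ c₂ c) {i j l : ℤ}
      (hl : i + j + p.deg = l) (x : P.obj c₁ i) {y : P.obj c₂ j} :
      InIdeal P r y → InIdeal P r (P.glue a b h hl x y)
  | loop {a b : ℕ} {c₁ c : Vertex t} (h : IsLoop a b c₁ c) {i l : ℤ}
      (hl : i + p.deg = l) {x : P.obj c₁ i} :
      InIdeal P r x → InIdeal P r (P.loop a b h hl x)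

/-- The dg ideal of `P` generated by the elements in `r`. -/
def Operad.ideal (P : Operad k t p) (r : ∀ c i, Set (P.obj c i)) (c : Vertex t) (i : ℤ) :
    Submodule k (P.obj c i) where
  carrier := {x | P.InIdeal r x}
  add_mem' h h' := .add h h'
  zero_mem' := .zero
  smul_mem' s _ h := .smul s h

theorem quotInd {V : Type u} [AddCommGroup V] [Module k V] {W : Submodule k V}
    {motive : V ⧸ W → Prop} (h : ∀ x : V, motive (Submodule.Quotient.mk x)) (x : V ⧸ W) :
    motive x :=
  Submodule.Quotient.induction_on W x h

/-- The quotient of a dg operad by the dg ideal generated by the elements in `r`. -/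
def Operad.quot (P : Operad k t p) (r : ∀ c i, Set (P.obj c i)) : Operad k t p where
  obj c i := P.obj c i ⧸ P.ideal r c i
  d {c i j} h := (P.ideal r c i).mapQ (P.ideal r c j) (P.d h) fun _ hx => .d h hx
  act σ {c c'} h {i} :=
    (P.ideal r c i).mapQ (P.ideal r c' i) (P.act σ h) fun _ hx => .act σ h hx
  glue a b {c₁ c₂ c} h {i j l} hl :=
    (P.ideal r c₁ i).liftQ
      (LinearMap.flip ((P.ideal r c₂ j).liftQ
        (LinearMap.flip ((P.glue a b h hl).compr₂ (P.ideal r c l).mkQ))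
        (fun y hy => by
          ext x
          exact (Submodule.Quotient.mk_eq_zero _).2 (.glue_right h hl x hy))))
      (fun x hx => by
        ext y
        exact (Submodule.Quotient.mk_eq_zero _).2 (.glue_left h hl y hx))
  loop a b {c₁ c} h {i l} hl :=
    (P.ideal r c₁ i).mapQ (P.ideal r c l) (P.loop a b h hl) fun _ hx => .loop h hl hx
  d_d h h' := quotInd fun x => congrArg (Submodule.Quotient.mk) (P.d_d h h' x)
  act_id σ {_} h {_} := quotInd fun x hσ =>
    congrArg (Submodule.Quotient.mk) (P.act_id σ h x hσ)
  act_act σ τ {_ _ _} h h' h'' {_} := quotInd fun x =>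
    congrArg (Submodule.Quotient.mk) (P.act_act σ τ h h' h'' x)
  act_d σ {_ _} h {_ _} hij := quotInd fun x =>
    congrArg (Submodule.Quotient.mk) (P.act_d σ h hij x)
  act_glue σ {_ _ _ _ _ _ _ _} h h' h₁ h₂ h₀ {_ _ _} hl := quotInd fun x =>
    quotInd fun y =>
      congrArg (Submodule.Quotient.mk) (P.act_glue σ h h' h₁ h₂ h₀ hl x y)
  act_loop σ {_ _ _ _ _ _} h h' h₁ h₀ {_ _} hl := quotInd fun x =>
    congrArg (Submodule.Quotient.mk) (P.act_loop σ h h' h₁ h₀ hl x)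
  d_glue {_ _ _ _ _} h {_ _ _ _ _ _} hl hi hj hl' h₁ h₂ := quotInd fun x =>
    quotInd fun y =>
      congrArg (Submodule.Quotient.mk) (P.d_glue h hl hi hj hl' h₁ h₂ x y)
  d_loop {_ _ _ _} h {_ _ _ _} hl hi hl' h₁ := quotInd fun x =>
    congrArg (Submodule.Quotient.mk) (P.d_loop h hl hi hl' h₁ x)
  glue_symm {_ _ _ _ _} h h' {_ _ _} hl hl' := quotInd fun x =>
    quotInd fun y =>
      congrArg (Submodule.Quotient.mk) (P.glue_symm h h' hl hl' x y)
  loop_symm {_ _ _ _} h h' {_ _} hl := quotInd fun x =>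
    congrArg (Submodule.Quotient.mk) (P.loop_symm h h' hl x)
  glue_glue {_ _ _ _ _ _ _ _ _ _} h₁₂ h₁ h₂₃ h₃ {_ _ _ _ _ _} hm hr hn hr' := quotInd fun x =>
    quotInd fun y => quotInd fun z =>
      congrArg (Submodule.Quotient.mk) (P.glue_glue h₁₂ h₁ h₂₃ h₃ hm hr hn hr' x y z)
  loop_loop {_ _ _ _ _ _ _ _} h₁ h₁' h₂ h₂' {_ _ _} hl hr := quotInd fun x =>
    congrArg (Submodule.Quotient.mk) (P.loop_loop h₁ h₁' h₂ h₂' hl hr x)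
  loop_glue {_ _ _ _ _ _ _ _ _} h h' h₁ h₁' {_ _ _ _ _} hl hr hm hr' := quotInd fun x =>
    quotInd fun y =>
      congrArg (Submodule.Quotient.mk) (P.loop_glue h h' h₁ h₁' hl hr hm hr' x y)
  loop_glue' {_ _ _ _ _ _ _ _ _} h h₁ h' h₁' {_ _ _ _} hl hr := quotInd fun x =>
    quotInd fun y =>
      congrArg (Submodule.Quotient.mk) (P.loop_glue' h h₁ h' h₁' hl hr x y)

/-- The projection to the quotient. -/
def Operad.proj (P : Operad k t p) (r : ∀ c i, Set (P.obj c i)) : P ⟶ P.quot r where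
  app c i := (P.ideal r c i).mkQ
  app_d _ _ := rfl
  app_act _ _ _ _ _ _ := rfl
  app_glue _ _ _ _ _ _ _ := rfl
  app_loop _ _ _ _ _ := rfl

theorem Operad.proj_eq_zero (P : Operad k t p) {r : ∀ c i, Set (P.obj c i)} {c : Vertex t}
    {i : ℤ} {x : P.obj c i} (h : x ∈ r c i) : (P.proj r).app c i x = 0 :=
  (Submodule.Quotient.mk_eq_zero _).2 (.of h)

/-- The universal property of the quotient. -/
def Operad.desc {P Q : Operad k t p} {r : ∀ c i, Set (P.obj c i)} (f : P ⟶ Q)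
    (hf : ∀ c i, ∀ x ∈ r c i, f.app c i x = 0) : P.quot r ⟶ Q where
  app c i := (P.ideal r c i).liftQ (f.app c i) fun x hx => by
    change f.app c i x = 0
    have hx' : P.InIdeal r x := hx
    clear hx
    induction hx' with
    | of h => exact hf _ _ _ h
    | zero => exact map_zero _
    | add _ _ ih ih' => rw [map_add, ih, ih', add_zero]
    | smul s _ ih => rw [map_smul, ih, smul_zero]
    | d h _ ih => rw [f.app_d, ih, map_zero]
    | act σ h _ ih => rw [f.app_act, ih, map_zero]
    | glue_left h hl y _ ih => rw [f.app_glue, ih, map_zero, LinearMap.zero_apply]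
    | glue_right h hl x _ ih => rw [f.app_glue, ih, map_zero]
    | loop h hl _ ih => rw [f.app_loop, ih, map_zero]
  app_d h := quotInd fun x => f.app_d h x
  app_act σ _ _ h _ := quotInd fun x => f.app_act σ h x
  app_glue h _ _ _ hl := quotInd fun x => quotInd fun y =>
    f.app_glue h hl x y
  app_loop h _ _ hl := quotInd fun x => f.app_loop h hl x

theorem Operad.proj_desc {P Q : Operad k t p} {r : ∀ c i, Set (P.obj c i)} (f : P ⟶ Q)
    (hf : ∀ c i, ∀ x ∈ r c i, f.app c i x = 0) : P.proj r ≫ Operad.desc f hf = f := rfl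

theorem Operad.quot_hom_ext {P Q : Operad k t p} {r : ∀ c i, Set (P.obj c i)}
    {f g : P.quot r ⟶ Q} (h : P.proj r ≫ f = P.proj r ≫ g) : f = g := by
  apply Operad.hom_ext
  intro c i
  exact quotInd fun x => congrArg (fun e => Operad.Hom.app e c i x) h

end Quot

/-! ### The Feynman transform -/

section Contract

variable {k : Type u} [Field k] {V W V' W' M N : Type u} [AddCommGroup V] [Module k V]
  [AddCommGroup W] [Module k W] [AddCommGroup V'] [Module k V'] [AddCommGroup W'] [Module k W']
  [AddCommGroup M] [Module k M] [AddCommGroup N] [Module k N]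

/-- For finite dimensional `V` and `W`, the image under `m` of the element of `V* ⊗ W*` that
corresponds to the bilinear form `B`. (It does not depend on the bases.) -/
noncomputable def contract (B : V →ₗ[k] W →ₗ[k] k)
    (m : Module.Dual k V →ₗ[k] Module.Dual k W →ₗ[k] M) : M :=
  ∑ᶠ q : Module.Basis.ofVectorSpaceIndex k V × Module.Basis.ofVectorSpaceIndex k W,
    B (Module.Basis.ofVectorSpace k V q.1) (Module.Basis.ofVectorSpace k W q.2) •
      m ((Module.Basis.ofVectorSpace k V).coord q.1) ((Module.Basis.ofVectorSpace k W).coord q.2)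

theorem contract_eq_zero (B : V →ₗ[k] W →ₗ[k] k)
    (m : Module.Dual k V →ₗ[k] Module.Dual k W →ₗ[k] M) (h : Subsingleton V ∨ Subsingleton W) :
    contract B m = 0 := by
  unfold contract
  rw [finsum_eq_zero_of_forall_eq_zero]
  intro q
  rcases h with h | h
  · rw [Subsingleton.elim (Module.Basis.ofVectorSpace k V q.1) 0]; simp
  · rw [Subsingleton.elim (Module.Basis.ofVectorSpace k W q.2) 0]; simp

theorem contract_eq_sum [Module.Finite k V] [Module.Finite k W] (B : V →ₗ[k] W →ₗ[k] k)
    (m : Module.Dual k V →ₗ[k] Module.Dual k W →ₗ[k] M) :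
    contract B m = ∑ α, ∑ β,
      B (Module.Basis.ofVectorSpace k V α) (Module.Basis.ofVectorSpace k W β) •
        m ((Module.Basis.ofVectorSpace k V).coord α)
          ((Module.Basis.ofVectorSpace k W).coord β) := by
  unfold contract
  rw [finsum_eq_sum_of_fintype, Fintype.sum_prod_type]

theorem map_contract [Module.Finite k V] [Module.Finite k W] (B : V →ₗ[k] W →ₗ[k] k)
    (m : Module.Dual k V →ₗ[k] Module.Dual k W →ₗ[k] M) (f : M →ₗ[k] N) :
    f (contract B m) = contract B (m.compr₂ f) := by
  simp [contract_eq_sum]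

theorem contract_comp [Module.Finite k V] [Module.Finite k W] [Module.Finite k V']
    [Module.Finite k W'] (φ : V →ₗ[k] V') (ψ : W →ₗ[k] W') (B : V' →ₗ[k] W' →ₗ[k] k)
    (m : Module.Dual k V →ₗ[k] Module.Dual k W →ₗ[k] M) :
    contract (B.compl₁₂ φ ψ) m = contract B (m.compl₁₂ φ.dualMap ψ.dualMap) := by
  have e₁ : ∀ α', φ.dualMap ((Module.Basis.ofVectorSpace k V').coord α') =
      ∑ α, (Module.Basis.ofVectorSpace k V').coord α' (φ (Module.Basis.ofVectorSpace k V α)) •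
        (Module.Basis.ofVectorSpace k V).coord α := fun α' =>
    (Module.Basis.sum_dual_apply_smul_coord (Module.Basis.ofVectorSpace k V) _).symm
  have e₂ : ∀ β', ψ.dualMap ((Module.Basis.ofVectorSpace k W').coord β') =
      ∑ β, (Module.Basis.ofVectorSpace k W').coord β' (ψ (Module.Basis.ofVectorSpace k W β)) •
        (Module.Basis.ofVectorSpace k W).coord β := fun β' =>
    (Module.Basis.sum_dual_apply_smul_coord (Module.Basis.ofVectorSpace k W) _).symm
  have e₃ : ∀ α β, B (φ (Module.Basis.ofVectorSpace k V α)) (ψ (Module.Basis.ofVectorSpace k W β)) =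
      ∑ α', ∑ β', (Module.Basis.ofVectorSpace k V').coord α' (φ (Module.Basis.ofVectorSpace k V α)) *
        ((Module.Basis.ofVectorSpace k W').coord β' (ψ (Module.Basis.ofVectorSpace k W β)) *
        B (Module.Basis.ofVectorSpace k V' α') (Module.Basis.ofVectorSpace k W' β')) := by
    intro α β
    conv_lhs => rw [← (Module.Basis.ofVectorSpace k V').sum_repr (φ _),
      ← (Module.Basis.ofVectorSpace k W').sum_repr (ψ _)]
    simp only [map_sum, map_smul, LinearMap.sum_apply, LinearMap.smul_apply, smul_eq_mul,
      Module.Basis.coord_apply, Finset.mul_sum]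
    rw [Finset.sum_comm]
    refine Finset.sum_congr rfl fun _ _ => Finset.sum_congr rfl fun _ _ => ?_
    ring
  rw [contract_eq_sum, contract_eq_sum]
  simp only [LinearMap.compl₁₂_apply, e₁, e₂, e₃]
  simp only [map_sum, map_smul, LinearMap.sum_apply, LinearMap.smul_apply, Finset.smul_sum,
    Finset.sum_smul, smul_smul]
  have swap : ∀ {A B C D : Type u} [Fintype A] [Fintype B] [Fintype C] [Fintype D]
      (F : A → B → C → D → M), ∑ x, ∑ y, ∑ z, ∑ w, F x y z w = ∑ z, ∑ w, ∑ x, ∑ y, F x y z w := by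
    intro A B C D _ _ _ _ F
    calc ∑ x, ∑ y, ∑ z, ∑ w, F x y z w = ∑ q : (A × B), ∑ r : (C × D), F q.1 q.2 r.1 r.2 := by
          simp only [Fintype.sum_prod_type]
      _ = ∑ r : (C × D), ∑ q : (A × B), F q.1 q.2 r.1 r.2 := Finset.sum_comm
      _ = _ := by simp only [Fintype.sum_prod_type]
  rw [swap]
  refine Finset.sum_congr rfl fun _ _ => Finset.sum_congr rfl fun _ _ => ?_
  rw [Finset.sum_comm]
  refine Finset.sum_congr rfl fun _ _ => Finset.sum_congr rfl fun _ _ => ?_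
  congr 1
  ring

end Contract

section EdgeSum

variable {k : Type u} [Field k] {t : Kind} {p : Parity}

/-- A linear functional, as an element of the dual module over the groupoid of vertices. -/
def VMod.dualMk (E : VMod k t) (c : Vertex t) (i : ℤ) :
    Module.Dual k (E.obj c (-i)) →ₗ[k] E.dual.obj c i :=
  LinearMap.id (M := Module.Dual k (E.obj c (-i)))

/-- The ways to obtain `c` by contracting an edge between two vertices (with the two ends of the
edge called `a` and `b`), together with degrees for the two vertices. -/
structure Split (a b : ℕ) (c : Vertex t) (n : ℤ) where
  left : Vertex t
  right : Vertex t
  isGlue : IsGlue a b left right c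
  i : ℤ
  j : ℤ
  deg : i + j = n

/-- The contribution to `edgeSum` of an edge between two vertices. -/
noncomputable def splitTerm {V : VMod k t} {P : Operad k t p} {Q : Operad k t p.flip}
    (ι : ∀ c i, V.obj c i →ₗ[k] P.obj c i) (γ : ∀ c i, V.dual.obj c i →ₗ[k] Q.obj c i)
    {a b : ℕ} {c : Vertex t} {i l : ℤ} (h : i + 1 = l) (f : Module.Dual k (P.obj c (-i)))
    (s : Split a b c (i + p.deg)) : Q.obj c l :=
  contract
    (((P.glue a b s.isGlue (show -s.i + -s.j + p.deg = -i by have := s.deg; omega)).compr₂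
      f).compl₁₂ (ι s.left (-s.i)) (ι s.right (-s.j)))
    ((Q.glue a b s.isGlue
      (show s.i + s.j + p.flip.deg = l by have := s.deg; have := p.deg_flip; omega)).compl₁₂
      (γ s.left s.i ∘ₗ V.dualMk s.left s.i) (γ s.right s.j ∘ₗ V.dualMk s.right s.j))

/-- The contribution to `edgeSum` of a loop. -/
def loopTerm {V : VMod k t} {P : Operad k t p} {Q : Operad k t p.flip}
    (ι : ∀ c i, V.obj c i →ₗ[k] P.obj c i) (γ : ∀ c i, V.dual.obj c i →ₗ[k] Q.obj c i)
    {a b : ℕ} {c : Vertex t} {i l : ℤ} (h : i + 1 = l) (f : Module.Dual k (P.obj c (-i)))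
    (s : {c₁ : Vertex t // IsLoop a b c₁ c}) : Q.obj c l :=
  Q.loop a b s.2 (show (i + p.deg) + p.flip.deg = l by have := p.deg_flip; omega)
    (γ s.1 (i + p.deg) (V.dualMk s.1 (i + p.deg)
      (f ∘ₗ P.loop a b s.2 (show -(i + p.deg) + p.deg = -i by omega) ∘ₗ
        ι s.1 (-(i + p.deg)))))

/-- The sum over the one-edge graphs `Γ` that contract to `c` of the images of `f` under
`P(c)* → P(Γ)* → V(Γ)* → Q(c)`. Here the first map is the transpose of the operation of `P`
(`p.deg * i` is the Koszul sign of the transpose), the second map is the restriction along `ι`, and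
the third one applies `γ` to the vertices (`s.i * s.j` is the Koszul sign of
`V(c₁)* ⊗ V(c₂)* ≅ (V(c₁) ⊗ V(c₂))*`) and then uses the operation of `Q`. The two ends of the edge
are called `a` and `b`, which gives every graph two orientations and explains the factor `1 / 2`. -/
noncomputable def edgeSum {V : VMod k t} {P : Operad k t p} {Q : Operad k t p.flip}
    (ι : ∀ c i, V.obj c i →ₗ[k] P.obj c i) (γ : ∀ c i, V.dual.obj c i →ₗ[k] Q.obj c i)
    (a b : ℕ) {c : Vertex t} {i l : ℤ} (h : i + 1 = l) (f : Module.Dual k (P.obj c (-i))) :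
    Q.obj c l :=
  ((1 / 2 : k) * sgn k (p.deg * i)) •
    ((∑ᶠ s : Split a b c (i + p.deg), sgn k (s.i * s.j) • splitTerm ι γ h f s) +
      ∑ᶠ s : {c₁ : Vertex t // IsLoop a b c₁ c}, loopTerm ι γ h f s)

theorem finite_vertex (g : ℕ) (L : Finset ℕ) :
    {v : Vertex t | v.genus ≤ g ∧ v.legs ⊆ L}.Finite := by
  refine Set.Finite.of_finite_image (f := fun v : Vertex t => (v.genus, v.legs))
    (((Set.finite_Iic g).prod (L.powerset.finite_toSet)).subset ?_) ?_
  · rintro _ ⟨v, hv, rfl⟩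
    exact ⟨hv.1, by simpa using hv.2⟩
  · intro v _ w _ h
    have h' := Prod.ext_iff.1 h
    exact Vertex.ext h'.1 h'.2

theorem finite_split {V : VMod k t} (hV : V.IsFiniteType) (a b : ℕ) (c : Vertex t) (n : ℤ) :
    {s : Split a b c n | ¬ (Subsingleton (V.obj s.left (-s.i)) ∨
      Subsingleton (V.obj s.right (-s.j)))}.Finite := by
  have key : ∀ l r : Vertex t, ∃ A B : ℤ, ∀ i j : ℤ, i + j = n →
      ¬ (Subsingleton (V.obj l (-i)) ∨ Subsingleton (V.obj r (-j))) → A ≤ i ∧ i ≤ B := by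
    intro l r
    rcases hV.bounded with h | h
    · obtain ⟨M, hM⟩ := h l
      obtain ⟨N, hN⟩ := h r
      refine ⟨n + N, -M, fun i j hij hs => ?_⟩
      push Not at hs
      constructor
      · by_contra hc
        exact not_subsingleton_iff_nontrivial.2 hs.2 (hN _ (by omega))
      · by_contra hc
        exact not_subsingleton_iff_nontrivial.2 hs.1 (hM _ (by omega))
    · obtain ⟨M, hM⟩ := h l
      obtain ⟨N, hN⟩ := h r
      refine ⟨-M, n + N, fun i j hij hs => ?_⟩
      push Not at hs
      constructor
      · by_contra hc
        exact not_subsingleton_iff_nontrivial.2 hs.1 (hM _ (by omega))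
      · by_contra hc
        exact not_subsingleton_iff_nontrivial.2 hs.2 (hN _ (by omega))
  choose A B hAB using key
  have hfin := finite_vertex (t := t) c.genus (insert a (insert b c.legs))
  refine (hfin.biUnion fun l _ => hfin.biUnion fun r _ =>
    (Set.finite_Icc (A l r) (B l r)).biUnion fun i _ =>
      Set.Subsingleton.finite (s := {s : Split a b c n | s.left = l ∧ s.right = r ∧ s.i = i})
        ?_).subset ?_
  · rintro ⟨l₁, r₁, g₁, i₁, j₁, d₁⟩ ⟨rfl, rfl, rfl⟩ ⟨l₂, r₂, g₂, i₂, j₂, d₂⟩ ⟨h₁, h₂, h₃⟩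
    dsimp only at h₁ h₂ h₃
    subst h₁ h₂ h₃
    have : j₁ = j₂ := by omega
    subst this
    rfl
  · intro s hs
    have hl : s.left ∈ {v : Vertex t | v.genus ≤ c.genus ∧ v.legs ⊆ insert a (insert b c.legs)} := by
      refine ⟨by have := s.isGlue.genus; omega, fun x hx => ?_⟩
      rw [s.isGlue.legs]
      simp only [Finset.mem_insert, Finset.mem_union, Finset.mem_erase]
      tauto
    have hr : s.right ∈ {v : Vertex t | v.genus ≤ c.genus ∧ v.legs ⊆ insert a (insert b c.legs)} := by
      refine ⟨by have := s.isGlue.genus; omega, fun x hx => ?_⟩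
      rw [s.isGlue.legs]
      simp only [Finset.mem_insert, Finset.mem_union, Finset.mem_erase]
      tauto
    simp only [Set.mem_iUnion]
    exact ⟨s.left, hl, s.right, hr, s.i, hAB _ _ _ _ s.deg hs, rfl, rfl, rfl⟩

theorem finite_support_split {V : VMod k t} (hV : V.IsFiniteType) {P : Operad k t p}
    {Q : Operad k t p.flip} (ι : ∀ c i, V.obj c i →ₗ[k] P.obj c i)
    (γ : ∀ c i, V.dual.obj c i →ₗ[k] Q.obj c i) (a b : ℕ) {c : Vertex t} {i l : ℤ}
    (h : i + 1 = l) (f : Module.Dual k (P.obj c (-i))) :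
    Function.HasFiniteSupport
      fun s : Split a b c (i + p.deg) => sgn k (s.i * s.j) • splitTerm ι γ h f s := by
  refine (finite_split hV a b c (i + p.deg)).subset fun s hs hc => hs ?_
  dsimp only [splitTerm]
  rw [contract_eq_zero _ _ hc, smul_zero]

theorem finite_loop (a b : ℕ) (c : Vertex t) : Finite {c₁ : Vertex t // IsLoop a b c₁ c} := by
  refine ((finite_vertex c.genus (insert a (insert b c.legs))).subset
    fun c₁ (h : IsLoop a b c₁ c) => ?_).to_subtype
  refine ⟨by have := h.genus; omega, fun x hx => ?_⟩
  rw [h.legs]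
  simp only [Finset.mem_insert, Finset.mem_erase]
  tauto

/-- Morphisms out of `Q` preserve `edgeSum`. -/
theorem app_edgeSum {V : VMod k t} (hV : V.IsFiniteType) {P : Operad k t p}
    {Q Q' : Operad k t p.flip} (ι : ∀ c i, V.obj c i →ₗ[k] P.obj c i)
    (γ : ∀ c i, V.dual.obj c i →ₗ[k] Q.obj c i) (a b : ℕ) {c : Vertex t} {i l : ℤ}
    (h : i + 1 = l) (f : Module.Dual k (P.obj c (-i))) (φ : Q ⟶ Q') :
    φ.app c l (edgeSum ι γ a b h f) =
      edgeSum ι (fun c i => φ.app c i ∘ₗ γ c i) a b h f := by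
  have := hV.finite
  have := finite_loop a b c
  unfold edgeSum
  rw [map_smul, map_add, map_finsum _ (finite_support_split hV ι γ a b h f),
    map_finsum _ (Set.toFinite _)]
  congr 2
  · refine finsum_congr fun s => ?_
    rw [map_smul]
    congr 1
    unfold splitTerm
    rw [map_contract]
    congr 1
    ext x y
    exact φ.app_glue _ _ _ _
  · exact finsum_congr fun s => φ.app_loop _ _ _

/-- Naturality of `edgeSum` with respect to `V` and `P`. -/
theorem edgeSum_comp {V V' : VMod k t} (hV : V.IsFiniteType) (hV' : V'.IsFiniteType)
    {P P' : Operad k t p} {Q : Operad k t p.flip} (ι : ∀ c i, V.obj c i →ₗ[k] P.obj c i)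
    (ι' : ∀ c i, V'.obj c i →ₗ[k] P'.obj c i) (γ : ∀ c i, V.dual.obj c i →ₗ[k] Q.obj c i)
    (γ' : ∀ c i, V'.dual.obj c i →ₗ[k] Q.obj c i) (u : ∀ c i, V.obj c i →ₗ[k] V'.obj c i)
    (φ : P ⟶ P') (hu : ∀ c i x, φ.app c i (ι c i x) = ι' c i (u c i x))
    (hγ : ∀ c i (x : Module.Dual k (V'.obj c (-i))),
      γ' c i (V'.dualMk c i x) = γ c i (V.dualMk c i (x ∘ₗ u c (-i))))
    (a b : ℕ) {c : Vertex t} {i l : ℤ} (h : i + 1 = l) (f : Module.Dual k (P'.obj c (-i))) :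
    edgeSum ι' γ' a b h f = edgeSum ι γ a b h (f ∘ₗ φ.app c (-i)) := by
  have := hV.finite
  have := hV'.finite
  unfold edgeSum
  congr 2
  · refine finsum_congr fun s => ?_
    congr 1
    unfold splitTerm
    trans contract ((((P'.glue a b s.isGlue (show -s.i + -s.j + p.deg = -i by
      have := s.deg; omega)).compr₂ f).compl₁₂ (ι' s.left (-s.i)) (ι' s.right (-s.j))).compl₁₂
        (u s.left (-s.i)) (u s.right (-s.j))) ((Q.glue a b s.isGlue
      (show s.i + s.j + p.flip.deg = l by have := s.deg; have := p.deg_flip; omega)).compl₁₂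
      (γ s.left s.i ∘ₗ V.dualMk s.left s.i) (γ s.right s.j ∘ₗ V.dualMk s.right s.j))
    · refine Eq.trans ?_ (contract_comp (u s.left (-s.i)) (u s.right (-s.j)) _ _).symm
      congr 1
      ext x y
      simp only [LinearMap.compl₁₂_apply, LinearMap.comp_apply, hγ]
      rfl
    · congr 1
      ext x y
      simp only [LinearMap.compl₁₂_apply, LinearMap.comp_apply, LinearMap.compr₂_apply, ← hu,
        φ.app_glue]
  · refine finsum_congr fun s => ?_
    unfold loopTerm
    rw [hγ]
    congr 3
    ext x
    simp only [LinearMap.comp_apply, ← hu, φ.app_loop]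

end EdgeSum

section Feynman

variable {k : Type u} [Field k] {t : Kind} {p : Parity}

/-- The relations that determine the differential of the Feynman transform on generators
`f ∈ P(c)*`: it is the dual of the differential of `P`, minus the sum over all one-edge graphs. -/
def feynmanRel (P : Operad k t p) (c : Vertex t) (l : ℤ) :
    Set ((freeDG P.dual p.flip).obj c l) :=
  {x | ∃ a b : ℕ, a ≠ b ∧ a ∉ c.legs ∧ b ∉ c.legs ∧ ∃ (i : ℤ) (h : i + 1 = l)
    (f : Module.Dual k (P.obj c (-i))),
    x = (freeDG P.dual p.flip).d h (freeDG.gen P.dual p.flip c i (P.dualMk c i f)) -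
      (freeDG.gen P.dual p.flip c l (P.dual.d h (P.dualMk c i f)) -
        edgeSum (fun _ _ => LinearMap.id) (freeDG.gen P.dual p.flip) a b h f)}

/-- The Feynman transform of an operad: the operad of the opposite parity that is freely generated,
as a graded operad, by the linear dual of the underlying module over the groupoid of vertices, with
the differential that is given on generators by `feynmanRel` (and extended as a derivation). -/
def feynmanObj (P : Operad k t p) : Operad k t p.flip :=
  (freeDG P.dual p.flip).quot (feynmanRel P)

/-- The inclusion of the generators into the Feynman transform. -/
def feynmanGen (P : Operad k t p) (c : Vertex t) (i : ℤ) :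
    P.dual.obj c i →ₗ[k] (feynmanObj P).obj c i :=
  ((freeDG P.dual p.flip).proj (feynmanRel P)).app c i ∘ₗ freeDG.gen P.dual p.flip c i

theorem feynmanGen_act (P : Operad k t p) (σ : Equiv.Perm ℕ) {c c' : Vertex t}
    (h : IsRelabel σ c c') {i : ℤ} (x : P.dual.obj c i) :
    (feynmanObj P).act σ h (feynmanGen P c i x) = feynmanGen P c' i (P.dual.act σ h x) :=
  (((freeDG P.dual p.flip).proj (feynmanRel P)).app_act σ h _).symm.trans
    (congrArg _ (freeDG.act_gen P.dual p.flip σ h x))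

theorem feynmanGen_d {P : Operad k t p} (hP : P.IsFiniteType) {a b : ℕ} (hab : a ≠ b)
    {c : Vertex t} (ha : a ∉ c.legs) (hb : b ∉ c.legs) {i l : ℤ} (h : i + 1 = l)
    (f : Module.Dual k (P.obj c (-i))) :
    (feynmanObj P).d h (feynmanGen P c i (P.dualMk c i f)) =
      feynmanGen P c l (P.dual.d h (P.dualMk c i f)) -
        edgeSum (fun _ _ => LinearMap.id) (feynmanGen P) a b h f := by
  have key := (freeDG P.dual p.flip).proj_eq_zero (r := feynmanRel P)
    ⟨a, b, hab, ha, hb, i, h, f, rfl⟩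
  rw [map_sub, map_sub, app_edgeSum hP, Operad.Hom.app_d, sub_eq_zero] at key
  exact key

/-- Morphisms out of the Feynman transform. -/
def feynmanLift {P : Operad k t p} (hP : P.IsFiniteType) {Q : Operad k t p.flip}
    (γ : ∀ c i, P.dual.obj c i →ₗ[k] Q.obj c i)
    (hγ : ∀ (σ : Equiv.Perm ℕ) {c c' : Vertex t} (h : IsRelabel σ c c') {i : ℤ}
      (x : P.dual.obj c i), Q.act σ h (γ c i x) = γ c' i (P.dual.act σ h x))
    (hd : ∀ (a b : ℕ) (c : Vertex t), a ≠ b → a ∉ c.legs → b ∉ c.legs → ∀ (i l : ℤ)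
      (h : i + 1 = l) (f : Module.Dual k (P.obj c (-i))),
      Q.d h (γ c i (P.dualMk c i f)) = γ c l (P.dual.d h (P.dualMk c i f)) -
        edgeSum (fun _ _ => LinearMap.id) γ a b h f) :
    feynmanObj P ⟶ Q :=
  Operad.desc (freeDG.lift γ hγ) (by
    rintro c l _ ⟨a, b, hab, ha, hb, i, h, f, rfl⟩
    rw [map_sub, map_sub, app_edgeSum hP, Operad.Hom.app_d, sub_eq_zero]
    exact hd a b c hab ha hb i l h f)

theorem feynmanObj_hom_ext {P : Operad k t p} {Q : Operad k t p.flip} {f g : feynmanObj P ⟶ Q}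
    (h : ∀ c i (x : P.dual.obj c i),
      f.app c i (feynmanGen P c i x) = g.app c i (feynmanGen P c i x)) : f = g :=
  Operad.quot_hom_ext (freeDG.hom_ext h)

/-- The transpose of a family of linear maps. -/
def VMod.dualMap {V W : VMod k t} (u : ∀ c i, V.obj c i →ₗ[k] W.obj c i) (c : Vertex t) (i : ℤ) :
    W.dual.obj c i →ₗ[k] V.dual.obj c i :=
  (u c (-i)).dualMap

/-- Contravariant functoriality of the Feynman transform. -/
def feynmanMap {P P' : Operad k t p} (hP : P.IsFiniteType) (hP' : P'.IsFiniteType) (φ : P ⟶ P') :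
    feynmanObj P' ⟶ feynmanObj P :=
  feynmanLift hP' (fun c i => feynmanGen P c i ∘ₗ VMod.dualMap φ.app c i)
    (by
      intro σ c c' h i x
      refine (feynmanGen_act P σ h _).trans (congrArg _ ?_)
      refine LinearMap.ext fun y => ?_
      exact congrArg (fun z => (show Module.Dual k (P'.obj c (-i)) from x) z)
        (φ.app_act σ⁻¹ h.symm y))
    (by
      intro a b c hab ha hb i l h f
      refine (feynmanGen_d hP hab ha hb h (f ∘ₗ φ.app c (-i))).trans (congrArg₂ _ ?_ ?_)
      · refine congrArg _ (LinearMap.ext fun y => ?_)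
        refine congrArg (fun z => (-(sgn k i)) • f z) ?_
        exact φ.app_d (show -l + 1 = -i by omega) y
      · exact (edgeSum_comp hP hP' _ _ _ _ φ.app φ (fun _ _ _ => rfl) (fun _ _ _ => rfl)
          a b h f).symm)

variable (k t p)

/-- Operads of finite type. -/
def finType : ObjectProperty (Operad k t p) := fun P => P.toVMod.IsFiniteType

/-- The Feynman transform, as a contravariant functor on operads of finite type. -/
def feynman : (finType k t p).FullSubcategoryᵒᵖ ⥤ Operad k t p.flip where
  obj P := feynmanObj P.unop.obj
  map {P P'} φ := feynmanMap P'.unop.property P.unop.property φ.unop.hom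
  map_id P := feynmanObj_hom_ext fun c i x => rfl
  map_comp φ ψ := feynmanObj_hom_ext fun c i x => rfl

end Feynman

/-! ### Restriction to genus zero, extension by zero, and the modular envelope -/

section Functors

variable {k : Type u} [Field k] {p : Parity}

/-- A vertex of genus zero, as a vertex for modular operads. -/
def Vertex.toModular (c : Vertex .cyclic) : Vertex .modular :=
  ⟨c.genus, c.legs, c.stable, trivial⟩

/-- A vertex of genus zero, as a vertex for cyclic operads. -/
def Vertex.toCyclic (c : Vertex .modular) (h : c.genus = 0) : Vertex .cyclic :=
  ⟨c.genus, c.legs, c.stable, h⟩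

theorem IsRelabel.toModular {σ : Equiv.Perm ℕ} {c c' : Vertex .cyclic} (h : IsRelabel σ c c') :
    IsRelabel σ c.toModular c'.toModular := ⟨h.1, h.2⟩

theorem IsGlue.toModular {a b : ℕ} {c₁ c₂ c : Vertex .cyclic} (h : IsGlue a b c₁ c₂ c) :
    IsGlue a b c₁.toModular c₂.toModular c.toModular := ⟨h.1, h.2, h.3, h.4, h.5⟩

theorem IsLoop.false {a b : ℕ} {c₁ c : Vertex .cyclic} (h : IsLoop a b c₁ c) : False := by
  have h₁ : c₁.genus = 0 := c₁.allowed
  have h₂ : c.genus = 0 := c.allowed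
  have := h.genus
  omega

theorem IsRelabel.toCyclic {σ : Equiv.Perm ℕ} {c c' : Vertex .modular} (h : IsRelabel σ c c')
    (h₁ : c.genus = 0) (h₂ : c'.genus = 0) : IsRelabel σ (c.toCyclic h₁) (c'.toCyclic h₂) :=
  ⟨h.1, h.2⟩

theorem IsGlue.toCyclic {a b : ℕ} {c₁ c₂ c : Vertex .modular} (h : IsGlue a b c₁ c₂ c)
    (h₁ : c₁.genus = 0) (h₂ : c₂.genus = 0) (h₀ : c.genus = 0) :
    IsGlue a b (c₁.toCyclic h₁) (c₂.toCyclic h₂) (c.toCyclic h₀) := ⟨h.1, h.2, h.3, h.4, h.5⟩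

theorem IsGlue.left_genus {a b : ℕ} {c₁ c₂ c : Vertex .modular} (h : IsGlue a b c₁ c₂ c)
    (h₀ : c.genus = 0) : c₁.genus = 0 := by have := h.genus; omega

theorem IsGlue.right_genus {a b : ℕ} {c₁ c₂ c : Vertex .modular} (h : IsGlue a b c₁ c₂ c)
    (h₀ : c.genus = 0) : c₂.genus = 0 := by have := h.genus; omega

theorem IsLoop.genus_ne {a b : ℕ} {c₁ c : Vertex .modular} (h : IsLoop a b c₁ c) :
    ¬ c.genus = 0 := by have := h.genus; omega

/-- The genus zero part of a modular operad. -/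
def forgetObj (P : Operad k .modular p) : Operad k .cyclic p where
  obj c i := P.obj c.toModular i
  d h := P.d h
  act σ {_ _} h {_} := P.act σ h.toModular
  glue a b {_ _ _} h {_ _ _} hl := P.glue a b h.toModular hl
  loop a b {_ _} h {_ _} hl := h.false.elim
  d_d h h' := P.d_d h h'
  act_id σ {_} h {_} := P.act_id σ h.toModular
  act_act σ τ {_ _ _} h h' h'' {_} := P.act_act σ τ h.toModular h'.toModular h''.toModular
  act_d σ {_ _} h {_ _} hij := P.act_d σ h.toModular hij
  act_glue σ {_ _ _ _ _ _ _ _} h h' h₁ h₂ h₀ {_ _ _} hl :=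
    P.act_glue σ h.toModular h'.toModular h₁.toModular h₂.toModular h₀.toModular hl
  act_loop σ {_ _ _ _ _ _} h h' h₁ h₀ {_ _} hl := h.false.elim
  d_glue {_ _ _ _ _} h {_ _ _ _ _ _} hl hi hj hl' h₁ h₂ :=
    P.d_glue h.toModular hl hi hj hl' h₁ h₂
  d_loop {_ _ _ _} h {_ _ _ _} hl hi hl' h₁ := h.false.elim
  glue_symm {_ _ _ _ _} h h' {_ _ _} hl hl' := P.glue_symm h.toModular h'.toModular hl hl'
  loop_symm {_ _ _ _} h h' {_ _} hl := h.false.elim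
  glue_glue {_ _ _ _ _ _ _ _ _ _} h₁₂ h₁ h₂₃ h₃ {_ _ _ _ _ _} hm hr hn hr' :=
    P.glue_glue h₁₂.toModular h₁.toModular h₂₃.toModular h₃.toModular hm hr hn hr'
  loop_loop {_ _ _ _ _ _ _ _} h₁ h₁' h₂ h₂' {_ _ _} hl hr := h₁.false.elim
  loop_glue {_ _ _ _ _ _ _ _ _} h h' h₁ h₁' {_ _ _ _ _} hl hr hm hr' := h'.false.elim
  loop_glue' {_ _ _ _ _ _ _ _ _} h h₁ h' h₁' {_ _ _ _} hl hr := h₁.false.elim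

variable (k p) in
/-- The functor `R` from modular to cyclic operads that forgets the higher genera. -/
def forgetHigher : Operad k .modular p ⥤ Operad k .cyclic p where
  obj := forgetObj
  map φ :=
    { app := fun c i => φ.app c.toModular i
      app_d := fun h x => φ.app_d h x
      app_act := fun σ _ _ h _ x => φ.app_act σ h.toModular x
      app_glue := fun h _ _ _ hl x y => φ.app_glue h.toModular hl x y
      app_loop := fun h _ _ _ _ => h.false.elim }

/-- Extension by zero of a dg module over the groupoid of vertices: a family indexed by the
proofs that the genus is zero is the same thing as an element of `E` in genus zero, and is trivial
in higher genus. -/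
def extendVMod (E : VMod k .cyclic) : VMod k .modular where
  obj c i := ∀ h : PLift (c.genus = 0), E.obj (c.toCyclic h.down) i
  d h := LinearMap.pi fun h₀ => E.d h ∘ₗ LinearMap.proj h₀
  act σ {c c'} h {i} := LinearMap.pi fun h₀ =>
    E.act σ (h.toCyclic (h.genus.symm.trans h₀.down) h₀.down) ∘ₗ
      LinearMap.proj (PLift.up (h.genus.symm.trans h₀.down))
  d_d h h' x := funext fun _ => E.d_d h h' _
  act_id σ {_} h {_} x hx := funext fun h₀ => E.act_id σ _ (x h₀) hx
  act_act σ τ {_ _ _} _ _ _ {_} _ := funext fun _ => E.act_act σ τ _ _ _ _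
  act_d σ {_ _} _ {_ _} hij _ := funext fun _ => E.act_d σ _ hij _

/-- Extension by zero of a cyclic operad. -/
def extendObj (P : Operad k .cyclic p) : Operad k .modular p where
  toVMod := extendVMod P.toVMod
  glue a b {c₁ c₂ c} h {i j l} hl :=
    LinearMap.mk₂ k
      (fun x y h₀ => P.glue a b
        (h.toCyclic (h.left_genus h₀.down) (h.right_genus h₀.down) h₀.down) hl
        (x ⟨h.left_genus h₀.down⟩) (y ⟨h.right_genus h₀.down⟩))
      (fun x x' y => funext fun h₀ => by
        refine Eq.trans ?_ (LinearMap.map_add₂ _ _ _ _); rfl)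
      (fun r x y => funext fun h₀ => by
        refine Eq.trans ?_ (LinearMap.map_smul₂ _ _ _ _); rfl)
      (fun x y y' => funext fun h₀ => by
        refine Eq.trans ?_ (LinearMap.map_add _ _ _); rfl)
      (fun r x y => funext fun h₀ => by
        refine Eq.trans ?_ (LinearMap.map_smul _ _ _); rfl)
  loop _ _ {_ _} _ {_ _} _ := 0
  act_glue σ {_ _ _ _ _ _ _ _} _ _ _ _ _ {_ _ _} hl _ _ := funext fun _ =>
    P.act_glue σ _ _ _ _ _ hl _ _
  act_loop σ {_ _ _ _ _ _} _ h' _ _ {_ _} _ _ := funext fun h₀ => (h'.genus_ne h₀.down).elim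
  d_glue {_ _ _ _ _} _ {_ _ _ _ _ _} hl hi hj hl' h₁ h₂ _ _ := funext fun _ =>
    P.d_glue _ hl hi hj hl' h₁ h₂ _ _
  d_loop {_ _ _ _} h {_ _ _ _} _ _ _ _ _ := funext fun h₀ => (h.genus_ne h₀.down).elim
  glue_symm {_ _ _ _ _} _ _ {_ _ _} hl hl' _ _ := funext fun _ => P.glue_symm _ _ hl hl' _ _
  loop_symm {_ _ _ _} h _ {_ _} _ _ := funext fun h₀ => (h.genus_ne h₀.down).elim
  glue_glue {_ _ _ _ _ _ _ _ _ _} h₁₂ h₁ h₂₃ h₃ {_ _ _ _ _ _} hm hr hn hr' _ _ _ :=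
    funext fun h₀ => P.glue_glue
      (h₁₂.toCyclic (h₃.left_genus h₀.down) (h₂₃.left_genus (h₃.right_genus h₀.down))
        (h₁.left_genus h₀.down))
      (h₁.toCyclic (h₁.left_genus h₀.down) (h₁.right_genus h₀.down) h₀.down)
      (h₂₃.toCyclic (h₂₃.left_genus (h₃.right_genus h₀.down)) (h₁.right_genus h₀.down)
        (h₃.right_genus h₀.down))
      (h₃.toCyclic (h₃.left_genus h₀.down) (h₃.right_genus h₀.down) h₀.down)
      hm hr hn hr' _ _ _
  loop_loop {_ _ _ _ _ _ _ _} _ h₁' _ _ {_ _ _} _ _ _ := funext fun h₀ =>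
    (h₁'.genus_ne h₀.down).elim
  loop_glue {_ _ _ _ _ _ _ _ _} _ h' _ _ {_ _ _ _ _} _ _ _ _ _ _ := funext fun h₀ =>
    (h'.genus_ne h₀.down).elim
  loop_glue' {_ _ _ _ _ _ _ _ _} _ h₁ _ _ {_ _ _ _} _ _ _ _ := funext fun h₀ =>
    (h₁.genus_ne h₀.down).elim

variable (k p) in
/-- The functor `L^!` from cyclic to modular operads: extension by zero. -/
def extendZero : Operad k .cyclic p ⥤ Operad k .modular p where
  obj := extendObj
  map φ :=
    { app := fun c i => LinearMap.pi fun h₀ => φ.app (c.toCyclic h₀.down) i ∘ₗ LinearMap.proj h₀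
      app_d := fun h _ => funext fun _ => φ.app_d h _
      app_act := fun σ _ _ _ _ _ => funext fun _ => φ.app_act σ _ _
      app_glue := fun _ _ _ _ hl _ _ => funext fun _ => φ.app_glue _ hl _ _
      app_loop := fun h _ _ _ _ => funext fun h₀ => (h.genus_ne h₀.down).elim }

theorem finType_forget (P : Operad k .modular p) (hP : finType k .modular p P) :
    finType k .cyclic p (forgetObj P) :=
  ⟨fun c i => hP.finite c.toModular i,
    hP.bounded.imp (fun h c => h c.toModular) (fun h c => h c.toModular)⟩

theorem finType_extend (P : Operad k .cyclic p) (hP : finType k .cyclic p P) :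
    finType k .modular p (extendObj P) := by
  have fin := hP.finite
  refine ⟨fun c i => ?_, hP.bounded.imp (fun h c => ?_) (fun h c => ?_)⟩
  · change Module.Finite k (∀ h : PLift (c.genus = 0), P.obj (c.toCyclic h.down) i)
    infer_instance
  all_goals
    by_cases h₀ : c.genus = 0
    · obtain ⟨N, hN⟩ := h (c.toCyclic h₀)
      exact ⟨N, fun i hi => ⟨fun x y => funext fun _ => (hN i hi).elim _ _⟩⟩
    · exact ⟨0, fun i _ => ⟨fun x y => funext fun h => (h₀ h.down).elim⟩⟩

variable (k p) in
/-- The functor `R` on operads of finite type. -/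
def forgetHigherFin :
    (finType k .modular p).FullSubcategory ⥤ (finType k .cyclic p).FullSubcategory :=
  ObjectProperty.lift _ ((finType k .modular p).ι ⋙ forgetHigher k p)
    fun P => finType_forget P.obj P.property

variable (k p) in
/-- The functor `L^!` on operads of finite type. -/
def extendZeroFin :
    (finType k .cyclic p).FullSubcategory ⥤ (finType k .modular p).FullSubcategory :=
  ObjectProperty.lift _ ((finType k .cyclic p).ι ⋙ extendZero k p)
    fun P => finType_extend P.obj P.property

/-- The relations of the modular envelope: the differential of a generator, and the contraction of
an edge between two generators, are those of `P`. (For generators of higher genus, which are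
zero, this says nothing.) -/
def envelopeRel (P : Operad k .cyclic p) (c : Vertex .modular) (l : ℤ) :
    Set ((freeDG (extendVMod P.toVMod) p).obj c l) :=
  {z | (∃ (i : ℤ) (h : i + 1 = l) (x : (extendVMod P.toVMod).obj c i),
      z = (freeDG (extendVMod P.toVMod) p).d h (freeDG.gen (extendVMod P.toVMod) p c i x) -
        freeDG.gen (extendVMod P.toVMod) p c l ((extendVMod P.toVMod).d h x)) ∨
    (∃ (a b : ℕ) (c₁ c₂ : Vertex .modular) (h : IsGlue a b c₁ c₂ c) (i j : ℤ)
      (hl : i + j + p.deg = l) (x : (extendVMod P.toVMod).obj c₁ i)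
      (y : (extendVMod P.toVMod).obj c₂ j),
      z = (freeDG (extendVMod P.toVMod) p).glue a b h hl (freeDG.gen (extendVMod P.toVMod) p c₁ i x)
          (freeDG.gen (extendVMod P.toVMod) p c₂ j y) -
        freeDG.gen (extendVMod P.toVMod) p c l ((extendObj P).glue a b h hl x y))}

/-- The modular envelope of a cyclic operad: the modular operad generated by the elements of `P` in
genus zero, subject to all relations that hold in `P`. -/
def envelopeObj (P : Operad k .cyclic p) : Operad k .modular p :=
  (freeDG (extendVMod P.toVMod) p).quot (envelopeRel P)

/-- Functoriality of the modular envelope. -/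
def envelopeMap {P P' : Operad k .cyclic p} (φ : P ⟶ P') : envelopeObj P ⟶ envelopeObj P' :=
  Operad.desc
    (freeDG.lift (fun c i => ((freeDG (extendVMod P'.toVMod) p).proj (envelopeRel P')).app c i ∘ₗ
        freeDG.gen _ p c i ∘ₗ ((extendZero k p).map φ).app c i)
      (fun σ c c' h i x => by
        refine (((freeDG _ p).proj (envelopeRel P')).app_act σ h _).symm.trans (congrArg _ ?_)
        refine (freeDG.act_gen _ p σ h _).trans (congrArg _ ?_)
        exact (((extendZero k p).map φ).app_act σ h x).symm))
    (by
      rintro c l _ (⟨i, h, x, rfl⟩ | ⟨a, b, c₁, c₂, h, i, j, hl, x, y, rfl⟩)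
      · rw [map_sub, Operad.Hom.app_d]
        have e := (freeDG (extendVMod P'.toVMod) p).proj_eq_zero (r := envelopeRel P')
          (Or.inl ⟨i, h, ((extendZero k p).map φ).app c i x, rfl⟩)
        rw [map_sub, Operad.Hom.app_d] at e
        refine Eq.trans ?_ e
        refine congrArg₂ _ rfl (congrArg (fun z =>
          ((freeDG (extendVMod P'.toVMod) p).proj (envelopeRel P')).app c l
            (freeDG.gen (extendVMod P'.toVMod) p c l z)) ?_)
        exact ((extendZero k p).map φ).app_d h x
      · rw [map_sub, Operad.Hom.app_glue]
        have e := (freeDG (extendVMod P'.toVMod) p).proj_eq_zero (r := envelopeRel P')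
          (Or.inr ⟨a, b, c₁, c₂, h, i, j, hl, ((extendZero k p).map φ).app c₁ i x,
            ((extendZero k p).map φ).app c₂ j y, rfl⟩)
        rw [map_sub, Operad.Hom.app_glue] at e
        refine Eq.trans ?_ e
        refine congrArg₂ _ rfl (congrArg (fun z =>
          ((freeDG (extendVMod P'.toVMod) p).proj (envelopeRel P')).app c l
            (freeDG.gen (extendVMod P'.toVMod) p c l z)) ?_)
        exact ((extendZero k p).map φ).app_glue h hl x y)

variable (k p) in
/-- The modular envelope functor `L` from cyclic to modular operads. -/
def envelope : Operad k .cyclic p ⥤ Operad k .modular p where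
  obj := envelopeObj
  map := envelopeMap
  map_id P := Operad.quot_hom_ext (freeDG.hom_ext fun _ _ _ => rfl)
  map_comp _ _ := Operad.quot_hom_ext (freeDG.hom_ext fun _ _ _ => rfl)

end Functors

/-! ### Quadratic duality and Koszul operads -/

section Quadratic

variable {k : Type u} [Field k] {t : Kind}

/-- The free operad on a dg module over the groupoid of vertices. -/
def freeOperad (E : VMod k t) (p : Parity) : Operad k t p :=
  (freeDG E p).quot fun c l => {x | ∃ (i : ℤ) (h : i + 1 = l) (y : E.obj c i),
    x = (freeDG E p).d h (freeDG.gen E p c i y) - freeDG.gen E p c l (E.d h y)}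

/-- The inclusion of the generators into the free operad. -/
def freeGen (E : VMod k t) (p : Parity) (c : Vertex t) (i : ℤ) :
    E.obj c i →ₗ[k] (freeOperad E p).obj c i :=
  ((freeDG E p).proj _).app c i ∘ₗ freeDG.gen E p c i

theorem freeGen_act (E : VMod k t) (p : Parity) (σ : Equiv.Perm ℕ) {c c' : Vertex t}
    (h : IsRelabel σ c c') {i : ℤ} (x : E.obj c i) :
    (freeOperad E p).act σ h (freeGen E p c i x) = freeGen E p c' i (E.act σ h x) :=
  (((freeDG E p).proj _).app_act σ h _).symm.trans (congrArg _ (freeDG.act_gen E p σ h x))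

theorem freeGen_d (E : VMod k t) (p : Parity) {c : Vertex t} {i l : ℤ} (h : i + 1 = l)
    (x : E.obj c i) :
    (freeOperad E p).d h (freeGen E p c i x) = freeGen E p c l (E.d h x) := by
  have key := (freeDG E p).proj_eq_zero
    (r := fun c l => {x | ∃ (i : ℤ) (h : i + 1 = l) (y : E.obj c i),
      x = (freeDG E p).d h (freeDG.gen E p c i y) - freeDG.gen E p c l (E.d h y)})
    ⟨i, h, x, rfl⟩
  rw [map_sub, Operad.Hom.app_d, sub_eq_zero] at key
  exact key

/-- The weight one part of the free operad: the span of the one-edge graphs with vertices labelled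
by generators. -/
def weightOne (E : VMod k t) (p : Parity) (c : Vertex t) (l : ℤ) :
    Submodule k ((freeOperad E p).obj c l) :=
  Submodule.span k
    ({z | ∃ (a b : ℕ) (c₁ c₂ : Vertex t) (h : IsGlue a b c₁ c₂ c) (i j : ℤ)
        (hl : i + j + p.deg = l) (x : E.obj c₁ i) (y : E.obj c₂ j),
        z = (freeOperad E p).glue a b h hl (freeGen E p c₁ i x) (freeGen E p c₂ j y)} ∪
      {z | ∃ (a b : ℕ) (c₁ : Vertex t) (h : IsLoop a b c₁ c) (i : ℤ) (hl : i + p.deg = l)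
        (x : E.obj c₁ i), z = (freeOperad E p).loop a b h hl (freeGen E p c₁ i x)})

/-- Quadratic data: a dg module `gens` over the groupoid of vertices, and a dg submodule of the
weight one part of the free operad on it. -/
structure QuadraticData (k : Type u) [Field k] (t : Kind) (p : Parity) where
  gens : VMod k t
  rels : ∀ c i, Submodule k ((freeOperad gens p).obj c i)
  rels_le : ∀ c i, rels c i ≤ weightOne gens p c i
  d_mem : ∀ {c : Vertex t} {i j : ℤ} (h : i + 1 = j), ∀ x ∈ rels c i,
    (freeOperad gens p).d h x ∈ rels c j
  act_mem : ∀ (σ : Equiv.Perm ℕ) {c c' : Vertex t} (h : IsRelabel σ c c') {i : ℤ},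
    ∀ x ∈ rels c i, (freeOperad gens p).act σ h x ∈ rels c' i

namespace QuadraticData

variable {p : Parity} (q : QuadraticData k t p)

/-- The quadratic operad that is presented by quadratic data. -/
def operad : Operad k t p := (freeOperad q.gens p).quot fun c i => q.rels c i

/-- The inclusion of the generators into the quadratic operad. -/
def gen (c : Vertex t) (i : ℤ) : q.gens.obj c i →ₗ[k] q.operad.obj c i :=
  ((freeOperad q.gens p).proj _).app c i ∘ₗ freeGen q.gens p c i

/-- The annihilator of the relations. The weight one part of the free operad of opposite parity on
the dual of the generators is identified by `edgeSum` with the dual of the weight one part of the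
free operad on the generators. -/
def perp (c : Vertex t) (l : ℤ) : Set ((freeOperad q.gens.dual p.flip).obj c l) :=
  {x | ∃ a b : ℕ, a ≠ b ∧ a ∉ c.legs ∧ b ∉ c.legs ∧ ∃ (i : ℤ) (h : i + 1 = l)
    (f : Module.Dual k ((freeOperad q.gens p).obj c (-i))), (∀ s ∈ q.rels c (-i), f s = 0) ∧
      x = edgeSum (freeGen q.gens p) (freeGen q.gens.dual p.flip) a b h f}

/-- The quadratic dual operad. -/
def dualOperad : Operad k t p.flip := (freeOperad q.gens.dual p.flip).quot q.perp

/-- On generators, the natural map from the Feynman transform of a quadratic operad to its quadratic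
dual is the restriction of functionals to the generators of the quadratic operad. -/
def koszulGen (c : Vertex t) (i : ℤ) : q.operad.dual.obj c i →ₗ[k] q.dualOperad.obj c i :=
  ((freeOperad q.gens.dual p.flip).proj q.perp).app c i ∘ₗ freeGen q.gens.dual p.flip c i ∘ₗ
    VMod.dualMap q.gen c i

/-- The natural map from the Feynman transform of a quadratic operad to its quadratic dual. -/
def koszulMap (hE : q.gens.IsFiniteType) (hO : q.operad.IsFiniteType) :
    feynmanObj q.operad ⟶ q.dualOperad :=
  feynmanLift hO q.koszulGen
    (by
      intro σ c c' h i x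
      refine (((freeOperad q.gens.dual p.flip).proj q.perp).app_act σ h _).symm.trans
        (congrArg _ ?_)
      refine (freeGen_act q.gens.dual p.flip σ h _).trans (congrArg _ ?_)
      refine LinearMap.ext fun y => ?_
      refine congrArg (fun z => (show Module.Dual k (q.operad.obj c (-i)) from x) z) ?_
      refine Eq.symm ((((freeOperad q.gens p).proj fun c i => q.rels c i).app_act σ⁻¹ h.symm _).symm.trans
        (congrArg _ ?_))
      exact freeGen_act q.gens p σ⁻¹ h.symm y)
    (by
      intro a b c hab ha hb i l h f
      have key : edgeSum (fun _ _ => LinearMap.id) q.koszulGen a b h f = 0 := by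
        have e := edgeSum_comp hE hO (freeGen q.gens p) (fun _ _ => LinearMap.id)
          (fun c i => ((freeOperad q.gens.dual p.flip).proj q.perp).app c i ∘ₗ
            freeGen q.gens.dual p.flip c i) q.koszulGen q.gen
          ((freeOperad q.gens p).proj fun c i => q.rels c i) (fun _ _ _ => rfl)
          (fun _ _ _ => rfl) a b h f
        refine e.trans ((app_edgeSum hE _ _ a b h _
          ((freeOperad q.gens.dual p.flip).proj q.perp)).symm.trans ?_)
        refine (freeOperad q.gens.dual p.flip).proj_eq_zero ?_
        refine ⟨a, b, hab, ha, hb, i, h, _, fun s hs => ?_, rfl⟩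
        refine (congrArg f ?_).trans (map_zero f)
        exact (freeOperad q.gens p).proj_eq_zero (r := fun c i => q.rels c i) hs
      rw [key, sub_zero]
      refine (((freeOperad q.gens.dual p.flip).proj q.perp).app_d h _).symm.trans
        (congrArg _ ?_)
      refine (freeGen_d q.gens.dual p.flip h _).trans (congrArg _ ?_)
      refine LinearMap.ext fun y => ?_
      refine congrArg (fun z => (-(sgn k i)) • f z) ?_
      refine Eq.symm ((((freeOperad q.gens p).proj _).app_d
        (show -l + 1 = -i by omega) _).symm.trans (congrArg _ ?_))
      exact freeGen_d q.gens p (show -l + 1 = -i by omega) y)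

end QuadraticData

end Quadratic

/-! ### Homotopy theory of operads -/

section Homotopy

variable (k : Type u) [Field k] (t : Kind) (p : Parity)

/-- Weak equivalences: morphisms that are injective and surjective on the cohomology of every
component. -/
def weakEquiv : MorphismProperty (Operad k t p) := fun P Q φ =>
  ∀ (c : Vertex t) (i j l : ℤ) (hij : i + 1 = j) (hjl : j + 1 = l),
    (∀ x : P.obj c j, P.d hjl x = 0 → (∃ y : Q.obj c i, Q.d hij y = φ.app c j x) →
      ∃ z : P.obj c i, P.d hij z = x) ∧
    (∀ y : Q.obj c j, Q.d hjl y = 0 → ∃ x : P.obj c j, P.d hjl x = 0 ∧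
      ∃ z : Q.obj c i, φ.app c j x - y = Q.d hij z)

variable {k t p}

/-- Cofibrant operads, in the model structure with levelwise weak equivalences and levelwise
surjections as fibrations: morphisms out of them lift along every surjective weak equivalence. -/
def IsCofibrant (Q : Operad k t p) : Prop :=
  ∀ ⦃A B : Operad k t p⦄ (π : A ⟶ B), weakEquiv k t p π →
    (∀ c i, Function.Surjective (π.app c i)) → ∀ f : Q ⟶ B, ∃ g : Q ⟶ A, g ≫ π = f

end Homotopy

end GraphOperad

/-! Parts 1 and 2 are formal consequences of universal properties; part 3 needs in addition an
obstruction theory and the homotopy invariance of `L`.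

An edge that contracts to a vertex of genus zero joins two vertices of genus zero, and no loop
contracts to genus zero. So the differential of `D(P)` in genus zero sees only `R(P)`. A map out of
a Feynman transform is an equivariant family of linear maps on generators that respects the
differential (`feynmanLift`), a map out of `L(P)` is a map from `P` to a genus zero part
(`envelopeLift`), and a map out of `R(M)` extends to a map from `M` to an extension by zero
(`toExtend`). With these, maps in both directions are written down and compared on generators
(`feynmanForgetIso`, `feynmanEnvelopeIso`); no description of free operads by trees is needed. For
`D L^!` and `L D`, the generators of positive genus vanish on both sides.

For part 3, Koszulness says that `D(O)` maps to `O^!` by a weak equivalence. By part 2 it remains to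
see that `D(O)` is cofibrant and that `L` sends two cofibrant replacements to isomorphic objects of
the localization.

Cofibrancy (`isCofibrant_feynmanObj`). Let `P` be of finite type. Morphisms `D(P) → A` are the same
as equivariant families of elements `θ(c)` of degree zero in the product totalization of `P ⊗ A`
that satisfy a Maurer–Cartan equation: `dθ` is minus half of the sum of all contractions of `θ` with
itself along one edge. The degrees of the contractions of `P` and `A` add up to one, so `P ⊗ A` is
an odd cyclic operad (`tensorOperad`). If `A → B` is an acyclic surjection, then so is `P ⊗ A → P ⊗
B`, because over a field the kernel is contractible and a contraction can be tensored with `P`. A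
solution over `B` is lifted by induction on the number of legs: in genus zero both vertices of an
edge have fewer legs than the result of the contraction, so the quadratic term is already known. An
arbitrary lift violates the equation by an element of the kernel. This element is a cycle by a
Bianchi identity (`d_bracket`), which holds because the contractions of two edges anticommute and
the two-edge graphs cancel in pairs. A primitive in the kernel corrects the lift, and an average
over bijections of legs, possible in characteristic zero, makes it equivariant.

Homotopy invariance (`localization_envelope_isIso`). The operad `A ⊗ k[t, dt]` is a path object:
integration of polynomials shows that evaluation at `0` has an acyclic kernel, so constant paths are
a weak equivalence and the evaluations at `0` and `1` agree in the localization. The envelope of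
paths in `Y` maps to paths in the envelope of `Y`, compatibly with evaluation, so `L` makes
homotopic maps equal in the localization. A weak equivalence to a cofibrant operad has a section up
to homotopy, which is again a weak equivalence; applying this twice gives an isomorphism. -/

namespace GraphOperad

/-! ### Genus zero: edge sums, adjunctions, and the comparison of Feynman transforms -/

section Adjunctions

variable {k : Type u} [Field k] {p : Parity}

/-- A one-edge graph with vertices of genus zero, as a modular graph. -/
def Split.toModular {a b : ℕ} {c : Vertex .cyclic} {n : ℤ} (s : Split a b c n) :
    Split a b c.toModular n :=
  ⟨s.left.toModular, s.right.toModular, s.isGlue.toModular, s.i, s.j, s.deg⟩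

/-- Genera add along an edge, so both vertices of a one-edge graph that contracts to genus zero have
genus zero. -/
theorem Split.toModular_bijective (a b : ℕ) (c : Vertex .cyclic) (n : ℤ) :
    Function.Bijective (Split.toModular : Split a b c n → Split a b c.toModular n) := by
  constructor
  · rintro ⟨l, r, g, i, j, d⟩ ⟨l', r', g', i', j', d'⟩ h
    obtain rfl : l = l' := Vertex.ext (congrArg (fun s => s.left.genus) h)
      (congrArg (fun s => s.left.legs) h)
    obtain rfl : r = r' := Vertex.ext (congrArg (fun s => s.right.genus) h)
      (congrArg (fun s => s.right.legs) h)
    obtain rfl : i = i' := congrArg Split.i h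
    obtain rfl : j = j' := congrArg Split.j h
    rfl
  · rintro ⟨l, r, g, i, j, d⟩
    exact ⟨⟨l.toCyclic (g.left_genus c.allowed), r.toCyclic (g.right_genus c.allowed),
      ⟨g.1, g.2, g.3, g.4, g.5⟩, i, j, d⟩, rfl⟩

/-- In genus zero, the sum over modular one-edge graphs is the sum over cyclic ones. -/
theorem edgeSum_forget {P : Operad k .modular p} {Q : Operad k .modular p.flip}
    (γ : ∀ c i, P.dual.obj c i →ₗ[k] Q.obj c i) (a b : ℕ) {c : Vertex .cyclic} {i l : ℤ}
    (h : i + 1 = l) (f : Module.Dual k (P.obj c.toModular (-i))) :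
    edgeSum (V := (forgetObj P).toVMod) (P := forgetObj P) (Q := forgetObj Q)
      (fun _ _ => LinearMap.id) (fun c i => γ c.toModular i) a b h f =
    edgeSum (V := P.toVMod) (fun _ _ => LinearMap.id) γ a b (c := c.toModular) h f := by
  have e₁ : IsEmpty {c₁ : Vertex .cyclic // IsLoop a b c₁ c} := ⟨fun s => s.2.false⟩
  have e₂ : IsEmpty {c₁ : Vertex .modular // IsLoop a b c₁ c.toModular} :=
    ⟨fun s => s.2.genus_ne c.allowed⟩
  unfold edgeSum
  have z₁ := finsum_of_isEmpty (loopTerm (V := (forgetObj P).toVMod) (P := forgetObj P)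
    (Q := forgetObj Q) (fun _ _ => LinearMap.id) (fun c i => γ c.toModular i) (a := a) (b := b) h f)
  have z₂ := finsum_of_isEmpty (loopTerm (fun _ _ => LinearMap.id) γ (a := a) (b := b)
    (c := c.toModular) h f)
  refine congrArg _ (congrArg₂ _ ?_ (z₁.trans z₂.symm))
  exact finsum_eq_of_bijective _ (Split.toModular_bijective a b c (i + p.deg)) fun s => rfl

/-- The edge sum vanishes when all operations that are summed do. -/
theorem edgeSum_eq_zero {t : Kind} {V : VMod k t} {P : Operad k t p} {Q : Operad k t p.flip}
    (ι : ∀ c i, V.obj c i →ₗ[k] P.obj c i) (γ : ∀ c i, V.dual.obj c i →ₗ[k] Q.obj c i)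
    (a b : ℕ) {c : Vertex t} {i l : ℤ} (h : i + 1 = l) {f : Module.Dual k (P.obj c (-i))}
    (hf : f = 0) : edgeSum ι γ a b h f = 0 := by
  subst hf
  unfold edgeSum
  rw [finsum_eq_zero_of_forall_eq_zero, finsum_eq_zero_of_forall_eq_zero, add_zero, smul_zero]
  · intro s
    simp [loopTerm]
  · intro s
    unfold splitTerm contract
    simp

/-- The counit of the adjunction between restriction and extension by zero. -/
def evalZero (X : Operad k .cyclic p) : forgetObj (extendObj X) ⟶ X where
  app c i := LinearMap.proj (PLift.up c.allowed)
  app_d _ _ := rfl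
  app_act _ _ _ _ _ _ := rfl
  app_glue _ _ _ _ _ _ _ := rfl
  app_loop h := h.false.elim

/-- The inverse of `evalZero`. -/
def constZero (X : Operad k .cyclic p) : X ⟶ forgetObj (extendObj X) where
  app c i := LinearMap.pi fun _ => LinearMap.id
  app_d _ _ := rfl
  app_act _ _ _ _ _ _ := rfl
  app_glue _ _ _ _ _ _ _ := rfl
  app_loop h := h.false.elim

/-- A morphism from the genus zero part of a modular operad to a cyclic operad extends to a
morphism to the extension by zero. -/
def toExtend {M : Operad k .modular p} {X : Operad k .cyclic p} (f : forgetObj M ⟶ X) :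
    M ⟶ extendObj X where
  app c i := LinearMap.pi fun h => f.app (c.toCyclic h.down) i
  app_d {c _ _} h x := funext fun h₀ => f.app_d (c := c.toCyclic h₀.down) h x
  app_act σ _ _ h _ x := funext fun h₀ =>
    f.app_act σ (h.toCyclic (h.genus.symm.trans h₀.down) h₀.down) x
  app_glue h _ _ _ hl x y := funext fun h₀ =>
    f.app_glue (h.toCyclic (h.left_genus h₀.down) (h.right_genus h₀.down) h₀.down) hl x y
  app_loop h _ _ _ _ := funext fun h₀ => (h.genus_ne h₀.down).elim

/-- The generators of the modular envelope. -/
def envelopeGen (P : Operad k .cyclic p) (c : Vertex .modular) (i : ℤ) :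
    (extendVMod P.toVMod).obj c i →ₗ[k] (envelopeObj P).obj c i :=
  ((freeDG (extendVMod P.toVMod) p).proj (envelopeRel P)).app c i ∘ₗ freeDG.gen _ p c i

theorem envelopeGen_act (P : Operad k .cyclic p) (σ : Equiv.Perm ℕ) {c c' : Vertex .modular}
    (h : IsRelabel σ c c') {i : ℤ} (x : (extendVMod P.toVMod).obj c i) :
    (envelopeObj P).act σ h (envelopeGen P c i x) =
      envelopeGen P c' i ((extendVMod P.toVMod).act σ h x) :=
  (((freeDG _ p).proj (envelopeRel P)).app_act σ h _).symm.trans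
    (congrArg _ (freeDG.act_gen _ p σ h x))

theorem envelopeGen_d (P : Operad k .cyclic p) {c : Vertex .modular} {i l : ℤ} (h : i + 1 = l)
    (x : (extendVMod P.toVMod).obj c i) :
    (envelopeObj P).d h (envelopeGen P c i x) =
      envelopeGen P c l ((extendVMod P.toVMod).d h x) := by
  have key := (freeDG (extendVMod P.toVMod) p).proj_eq_zero (r := envelopeRel P)
    (Or.inl ⟨i, h, x, rfl⟩)
  rw [map_sub, Operad.Hom.app_d, sub_eq_zero] at key
  exact key

theorem envelopeGen_glue (P : Operad k .cyclic p) {a b : ℕ} {c₁ c₂ c : Vertex .modular}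
    (h : IsGlue a b c₁ c₂ c) {i j l : ℤ} (hl : i + j + p.deg = l)
    (x : (extendVMod P.toVMod).obj c₁ i) (y : (extendVMod P.toVMod).obj c₂ j) :
    (envelopeObj P).glue a b h hl (envelopeGen P c₁ i x) (envelopeGen P c₂ j y) =
      envelopeGen P c l ((extendObj P).glue a b h hl x y) := by
  have key := (freeDG (extendVMod P.toVMod) p).proj_eq_zero (r := envelopeRel P)
    (Or.inr ⟨a, b, c₁, c₂, h, i, j, hl, x, y, rfl⟩)
  rw [map_sub, Operad.Hom.app_glue, sub_eq_zero] at key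
  exact key

theorem envelope_hom_ext {P : Operad k .cyclic p} {M : Operad k .modular p}
    {f g : envelopeObj P ⟶ M}
    (h : ∀ c i x, f.app c i (envelopeGen P c i x) = g.app c i (envelopeGen P c i x)) : f = g :=
  Operad.quot_hom_ext (freeDG.hom_ext h)

/-- The unit of the adjunction between the modular envelope and restriction. -/
def envelopeUnit (P : Operad k .cyclic p) : P ⟶ forgetObj (envelopeObj P) where
  app c i := envelopeGen P c.toModular i ∘ₗ (constZero P).app c i
  app_d h x := (envelopeGen_d P h _).symm
  app_act σ {c _} h {i} x := (envelopeGen_act P σ h.toModular ((constZero P).app c i x)).symm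
  app_glue {_ _ c₁ c₂ _} h i j _ hl x y := (envelopeGen_glue P h.toModular hl
    ((constZero P).app c₁ i x) ((constZero P).app c₂ j y)).symm
  app_loop h := h.false.elim

/-- In genus zero, a generator of the envelope comes from the unit; the others vanish. -/
theorem envelope_hom_ext' {P : Operad k .cyclic p} {M : Operad k .modular p}
    {f g : envelopeObj P ⟶ M}
    (h : envelopeUnit P ≫ (forgetHigher k p).map f = envelopeUnit P ≫ (forgetHigher k p).map g) :
    f = g := by
  refine envelope_hom_ext fun c i x => ?_
  by_cases h₀ : c.genus = 0
  · exact (congrArg (fun e : P ⟶ forgetObj M => e.app (c.toCyclic h₀) i (x ⟨h₀⟩)) h :)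
  · have : x = 0 := funext fun h => (h₀ h.down).elim
    rw [this, map_zero, map_zero, map_zero]

/-- A linear map out of the extension by zero. -/
def extendDesc {E : VMod k .cyclic} {W : Vertex .modular → ℤ → Type u}
    [∀ c i, AddCommGroup (W c i)] [∀ c i, Module k (W c i)]
    (f : ∀ (c : Vertex .cyclic) i, E.obj c i →ₗ[k] W c.toModular i) (c : Vertex .modular) (i : ℤ) :
    (extendVMod E).obj c i →ₗ[k] W c i :=
  open Classical in
  if h : c.genus = 0 then f (c.toCyclic h) i ∘ₗ LinearMap.proj (PLift.up h) else 0

theorem extendDesc_apply {E : VMod k .cyclic} {W : Vertex .modular → ℤ → Type u}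
    [∀ c i, AddCommGroup (W c i)] [∀ c i, Module k (W c i)]
    (f : ∀ (c : Vertex .cyclic) i, E.obj c i →ₗ[k] W c.toModular i) (c : Vertex .modular) (i : ℤ)
    (h : c.genus = 0) (x : (extendVMod E).obj c i) :
    extendDesc f c i x = f (c.toCyclic h) i (x ⟨h⟩) := by
  rw [extendDesc, dif_pos h]
  rfl

theorem extendVMod_eq_zero {E : VMod k .cyclic} {c : Vertex .modular} {i : ℤ} (h : ¬ c.genus = 0)
    (x : (extendVMod E).obj c i) : x = 0 :=
  funext fun h' => (h h'.down).elim

/-- The universal property of the modular envelope. -/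
def envelopeLift {P : Operad k .cyclic p} {M : Operad k .modular p} (f : P ⟶ forgetObj M) :
    envelopeObj P ⟶ M :=
  Operad.desc
    (freeDG.lift (extendDesc f.app)
      (fun σ c c' h i x => by
        by_cases h₀ : c'.genus = 0
        · have h₁ : c.genus = 0 := h.genus.symm.trans h₀
          refine (congrArg _ (extendDesc_apply f.app c i h₁ x)).trans
            (Eq.trans ?_ (extendDesc_apply f.app c' i h₀ _).symm)
          exact (f.app_act σ (h.toCyclic h₁ h₀) _).symm
        · have h₁ : ¬ c.genus = 0 := fun e => h₀ (h.genus.trans e)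
          rw [extendVMod_eq_zero h₁ x]
          simp only [map_zero]))
    (by
      rintro c l _ (⟨i, h, x, rfl⟩ | ⟨a, b, c₁, c₂, h, i, j, hl, x, y, rfl⟩)
      · rw [map_sub, Operad.Hom.app_d, sub_eq_zero]
        change M.d h (extendDesc f.app c i x) = extendDesc f.app c l _
        by_cases h₀ : c.genus = 0
        · rw [extendDesc_apply f.app c i h₀, extendDesc_apply f.app c l h₀]
          exact (f.app_d (c := c.toCyclic h₀) h (x ⟨h₀⟩)).symm
        · rw [extendVMod_eq_zero h₀ x]
          simp only [map_zero]
      · rw [map_sub, Operad.Hom.app_glue, sub_eq_zero]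
        change M.glue a b h hl (extendDesc f.app c₁ i x) (extendDesc f.app c₂ j y) =
          extendDesc f.app c l _
        by_cases h₀ : c.genus = 0
        · refine (congrArg₂ (fun u v => M.glue a b h hl u v)
            (extendDesc_apply f.app c₁ i (h.left_genus h₀) x)
            (extendDesc_apply f.app c₂ j (h.right_genus h₀) y)).trans
              (Eq.trans ?_ (extendDesc_apply f.app c l h₀ _).symm)
          exact (f.app_glue (h.toCyclic (h.left_genus h₀) (h.right_genus h₀) h₀) hl _ _).symm
        -- If `c` has positive genus, then so has `c₁` or `c₂`, and there the extension by zero has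
        -- no nonzero elements.
        · have : x = 0 ∨ y = 0 := by
            by_cases h₁ : c₁.genus = 0
            · exact Or.inr (extendVMod_eq_zero (fun h₂ => h₀ (by rw [h.genus, h₁, h₂])) y)
            · exact Or.inl (extendVMod_eq_zero h₁ x)
          have e : (extendObj P).glue a b h hl x y = 0 := extendVMod_eq_zero h₀ _
          refine Eq.trans ?_ ((congrArg _ e).trans (map_zero (extendDesc f.app c l))).symm
          rcases this with rfl | rfl <;> simp only [map_zero, LinearMap.zero_apply])

theorem envelopeLift_gen {P : Operad k .cyclic p} {M : Operad k .modular p}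
    (f : P ⟶ forgetObj M) {c : Vertex .modular} {i : ℤ} (h : c.genus = 0)
    (x : (extendVMod P.toVMod).obj c i) :
    (envelopeLift f).app c i (envelopeGen P c i x) = f.app (c.toCyclic h) i (x ⟨h⟩) :=
  extendDesc_apply f.app c i h x

theorem envelopeUnit_lift {P : Operad k .cyclic p} {M : Operad k .modular p}
    (f : P ⟶ forgetObj M) : envelopeUnit P ≫ (forgetHigher k p).map (envelopeLift f) = f :=
  Operad.hom_ext fun c i x => extendDesc_apply f.app c.toModular i c.allowed
    ((constZero P).app c i x)

end Adjunctions

/-! ### The Feynman transform against restriction, extension by zero and the envelope -/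

section Comparison

variable {k : Type u} [Field k] {p : Parity}

/-- The comparison `D R P → R D P`. -/
def feynmanForget {P : Operad k .modular p} (hP : P.IsFiniteType) :
    feynmanObj (forgetObj P) ⟶ forgetObj (feynmanObj P) :=
  feynmanLift (finType_forget P hP) (fun c i => feynmanGen P c.toModular i)
    (fun σ c c' h i x => feynmanGen_act P σ h.toModular x)
    (fun a b c hab ha hb i l h f => (feynmanGen_d hP (c := c.toModular) hab ha hb h f).trans
      (congrArg₂ _ rfl (edgeSum_forget _ a b h f).symm))

/-- Restriction is left adjoint to extension by zero, so a map out of `R D P` is a map `D P → L^!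
Y`, and such a map is determined by its values on generators. -/
theorem forget_feynman_hom_ext {P : Operad k .modular p} {Y : Operad k .cyclic p.flip}
    {f g : forgetObj (feynmanObj P) ⟶ Y}
    (h : ∀ c i x, f.app c i (feynmanGen P c.toModular i x) =
      g.app c i (feynmanGen P c.toModular i x)) : f = g := by
  have : toExtend f = toExtend g :=
    feynmanObj_hom_ext fun c i x => funext fun h₀ => h (c.toCyclic h₀.down) i x
  exact Operad.hom_ext fun c i x =>
    congrFun (congrArg (fun e : feynmanObj P ⟶ extendObj Y => e.app c.toModular i x) this :)
      ⟨c.allowed⟩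

/-- The counit `R L^! Y → Y` is a morphism, hence preserves edge sums, and in genus zero the modular
and the cyclic edge sums agree. This is what makes the comparison `D P → L^! D R P` respect the
differential. -/
theorem edgeSum_extend {P : Operad k .modular p} (hP : P.IsFiniteType) {Y : Operad k .cyclic p.flip}
    (γ : ∀ (c : Vertex .cyclic) i, (forgetObj P).dual.obj c i →ₗ[k] Y.obj c i)
    (a b : ℕ) {c : Vertex .cyclic} {i l : ℤ} (h : i + 1 = l)
    (f : Module.Dual k (P.obj c.toModular (-i))) :
    (show (extendObj Y).obj c.toModular l from
      edgeSum (V := P.toVMod) (P := P) (Q := extendObj Y) (fun _ _ => LinearMap.id)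
      (fun c i => LinearMap.pi fun h : PLift (c.genus = 0) => γ (c.toCyclic h.down) i) a b
      (c := c.toModular) h f) ⟨c.allowed⟩ =
    edgeSum (P := forgetObj P) (fun _ _ => LinearMap.id) γ a b (c := c) h f := by
  have e := edgeSum_forget (P := P) (Q := extendObj Y)
    (fun c i => LinearMap.pi fun h : PLift (c.genus = 0) => γ (c.toCyclic h.down) i) a b h f
  have e' := app_edgeSum (P := forgetObj P) (finType_forget P hP) (fun _ _ => LinearMap.id)
    (fun c i => LinearMap.pi fun h : PLift (c.genus = 0) => γ c i) a b h f (evalZero Y)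
  exact (congrFun e ⟨c.allowed⟩).symm.trans e'

/-- The comparison `D P → L^! D R P`. -/
def feynmanExtend {P : Operad k .modular p} (hP : P.IsFiniteType) :
    feynmanObj P ⟶ extendObj (feynmanObj (forgetObj P)) :=
  feynmanLift hP
    (fun c i => LinearMap.pi fun h : PLift (c.genus = 0) =>
      feynmanGen (forgetObj P) (c.toCyclic h.down) i)
    (fun σ c c' h i x => funext fun h₀ => feynmanGen_act (forgetObj P) σ
      (h.toCyclic (h.genus.symm.trans h₀.down) h₀.down) x)
    (fun a b c hab ha hb i l h f => funext fun h₀ => by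
      refine (feynmanGen_d (finType_forget P hP) (c := c.toCyclic h₀.down) hab ha hb h f).trans
        (congrArg₂ _ rfl ?_)
      exact (edgeSum_extend hP _ a b (c := c.toCyclic h₀.down) h f).symm)

/-- The isomorphism `D R P ≅ R D P`. -/
def feynmanForgetIso {P : Operad k .modular p} (hP : P.IsFiniteType) :
    feynmanObj (forgetObj P) ≅ forgetObj (feynmanObj P) where
  hom := feynmanForget hP
  inv := (forgetHigher k p.flip).map (feynmanExtend hP) ≫ evalZero _
  hom_inv_id := feynmanObj_hom_ext fun c i x => rfl
  inv_hom_id := forget_feynman_hom_ext fun c i x => rfl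

/-- The comparison `L D Q → D L^! Q`. -/
def envelopeFeynman {Q : Operad k .cyclic p} (hQ : Q.IsFiniteType) :
    envelopeObj (feynmanObj Q) ⟶ feynmanObj (extendObj Q) :=
  envelopeLift (feynmanMap (finType_forget _ (finType_extend Q hQ)) hQ (evalZero Q) ≫
    feynmanForget (finType_extend Q hQ))

/-- On generators, the comparison `D L^! Q → L D Q`. -/
def feynmanEnvelopeGen (Q : Operad k .cyclic p) (c : Vertex .modular) (i : ℤ) :
    (extendObj Q).dual.obj c i →ₗ[k] (envelopeObj (feynmanObj Q)).obj c i :=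
  envelopeGen (feynmanObj Q) c i ∘ₗ LinearMap.pi fun h : PLift (c.genus = 0) =>
    feynmanGen Q (c.toCyclic h.down) i ∘ₗ
      VMod.dualMap (constZero Q).app (c.toCyclic h.down) i

/-- The comparison `D L^! Q → L D Q`. -/
def feynmanEnvelope {Q : Operad k .cyclic p} (hQ : Q.IsFiniteType) :
    feynmanObj (extendObj Q) ⟶ envelopeObj (feynmanObj Q) :=
  feynmanLift (finType_extend Q hQ) (feynmanEnvelopeGen Q)
    (fun σ c c' h i x => by
      refine (envelopeGen_act (feynmanObj Q) σ h _).trans (congrArg _ (funext fun h₀ => ?_))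
      exact feynmanGen_act Q σ (h.toCyclic (h.genus.symm.trans h₀.down) h₀.down) _)
    (fun a b c hab ha hb i l h f => by
      by_cases h₀ : c.genus = 0
      -- In genus zero the required formula is the image, under the unit `D Q → R L D Q`, of the
      -- formula for the differential in `D Q`, applied to the functional that corresponds to `f`
      -- under `Q ≅ R L^! Q`.
      · have e := congrArg ((envelopeUnit (feynmanObj Q)).app (c.toCyclic h₀) l)
          (feynmanGen_d hQ (c := c.toCyclic h₀) hab ha hb h (f ∘ₗ (constZero Q).app _ _))
        rw [Operad.Hom.app_d, map_sub, app_edgeSum hQ] at e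
        refine Eq.trans e (congrArg₂ (· - ·) rfl ?_)
        refine Eq.trans ?_ (edgeSum_forget (feynmanEnvelopeGen Q) a b (c := c.toCyclic h₀) h f)
        exact (edgeSum_comp hQ (finType_forget _ (finType_extend Q hQ)) (fun _ _ => LinearMap.id)
          (fun _ _ => LinearMap.id)
          (fun c i => (envelopeUnit (feynmanObj Q)).app c i ∘ₗ feynmanGen Q c i)
          (fun c i => feynmanEnvelopeGen Q c.toModular i) (constZero Q).app (constZero Q)
          (fun _ _ _ => rfl) (fun _ _ _ => rfl) a b (c := c.toCyclic h₀) h f).symm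
      -- In positive genus `L^! Q` vanishes, so there are no nonzero functionals and both sides are
      -- zero.
      · have hf : f = 0 := LinearMap.ext fun x => by
          have hx : x = 0 := extendVMod_eq_zero h₀ x
          rw [hx, map_zero, map_zero]
        rw [edgeSum_eq_zero _ _ a b h hf, hf]
        simp only [map_zero, sub_zero])

/-- The isomorphism `D L^! Q ≅ L D Q`. -/
def feynmanEnvelopeIso {Q : Operad k .cyclic p} (hQ : Q.IsFiniteType) :
    feynmanObj (extendObj Q) ≅ envelopeObj (feynmanObj Q) where
  hom := feynmanEnvelope hQ
  inv := envelopeFeynman hQ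
  hom_inv_id := feynmanObj_hom_ext fun c i x => by
    by_cases h₀ : c.genus = 0
    · exact envelopeLift_gen _ h₀ _
    · have hx : x = 0 := LinearMap.ext fun y => by
        have hy : y = 0 := extendVMod_eq_zero h₀ y
        rw [hy]
        exact (map_zero (show Module.Dual k _ from x)).trans
          (map_zero (show Module.Dual k _ from 0)).symm
      rw [hx, map_zero, map_zero, map_zero]
  -- Maps out of `L D Q` are tested on the unit, and the resulting maps out of `D Q` on generators.
  inv_hom_id := envelope_hom_ext' (feynmanObj_hom_ext fun c i x => by
    refine (congrArg ((feynmanEnvelope hQ).app c.toModular i)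
      (envelopeLift_gen _ (c := c.toModular) c.allowed _)).trans ?_
    rfl)

/-- The Feynman transform commutes with the restriction to genus zero. -/
def feynmanForgetNatIso (k : Type u) [Field k] (p : Parity) :
    (forgetHigherFin k p).op ⋙ feynman k .cyclic p ≅
      feynman k .modular p ⋙ forgetHigher k p.flip :=
  NatIso.ofComponents (fun P => feynmanForgetIso P.unop.property)
    (fun φ => feynmanObj_hom_ext fun c i x => rfl)

/-- The Feynman transform takes extension by zero to the modular envelope. -/
def feynmanEnvelopeNatIso (k : Type u) [Field k] (p : Parity) :
    (extendZeroFin k p).op ⋙ feynman k .modular p ≅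
      feynman k .cyclic p ⋙ envelope k p.flip :=
  NatIso.ofComponents (fun P => feynmanEnvelopeIso P.unop.property)
    (fun φ => feynmanObj_hom_ext fun c i x => rfl)

end Comparison

/-! ### Signs -/

section Signs

variable (k : Type u) [Field k]

theorem sgn_add (a b : ℤ) : sgn k (a + b) = sgn k a * sgn k b := by
  simp [sgn, Int.negOnePow_add]

theorem sgn_zero : sgn k 0 = 1 := by simp [sgn]

theorem sgn_one : sgn k 1 = -1 := by simp [sgn]

variable {k}

/-- Many of the sign checks for tensor products pass through here: exponents are compared in `ZMod
2`, where `p.deg` is idempotent and `p.flip.deg` is `1 + p.deg`. -/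
theorem sgn_congr {a b : ℤ} (h : (a : ZMod 2) = b) : sgn k a = sgn k b := by
  have : a.negOnePow = b.negOnePow := by
    rw [Int.negOnePow_eq_iff, even_iff_two_dvd]
    exact (ZMod.intCast_eq_intCast_iff_dvd_sub b a 2).1 h.symm
  rw [sgn, sgn, this]

theorem Parity.deg_mul_self (p : Parity) : (p.deg : ZMod 2) * p.deg = p.deg := by
  cases p <;> rfl

theorem sgn_smul_congr {M : Type*} [AddCommGroup M] [Module k M] {a b : ℤ}
    (h : (a : ZMod 2) = b) {x y : M} (hxy : x = y) : sgn k a • x = sgn k b • y := by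
  rw [sgn_congr h, hxy]

end Signs

/-! ### Extension of coefficients to polynomials -/

section Poly

open TensorProduct Polynomial

variable {k : Type u} [Field k] {t : Kind} {p : Parity}

/-- The operad `k[X] ⊗ A`. -/
noncomputable def polyObj (A : Operad k t p) : Operad k t p where
  obj c i := k[X] ⊗[k] A.obj c i
  d h := (A.d h).lTensor k[X]
  act σ {_ _} h {_} := (A.act σ h).lTensor k[X]
  glue a b {_ _ _} h {_ _ _} hl := TensorProduct.map₂ (LinearMap.mul k k[X]) (A.glue a b h hl)
  loop a b {_ _} h {_ _} hl := (A.loop a b h hl).lTensor k[X]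
  d_d h h' x := by
    induction x with
    | zero => simp only [map_zero]
    | tmul f x => simp [A.d_d]
    | add x y hx hy => simp only [map_add, hx, hy, add_zero]
  act_id σ {_} h {_} x hσ := by
    induction x with
    | zero => simp only [map_zero]
    | tmul f x => simp [A.act_id σ h x hσ]
    | add x y hx hy => simp only [map_add, hx, hy]
  act_act σ τ {_ _ _} h h' h'' {_} x := by
    induction x with
    | zero => simp only [map_zero]
    | tmul f x => simp [A.act_act σ τ h h' h'']
    | add x y hx hy => simp only [map_add, hx, hy]
  act_d σ {_ _} h {_ _} hij x := by
    induction x with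
    | zero => simp only [map_zero]
    | tmul f x => simp [A.act_d]
    | add x y hx hy => simp only [map_add, hx, hy]
  act_glue σ {_ _ _ _ _ _ _ _} h h' h₁ h₂ h₀ {_ _ _} hl x y := by
    induction x with
    | zero => simp only [map_zero, LinearMap.zero_apply]
    | add x x' hx hx' => simp only [map_add, LinearMap.add_apply, hx, hx']
    | tmul f x =>
      induction y with
      | zero => simp only [map_zero]
      | add y y' hy hy' => simp only [map_add, hy, hy']
      | tmul g y => simp [A.act_glue σ h h' h₁ h₂ h₀ hl]
  act_loop σ {_ _ _ _ _ _} h h' h₁ h₀ {_ _} hl x := by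
    induction x with
    | zero => simp only [map_zero]
    | tmul f x => simp [A.act_loop σ h h' h₁ h₀ hl]
    | add x y hx hy => simp only [map_add, hx, hy]
  d_glue {_ _ _ _ _} h {_ _ _ _ _ _} hl hi hj hl' h₁ h₂ x y := by
    induction x with
    | zero => simp only [map_zero, LinearMap.zero_apply, smul_zero, add_zero]
    | add x x' hx hx' =>
      simp only [map_add, LinearMap.add_apply, hx, hx', smul_add]
      abel
    | tmul f x =>
      induction y with
      | zero => simp only [map_zero, smul_zero, add_zero]
      | add y y' hy hy' =>
        simp only [map_add, hy, hy', smul_add]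
        abel
      | tmul g y => simp [A.d_glue h hl hi hj hl' h₁ h₂, tmul_add, tmul_smul]
  d_loop {_ _ _ _} h {_ _ _ _} hl hi hl' h₁ x := by
    induction x with
    | zero => simp only [map_zero, smul_zero]
    | tmul f x => simp [A.d_loop h hl hi hl' h₁, tmul_smul]
    | add x y hx hy => simp only [map_add, hx, hy, smul_add]
  glue_symm {_ _ _ _ _} h h' {_ _ _} hl hl' x y := by
    induction x with
    | zero => simp only [map_zero, LinearMap.zero_apply, smul_zero]
    | add x x' hx hx' => simp only [map_add, LinearMap.add_apply, hx, hx', smul_add]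
    | tmul f x =>
      induction y with
      | zero => simp only [map_zero, smul_zero, LinearMap.zero_apply]
      | add y y' hy hy' => simp only [map_add, LinearMap.add_apply, hy, hy', smul_add]
      -- Commutativity of `k[X]` is needed for the symmetry of the contraction; as `k[X]` sits in
      -- degree zero it causes no signs.
      | tmul g y => simp [A.glue_symm h h' hl hl', tmul_smul, mul_comm f g]
  loop_symm {_ _ _ _} h h' {_ _} hl x := by
    induction x with
    | zero => simp only [map_zero]
    | tmul f x => simp [A.loop_symm h h']
    | add x y hx hy => simp only [map_add, hx, hy]
  glue_glue {_ _ _ _ _ _ _ _ _ _} h₁₂ h₁ h₂₃ h₃ {_ _ _ _ _ _} hm hr hn hr' x y z := by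
    induction x with
    | zero => simp only [map_zero, LinearMap.zero_apply, smul_zero]
    | add x x' hx hx' => simp only [map_add, LinearMap.add_apply, hx, hx', smul_add]
    | tmul f x =>
      induction y with
      | zero => simp only [map_zero, smul_zero, LinearMap.zero_apply]
      | add y y' hy hy' => simp only [map_add, LinearMap.add_apply, hy, hy', smul_add]
      | tmul g y =>
        induction z with
        | zero => simp only [map_zero, smul_zero]
        | add z z' hz hz' => simp only [map_add, hz, hz', smul_add]
        | tmul e z => simp [A.glue_glue h₁₂ h₁ h₂₃ h₃ hm hr hn hr', tmul_smul, mul_assoc]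
  loop_loop {_ _ _ _ _ _ _ _} h₁ h₁' h₂ h₂' {_ _ _} hl hr x := by
    induction x with
    | zero => simp only [map_zero, smul_zero]
    | tmul f x => simp [A.loop_loop h₁ h₁' h₂ h₂' hl hr, tmul_smul]
    | add x y hx hy => simp only [map_add, hx, hy, smul_add]
  loop_glue {_ _ _ _ _ _ _ _ _} h h' h₁ h₁' {_ _ _ _ _} hl hr hm hr' x y := by
    induction x with
    | zero => simp only [map_zero, LinearMap.zero_apply, smul_zero]
    | add x x' hx hx' => simp only [map_add, LinearMap.add_apply, hx, hx', smul_add]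
    | tmul f x =>
      induction y with
      | zero => simp only [map_zero, smul_zero]
      | add y y' hy hy' => simp only [map_add, hy, hy', smul_add]
      | tmul g y => simp [A.loop_glue h h' h₁ h₁' hl hr hm hr', tmul_smul]
  loop_glue' {_ _ _ _ _ _ _ _ _} h h₁ h' h₁' {_ _ _ _} hl hr x y := by
    induction x with
    | zero => simp only [map_zero, LinearMap.zero_apply, smul_zero]
    | add x x' hx hx' => simp only [map_add, LinearMap.add_apply, hx, hx', smul_add]
    | tmul f x =>
      induction y with
      | zero => simp only [map_zero, smul_zero]
      | add y y' hy hy' => simp only [map_add, hy, hy', smul_add]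
      | tmul g y => simp [A.loop_glue' h h₁ h' h₁' hl hr, tmul_smul]

end Poly

/-! ### Signs square to one -/

section Signs

variable (k : Type u) [Field k]

theorem sgn_mul_self (a : ℤ) : sgn k a * sgn k a = 1 := by
  rw [← sgn_add, ← sgn_zero]
  exact sgn_congr (by push_cast; exact CharTwo.add_self_eq_zero _)

theorem sgn_sub (a b : ℤ) : sgn k (a - b) = sgn k a * sgn k b := by
  rw [← sgn_add]
  exact sgn_congr (by push_cast; rw [CharTwo.sub_eq_add])

end Signs

/-! ### Adjoining the differential of a parameter -/

section AdjoinDt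

variable {k : Type u} [Field k] {t : Kind} {p : Parity}

/-- A derivation of degree zero of an operad. -/
structure Operad.Deriv (B : Operad k t p) where
  app : ∀ {c : Vertex t} {i j : ℤ}, i = j → (B.obj c i →ₗ[k] B.obj c j)
  app_d : ∀ {c : Vertex t} {i j i' j' : ℤ} (h : i = j) (h' : i' = j') (hi : i + 1 = i')
    (hj : j + 1 = j') (x : B.obj c i), app h' (B.d hi x) = B.d hj (app h x)
  app_act : ∀ (σ : Equiv.Perm ℕ) {c c' : Vertex t} (h : IsRelabel σ c c') {i j : ℤ} (hij : i = j)
    (x : B.obj c i), app hij (B.act σ h x) = B.act σ h (app hij x)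
  app_glue : ∀ {a b : ℕ} {c₁ c₂ c : Vertex t} (h : IsGlue a b c₁ c₂ c) {i j l i' j' l' : ℤ}
    (hi : i = i') (hj : j = j') (hll : l = l') (hl : i + j + p.deg = l)
    (h₁ : i' + j + p.deg = l') (h₂ : i + j' + p.deg = l') (x : B.obj c₁ i) (y : B.obj c₂ j),
    app hll (B.glue a b h hl x y) = B.glue a b h h₁ (app hi x) y + B.glue a b h h₂ x (app hj y)
  app_loop : ∀ {a b : ℕ} {c₁ c : Vertex t} (h : IsLoop a b c₁ c) {i l i' l' : ℤ}
    (hi : i = i') (hll : l = l') (hl : i + p.deg = l) (hl' : i' + p.deg = l') (x : B.obj c₁ i),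
    app hll (B.loop a b h hl x) = B.loop a b h hl' (app hi x)

/-- The operad of the elements `x + dt y`, where `d x` is the differential of `B` plus `dt` times
the derivation. -/
def Operad.Deriv.dtObj {B : Operad k t p} (D : B.Deriv) : Operad k t p where
  obj c i := B.obj c i × B.obj c (i - 1)
  d {c i j} h :=
    -- The differential of `x + dt y` is `d x + dt (D x) - dt (d y)`: the minus sign comes from
    -- moving `d` past `dt`.
    { toFun := fun x => (B.d h x.1, D.app (show i = j - 1 by omega) x.1 -
        B.d (show i - 1 + 1 = j - 1 by omega) x.2)
      map_add' := fun x y => by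
        ext
        · simp
        · simp only [Prod.fst_add, Prod.snd_add, map_add]; abel
      map_smul' := fun r x => by ext <;> simp [smul_sub] }
  act σ {c c'} h {i} := (B.act σ h).prodMap (B.act σ h)
  glue a b {c₁ c₂ c} h {i j l} hl :=
    -- Here `dt` is moved to the front: past the operation, of degree `p.deg`, and in the second
    -- summand also past `x.1`, of degree `i`. The product of the two `dt` components is dropped
    -- since `dt` squares to zero.
    LinearMap.mk₂ k (fun x y => (B.glue a b h hl x.1 y.1,
        sgn k p.deg • (B.glue a b h (show i - 1 + j + p.deg = l - 1 by omega) x.2 y.1 +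
          sgn k i • B.glue a b h (show i + (j - 1) + p.deg = l - 1 by omega) x.1 y.2)))
      (fun x x' y => by
        ext
        · simp
        · simp only [Prod.fst_add, Prod.snd_add, map_add, LinearMap.add_apply, smul_add]; abel)
      (fun r x y => by
        ext
        · simp
        · simp only [Prod.smul_fst, Prod.smul_snd, map_smul, LinearMap.smul_apply, smul_add,
            smul_comm r])
      (fun x y y' => by
        ext
        · simp
        · simp only [Prod.fst_add, Prod.snd_add, map_add, smul_add]; abel)
      (fun r x y => by
        ext
        · simp
        · simp only [Prod.smul_fst, Prod.smul_snd, map_smul, smul_add, smul_comm r])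
  loop a b {c₁ c} h {i l} hl := (B.loop a b h hl).prodMap
    (sgn k p.deg • B.loop a b h (show i - 1 + p.deg = l - 1 by omega))
  d_d {c i j l} h h' x := by
    ext
    · exact B.d_d h h' x.1
    · change D.app _ (B.d h x.1) - B.d _ (D.app _ x.1 - B.d _ x.2) = 0
      -- The coefficient of `dt` in `d (d x)` is the commutator of the derivation with `d`, which
      -- vanishes.
      rw [map_sub, B.d_d, sub_zero,
        D.app_d (show i = j - 1 by omega) _ h (show j - 1 + 1 = l - 1 by omega), sub_self]
  act_id σ {c} h {i} x hσ := Prod.ext (B.act_id σ h x.1 hσ) (B.act_id σ h x.2 hσ)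
  act_act σ τ {_ _ _} h h' h'' {_} x :=
    Prod.ext (B.act_act σ τ h h' h'' x.1) (B.act_act σ τ h h' h'' x.2)
  act_d σ {_ _} h {_ _} hij x := by
    refine Prod.ext (B.act_d σ h hij x.1) ?_
    change B.act σ h (D.app _ x.1 - B.d _ x.2) = D.app _ (B.act σ h x.1) - B.d _ (B.act σ h x.2)
    rw [map_sub, D.app_act, B.act_d]
  act_glue σ {_ _ _ _ _ _ _ _} h h' h₁ h₂ h₀ {_ _ _} hl x y := by
    refine Prod.ext (B.act_glue σ h h' h₁ h₂ h₀ hl x.1 y.1) ?_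
    change B.act σ h₀ (sgn k p.deg • (B.glue _ _ _ _ x.2 y.1 + sgn k _ • B.glue _ _ _ _ x.1 y.2)) =
      sgn k p.deg • (B.glue _ _ _ _ (B.act σ h₁ x.2) (B.act σ h₂ y.1) +
        sgn k _ • B.glue _ _ _ _ (B.act σ h₁ x.1) (B.act σ h₂ y.2))
    rw [map_smul, map_add, map_smul, B.act_glue σ h h' h₁ h₂ h₀, B.act_glue σ h h' h₁ h₂ h₀]
  act_loop σ {_ _ _ _ _ _} h h' h₁ h₀ {_ _} hl x := by
    refine Prod.ext (B.act_loop σ h h' h₁ h₀ hl x.1) ?_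
    change B.act σ h₀ (sgn k p.deg • B.loop _ _ _ _ x.2) =
      sgn k p.deg • B.loop _ _ _ _ (B.act σ h₁ x.2)
    rw [map_smul, B.act_loop σ h h' h₁ h₀]
  d_glue {a b c₁ c₂ c} h {i j i' j' l l'} hl hi hj hl' h₁ h₂ x y := by
    refine Prod.ext (B.d_glue h hl hi hj hl' h₁ h₂ x.1 y.1) ?_
    change D.app _ (B.glue _ _ _ _ x.1 y.1) - B.d _ (sgn k p.deg •
        (B.glue _ _ _ _ x.2 y.1 + sgn k i • B.glue _ _ _ _ x.1 y.2)) =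
      sgn k p.deg • (sgn k p.deg • (B.glue _ _ _ _ (D.app _ x.1 - B.d _ x.2) y.1 +
          sgn k i' • B.glue _ _ _ _ (B.d _ x.1) y.2) +
        sgn k i • sgn k p.deg • (B.glue _ _ _ _ x.2 (B.d _ y.1) +
          sgn k i • B.glue _ _ _ _ x.1 (D.app _ y.1 - B.d _ y.2)))
    rw [map_smul, map_add, map_smul,
      D.app_glue h (show i = i' - 1 by omega) (show j = j' - 1 by omega) _ hl (by omega) (by omega),
      B.d_glue h (show i - 1 + j + p.deg = l - 1 by omega) (show i - 1 + 1 = i' - 1 by omega) hj _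
        (by omega) (by omega),
      B.d_glue h (show i + (j - 1) + p.deg = l - 1 by omega) hi
        (show j - 1 + 1 = j' - 1 by omega) _ (by omega) (by omega)]
    subst hi
    simp only [map_sub, LinearMap.sub_apply, smul_add, smul_sub, sgn_add, sgn_sub, sgn_one]
    have e₁ := sgn_mul_self k p.deg
    have e₂ := sgn_mul_self k i
    match_scalars <;> grind
  d_loop {_ _ _ _} h {i i' l l'} hl hi hl' h₁ x := by
    refine Prod.ext (B.d_loop h hl hi hl' h₁ x.1) ?_
    change D.app _ (B.loop _ _ _ _ x.1) - B.d _ (sgn k p.deg • B.loop _ _ _ _ x.2) =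
      sgn k p.deg • sgn k p.deg • B.loop _ _ _ _ (D.app _ x.1 - B.d _ x.2)
    rw [map_smul, D.app_loop h (show i = i' - 1 by omega) _ hl (by omega),
      B.d_loop h (show i - 1 + p.deg = l - 1 by omega) (show i - 1 + 1 = i' - 1 by omega) _
        (by omega)]
    have e₁ := sgn_mul_self k p.deg
    simp only [map_sub, smul_sub, smul_smul, e₁, one_smul]
  glue_symm {_ _ _ _ _} h h' {i j l} hl hl' x y := by
    refine Prod.ext (B.glue_symm h h' hl hl' x.1 y.1) ?_
    change sgn k p.deg • (B.glue _ _ _ _ y.2 x.1 + sgn k j • B.glue _ _ _ _ y.1 x.2) =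
      sgn k (i * j) • sgn k p.deg • (B.glue _ _ _ _ x.2 y.1 + sgn k i • B.glue _ _ _ _ x.1 y.2)
    rw [B.glue_symm h h' (show i - 1 + j + p.deg = l - 1 by omega) (by omega) x.2 y.1,
      B.glue_symm h h' (show i + (j - 1) + p.deg = l - 1 by omega) (by omega) x.1 y.2]
    have e₁ := sgn_mul_self k i
    have e₂ := sgn_mul_self k j
    simp only [mul_sub, sub_mul, mul_one, one_mul, sgn_sub]
    match_scalars <;> grind
  loop_symm {_ _ _ _} h h' {_ _} hl x := Prod.ext (B.loop_symm h h' hl x.1)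
    (congrArg (sgn k p.deg • ·) (B.loop_symm h h' _ x.2))
  glue_glue {_ _ _ _ _ _ _ _ _ _} h₁₂ h₁ h₂₃ h₃ {i j l m n r} hm hr hn hr' x y z := by
    refine Prod.ext (B.glue_glue h₁₂ h₁ h₂₃ h₃ hm hr hn hr' x.1 y.1 z.1) ?_
    change sgn k p.deg • (B.glue _ _ _ _ (sgn k p.deg • (B.glue _ _ _ _ x.2 y.1 +
        sgn k i • B.glue _ _ _ _ x.1 y.2)) z.1 +
        sgn k m • B.glue _ _ _ _ (B.glue _ _ _ _ x.1 y.1) z.2) =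
      sgn k (p.deg * (i + 1)) • sgn k p.deg • (B.glue _ _ _ _ x.2 (B.glue _ _ _ _ y.1 z.1) +
        sgn k i • B.glue _ _ _ _ x.1 (sgn k p.deg • (B.glue _ _ _ _ y.2 z.1 +
          sgn k j • B.glue _ _ _ _ y.1 z.2)))
    simp only [map_smul, map_add, LinearMap.smul_apply, LinearMap.add_apply]
    rw [B.glue_glue h₁₂ h₁ h₂₃ h₃ (show i - 1 + j + p.deg = m - 1 by omega) (by omega) hn
        (show i - 1 + n + p.deg = r - 1 by omega),
      B.glue_glue h₁₂ h₁ h₂₃ h₃ (show i + (j - 1) + p.deg = m - 1 by omega) (by omega)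
        (show j - 1 + l + p.deg = n - 1 by omega) (show i + (n - 1) + p.deg = r - 1 by omega),
      B.glue_glue h₁₂ h₁ h₂₃ h₃ hm (by omega)
        (show j + (l - 1) + p.deg = n - 1 by omega) (show i + (n - 1) + p.deg = r - 1 by omega)]
    subst hm
    simp only [mul_add, mul_one, sgn_add, sub_add_cancel]
    have e₁ := sgn_mul_self k p.deg
    match_scalars <;> grind
  loop_loop {_ _ _ _ _ _ _ _} h₁ h₁' h₂ h₂' {i l r} hl hr x := by
    refine Prod.ext (B.loop_loop h₁ h₁' h₂ h₂' hl hr x.1) ?_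
    change sgn k p.deg • B.loop _ _ _ _ (sgn k p.deg • B.loop _ _ _ _ x.2) =
      sgn k p.deg • sgn k p.deg • B.loop _ _ _ _ (sgn k p.deg • B.loop _ _ _ _ x.2)
    simp only [map_smul]
    rw [B.loop_loop h₁ h₁' h₂ h₂' (show i - 1 + p.deg = l - 1 by omega)]
  loop_glue {_ _ _ _ _ _ _ _ _} h h' h₁ h₁' {i j l m r} hl hr hm hr' x y := by
    refine Prod.ext (B.loop_glue h h' h₁ h₁' hl hr hm hr' x.1 y.1) ?_
    change sgn k p.deg • B.loop _ _ _ _ (sgn k p.deg • (B.glue _ _ _ _ x.2 y.1 +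
        sgn k i • B.glue _ _ _ _ x.1 y.2)) =
      sgn k p.deg • sgn k p.deg • (B.glue _ _ _ _ (sgn k p.deg • B.loop _ _ _ _ x.2) y.1 +
        sgn k m • B.glue _ _ _ _ (B.loop _ _ _ _ x.1) y.2)
    simp only [map_smul, map_add, LinearMap.smul_apply]
    rw [B.loop_glue h h' h₁ h₁' (show i - 1 + j + p.deg = l - 1 by omega) (by omega)
        (show i - 1 + p.deg = m - 1 by omega) (by omega),
      B.loop_glue h h' h₁ h₁' (show i + (j - 1) + p.deg = l - 1 by omega) (by omega) hm (by omega)]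
    subst hm
    simp only [sgn_add]
    have e₁ := sgn_mul_self k p.deg
    match_scalars <;> grind
  loop_glue' {_ _ _ _ _ _ _ _ _} h h₁ h' h₁' {i j l r} hl hr x y := by
    refine Prod.ext (B.loop_glue' h h₁ h' h₁' hl hr x.1 y.1) ?_
    change sgn k p.deg • B.loop _ _ _ _ (sgn k p.deg • (B.glue _ _ _ _ x.2 y.1 +
        sgn k i • B.glue _ _ _ _ x.1 y.2)) =
      sgn k p.deg • sgn k p.deg • B.loop _ _ _ _ (sgn k p.deg • (B.glue _ _ _ _ x.2 y.1 +
        sgn k i • B.glue _ _ _ _ x.1 y.2))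
    simp only [map_smul, map_add]
    rw [B.loop_glue' h h₁ h' h₁' (show i - 1 + j + p.deg = l - 1 by omega) (by omega),
      B.loop_glue' h h₁ h' h₁' (show i + (j - 1) + p.deg = l - 1 by omega) (by omega)]
    have e₁ := sgn_mul_self k p.deg
    match_scalars <;> grind

end AdjoinDt

/-! ### Morphisms to and from operads with `dt` adjoined -/

section DtFunctor

variable {k : Type u} [Field k] {t : Kind} {p : Parity}

/-- The projection that sets `dt = 0`. -/
def Operad.Deriv.dtFst {B : Operad k t p} (D : B.Deriv) : D.dtObj ⟶ B where
  app c i := LinearMap.fst k _ _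
  app_d _ _ := rfl
  app_act _ _ _ _ _ _ := rfl
  app_glue _ _ _ _ _ _ _ := rfl
  app_loop _ _ _ _ _ := rfl

/-- Elements that are annihilated by the derivation. -/
def Operad.Deriv.dtInl {A B : Operad k t p} (D : B.Deriv) (φ : A ⟶ B)
    (hφ : ∀ {c : Vertex t} {i j : ℤ} (h : i = j) (x : A.obj c i), D.app h (φ.app c i x) = 0) :
    A ⟶ D.dtObj where
  app c i := LinearMap.inl k (B.obj c i) (B.obj c (i - 1)) ∘ₗ φ.app c i
  app_d {c i j} h x := by
    refine Prod.ext (φ.app_d h x) ?_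
    change 0 = D.app _ (φ.app c i x) - B.d _ 0
    rw [hφ, map_zero, sub_zero]
  app_act σ _ _ h _ x := Prod.ext (φ.app_act σ h x) (map_zero (B.act σ h)).symm
  app_glue {a b c₁ c₂ c} h i j l hl x y := by
    refine Prod.ext (φ.app_glue h hl x y) ?_
    change 0 = sgn k p.deg • (B.glue a b h _ 0 (φ.app c₂ j y) +
      sgn k i • B.glue a b h _ (φ.app c₁ i x) 0)
    simp only [map_zero, LinearMap.zero_apply, smul_zero, add_zero]
  app_loop {a b c₁ c} h {_ _} hl x := by
    refine Prod.ext (φ.app_loop h hl x) ?_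
    change 0 = sgn k p.deg • B.loop a b h _ 0
    rw [map_zero, smul_zero]

/-- Functoriality of the adjunction of `dt`. -/
def Operad.Deriv.dtMap {B B' : Operad k t p} (D : B.Deriv) (D' : B'.Deriv) (φ : B ⟶ B')
    (hφ : ∀ {c : Vertex t} {i j : ℤ} (h : i = j) (x : B.obj c i),
      D'.app h (φ.app c i x) = φ.app c j (D.app h x)) : D.dtObj ⟶ D'.dtObj where
  app c i := (φ.app c i).prodMap (φ.app c (i - 1))
  app_d {c i j} h x := by
    refine Prod.ext (φ.app_d h x.1) ?_
    change φ.app c (j - 1) (D.app _ x.1 - B.d _ x.2) =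
      D'.app _ (φ.app c i x.1) - B'.d _ (φ.app c (i - 1) x.2)
    rw [map_sub, hφ, φ.app_d]
  app_act σ _ _ h _ x := Prod.ext (φ.app_act σ h x.1) (φ.app_act σ h x.2)
  app_glue {a b c₁ c₂ c} h i j l hl x y := by
    refine Prod.ext (φ.app_glue h hl x.1 y.1) ?_
    change φ.app c _ (sgn k p.deg • (B.glue a b h _ x.2 y.1 + sgn k i • B.glue a b h _ x.1 y.2)) =
      sgn k p.deg • (B'.glue a b h _ (φ.app c₁ _ x.2) (φ.app c₂ _ y.1) +
        sgn k i • B'.glue a b h _ (φ.app c₁ _ x.1) (φ.app c₂ _ y.2))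
    rw [map_smul, map_add, map_smul, φ.app_glue, φ.app_glue]
  app_loop {a b c₁ c} h {i l} hl x := by
    refine Prod.ext (φ.app_loop h hl x.1) ?_
    change φ.app c _ (sgn k p.deg • B.loop a b h _ x.2) =
      sgn k p.deg • B'.loop a b h _ (φ.app c₁ _ x.2)
    rw [map_smul, φ.app_loop]

end DtFunctor

/-! ### Path objects -/

section Path

open TensorProduct Polynomial

variable {k : Type u} [Field k] {t : Kind} {p : Parity}

/-- The elements `f ⊗ x` of `k[X] ⊗ A`. -/
noncomputable def polyMk (A : Operad k t p) (c : Vertex t) (i : ℤ) :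
    k[X] →ₗ[k] A.obj c i →ₗ[k] (polyObj A).obj c i :=
  TensorProduct.mk k k[X] (A.obj c i)

theorem polyObj_induction {A : Operad k t p} {c : Vertex t} {i : ℤ}
    {motive : (polyObj A).obj c i → Prop} (zero : motive 0)
    (mk : ∀ f x, motive (polyMk A c i f x)) (add : ∀ x y, motive x → motive y → motive (x + y))
    (x : (polyObj A).obj c i) : motive x :=
  TensorProduct.induction_on x zero mk add

/-- Linear maps out of `k[X] ⊗ A`. -/
noncomputable def polyLift {A : Operad k t p} {c : Vertex t} {i : ℤ} {M : Type u} [AddCommGroup M]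
    [Module k M] (f : k[X] →ₗ[k] A.obj c i →ₗ[k] M) : (polyObj A).obj c i →ₗ[k] M :=
  TensorProduct.lift f

theorem polyLift_mk {A : Operad k t p} {c : Vertex t} {i : ℤ} {M : Type u} [AddCommGroup M]
    [Module k M] (f : k[X] →ₗ[k] A.obj c i →ₗ[k] M) (g : k[X]) (x : A.obj c i) :
    polyLift f (polyMk A c i g x) = f g x :=
  rfl

theorem polyObj_d (A : Operad k t p) {c : Vertex t} {i j : ℤ} (h : i + 1 = j) (f : k[X])
    (x : A.obj c i) : (polyObj A).d h (polyMk A c i f x) = polyMk A c j f (A.d h x) :=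
  rfl

theorem polyObj_act (A : Operad k t p) (σ : Equiv.Perm ℕ) {c c' : Vertex t} (h : IsRelabel σ c c')
    {i : ℤ} (f : k[X]) (x : A.obj c i) :
    (polyObj A).act σ h (polyMk A c i f x) = polyMk A c' i f (A.act σ h x) :=
  rfl

theorem polyObj_glue (A : Operad k t p) {a b : ℕ} {c₁ c₂ c : Vertex t} (h : IsGlue a b c₁ c₂ c)
    {i j l : ℤ} (hl : i + j + p.deg = l) (f g : k[X]) (x : A.obj c₁ i) (y : A.obj c₂ j) :
    (polyObj A).glue a b h hl (polyMk A c₁ i f x) (polyMk A c₂ j g y) =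
      polyMk A c l (f * g) (A.glue a b h hl x y) :=
  rfl

theorem polyObj_loop (A : Operad k t p) {a b : ℕ} {c₁ c : Vertex t} (h : IsLoop a b c₁ c)
    {i l : ℤ} (hl : i + p.deg = l) (f : k[X]) (x : A.obj c₁ i) :
    (polyObj A).loop a b h hl (polyMk A c₁ i f x) = polyMk A c l f (A.loop a b h hl x) :=
  rfl

/-- Transport along an equality of degrees. -/
def VMod.castMap (A : VMod k t) {c : Vertex t} {i j : ℤ} (h : i = j) : A.obj c i →ₗ[k] A.obj c j :=
  h ▸ LinearMap.id

/-- A linear endomorphism of `k[X]` acts on `k[X] ⊗ A`. -/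
noncomputable def polyApply (A : Operad k t p) (φ : k[X] →ₗ[k] k[X]) {c : Vertex t} {i j : ℤ}
    (h : i = j) : (polyObj A).obj c i →ₗ[k] (polyObj A).obj c j :=
  polyLift ((polyMk A c j).compl₁₂ φ (A.castMap h))

theorem polyApply_mk (A : Operad k t p) (φ : k[X] →ₗ[k] k[X]) {c : Vertex t} {i : ℤ}
    (f : k[X]) (x : A.obj c i) :
    polyApply A φ rfl (polyMk A c i f x) = polyMk A c i (φ f) x :=
  rfl

/-- The derivative of polynomials with coefficients in an operad. -/
noncomputable def polyDeriv (A : Operad k t p) : (polyObj A).Deriv where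
  app {c i j} h := polyApply A Polynomial.derivative h
  app_d h h' hi hj x := by
    subst h h'
    induction x using polyObj_induction with
    | zero => simp only [map_zero]
    | mk f x => rfl
    | add x y hx hy => simp only [map_add, hx, hy]
  app_act σ c c' h i j hij x := by
    subst hij
    induction x using polyObj_induction with
    | zero => simp only [map_zero]
    | mk f x => rfl
    | add x y hx hy => simp only [map_add, hx, hy]
  app_glue {a b c₁ c₂ c} h {i j l i' j' l'} hi hj hll hl h₁ h₂ x y := by
    subst hi hj hll
    induction x using polyObj_induction with
    | zero => simp only [map_zero, LinearMap.zero_apply, add_zero]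
    | add x x' hx hx' => simp only [map_add, LinearMap.add_apply, hx, hx']; abel
    | mk f x =>
      induction y using polyObj_induction with
      | zero => simp only [map_zero, add_zero]
      | add y y' hy hy' => simp only [map_add, hy, hy']; abel
      | mk g y =>
        simp only [polyObj_glue, polyApply_mk, derivative_mul, map_add, LinearMap.add_apply]
  app_loop {a b c₁ c} h {i l i' l'} hi hll hl hl' x := by
    subst hi hll
    induction x using polyObj_induction with
    | zero => simp only [map_zero]
    | mk f x => rfl
    | add x y hx hy => simp only [map_add, hx, hy]

/-- Evaluation of polynomials with coefficients in an operad. -/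
noncomputable def polyEval (r : k) (A : Operad k t p) : polyObj A ⟶ A where
  app c i := polyLift (LinearMap.lsmul k (A.obj c i) ∘ₗ Polynomial.leval r)
  app_d h x := by
    induction x using polyObj_induction with
    | zero => simp only [map_zero]
    | mk f x => simp [polyObj_d, polyLift_mk]
    | add x y hx hy => simp only [map_add, hx, hy]
  app_act σ _ _ h _ x := by
    induction x using polyObj_induction with
    | zero => simp only [map_zero]
    | mk f x => simp [polyObj_act, polyLift_mk]
    | add x y hx hy => simp only [map_add, hx, hy]
  app_glue h _ _ _ hl x y := by
    induction x using polyObj_induction with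
    | zero => simp only [map_zero, LinearMap.zero_apply]
    | add x x' hx hx' => simp only [map_add, LinearMap.add_apply, hx, hx']
    | mk f x =>
      induction y using polyObj_induction with
      | zero => simp only [map_zero]
      | add y y' hy hy' => simp only [map_add, hy, hy']
      | mk g y => simp [polyObj_glue, polyLift_mk, smul_smul, mul_comm]
  app_loop h _ _ hl x := by
    induction x using polyObj_induction with
    | zero => simp only [map_zero]
    | mk f x => simp [polyObj_loop, polyLift_mk]
    | add x y hx hy => simp only [map_add, hx, hy]

theorem polyEval_mk (r : k) (A : Operad k t p) {c : Vertex t} {i : ℤ} (f : k[X])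
    (x : A.obj c i) : (polyEval r A).app c i (polyMk A c i f x) = f.eval r • x :=
  rfl

/-- Constant polynomials. -/
noncomputable def polyConst (A : Operad k t p) : A ⟶ polyObj A where
  app c i := polyMk A c i 1
  app_d _ _ := rfl
  app_act _ _ _ _ _ _ := rfl
  app_glue _ _ _ _ _ _ _ := by rw [polyObj_glue, one_mul]
  app_loop _ _ _ _ _ := rfl

/-- Functoriality of polynomials with coefficients in an operad. -/
noncomputable def polyMap {A B : Operad k t p} (f : A ⟶ B) : polyObj A ⟶ polyObj B where
  app c i := polyLift ((polyMk B c i).compl₂ (f.app c i))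
  app_d h x := by
    induction x using polyObj_induction with
    | zero => simp only [map_zero]
    | mk g x => simp [polyObj_d, polyLift_mk, f.app_d]
    | add x y hx hy => simp only [map_add, hx, hy]
  app_act σ _ _ h _ x := by
    induction x using polyObj_induction with
    | zero => simp only [map_zero]
    | mk g x => simp [polyObj_act, polyLift_mk, f.app_act]
    | add x y hx hy => simp only [map_add, hx, hy]
  app_glue h _ _ _ hl x y := by
    induction x using polyObj_induction with
    | zero => simp only [map_zero, LinearMap.zero_apply]
    | add x x' hx hx' => simp only [map_add, LinearMap.add_apply, hx, hx']
    | mk f x =>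
      induction y using polyObj_induction with
      | zero => simp only [map_zero]
      | add y y' hy hy' => simp only [map_add, hy, hy']
      | mk e y => simp [polyObj_glue, polyLift_mk, Operad.Hom.app_glue]
  app_loop h _ _ hl x := by
    induction x using polyObj_induction with
    | zero => simp only [map_zero]
    | mk g x => simp [polyObj_loop, polyLift_mk, f.app_loop]
    | add x y hx hy => simp only [map_add, hx, hy]

theorem polyMap_mk {A B : Operad k t p} (φ : A ⟶ B) {c : Vertex t} {i : ℤ} (f : k[X])
    (x : A.obj c i) :
    (polyMap φ).app c i (polyMk A c i f x) = polyMk B c i f (φ.app c i x) :=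
  rfl

/-- The path object `A ⊗ k[t, dt]` of an operad. -/
noncomputable def pathObj (A : Operad k t p) : Operad k t p := (polyDeriv A).dtObj

/-- The evaluation of paths at a point. -/
noncomputable def pathEval (r : k) (A : Operad k t p) : pathObj A ⟶ A :=
  (polyDeriv A).dtFst ≫ polyEval r A

/-- Constant paths. -/
noncomputable def pathConst (A : Operad k t p) : A ⟶ pathObj A :=
  (polyDeriv A).dtInl (polyConst A) fun {c i j} h x => by
    subst h
    change polyMk A c i (derivative (1 : k[X])) x = 0
    rw [derivative_one, map_zero, LinearMap.zero_apply]

theorem pathConst_eval (r : k) (A : Operad k t p) : pathConst A ≫ pathEval r A = 𝟙 A := by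
  refine Operad.hom_ext fun c i x => ?_
  change eval r (1 : k[X]) • x = x
  rw [eval_one, one_smul]

/-- Functoriality of path objects. -/
noncomputable def pathMap {A B : Operad k t p} (f : A ⟶ B) : pathObj A ⟶ pathObj B :=
  (polyDeriv A).dtMap (polyDeriv B) (polyMap f) fun {c i j} h x => by
    subst h
    induction x using polyObj_induction with
    | zero => simp only [map_zero]
    | mk g x => rfl
    | add x y hx hy => simp only [map_add, hx, hy]

theorem pathMap_eval (r : k) {A B : Operad k t p} (f : A ⟶ B) :
    pathMap f ≫ pathEval r B = pathEval r A ≫ f := by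
  refine Operad.hom_ext fun c i x => ?_
  obtain ⟨x, y⟩ := x
  change (polyEval r B).app c i ((polyMap f).app c i x) = f.app c i ((polyEval r A).app c i x)
  induction x using polyObj_induction with
  | zero => simp only [map_zero]
  | mk g x => simp only [polyMap_mk, polyEval_mk, map_smul]
  | add x y hx hy => simp only [map_add, hx, hy]

/-- The genus zero part of a path object is a path object. -/
noncomputable def forgetPath (M : Operad k .modular p) :
    pathObj (forgetObj M) ⟶ forgetObj (pathObj M) where
  app c i := LinearMap.id
  app_d _ _ := rfl
  app_act _ _ _ _ _ _ := rfl
  app_glue _ _ _ _ _ _ _ := rfl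
  app_loop h := h.false.elim

/-- The natural map from the envelope of a path object to the path object of the envelope. -/
noncomputable def envelopePath (P : Operad k .cyclic p) :
    envelopeObj (pathObj P) ⟶ pathObj (envelopeObj P) :=
  envelopeLift (pathMap (envelopeUnit P) ≫ forgetPath _)

/-- Tested on the unit of the envelope, this is the naturality of evaluation with respect to
`pathMap`. -/
theorem envelopePath_eval (r : k) (P : Operad k .cyclic p) :
    envelopePath P ≫ pathEval r (envelopeObj P) = (envelope k p).map (pathEval r P) := by
  apply envelope_hom_ext'
  have e : envelopeUnit (pathObj P) ≫ (forgetHigher k p).map (envelopePath P) ≫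
      (forgetHigher k p).map (pathEval r (envelopeObj P)) =
      pathMap (envelopeUnit P) ≫ pathEval r (forgetObj (envelopeObj P)) := by
    exact (congrArg (· ≫ (forgetHigher k p).map (pathEval r (envelopeObj P)))
      (envelopeUnit_lift (pathMap (envelopeUnit P) ≫ forgetPath _)) :)
  exact e.trans (pathMap_eval r (envelopeUnit P))

/-- Integration of polynomials. -/
noncomputable def polyInt (k : Type u) [Field k] : k[X] →ₗ[k] k[X] :=
  Polynomial.lsum fun n => (Polynomial.monomial (n + 1)) ∘ₗ (((n : k) + 1)⁻¹ • LinearMap.id)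

theorem polyInt_monomial (n : ℕ) (r : k) :
    polyInt k (monomial n r) = monomial (n + 1) (((n : k) + 1)⁻¹ * r) := by
  simp [polyInt, Polynomial.lsum, sum_monomial_index]

/-- Integration divides by `n + 1`; this is where the path objects need characteristic zero. -/
theorem derivative_polyInt [CharZero k] (f : k[X]) : derivative (polyInt k f) = f := by
  induction f using Polynomial.induction_on' with
  | add f g hf hg => simp only [map_add, hf, hg]
  | monomial n r =>
    rw [polyInt_monomial, derivative_monomial]
    congr 1
    have : (n : k) + 1 ≠ 0 := by exact_mod_cast n.succ_ne_zero
    simp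
    field_simp

/-- The integral has base point `0`, so the constant term is what gets lost. This matches the
evaluation at `0` in the path object. -/
theorem polyInt_derivative [CharZero k] (f : k[X]) :
    polyInt k (derivative f) = f - C (f.eval 0) := by
  induction f using Polynomial.induction_on' with
  | add f g hf hg => simp only [map_add, hf, hg, eval_add]; abel
  | monomial n r =>
    rw [derivative_monomial, polyInt_monomial]
    rcases n with _ | n
    · simp
    · have : (n : k) + 1 ≠ 0 := by exact_mod_cast n.succ_ne_zero
      simp
      congr 1
      field_simp

theorem eval_polyInt (f : k[X]) : (polyInt k f).eval 0 = 0 := by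
  induction f using Polynomial.induction_on' with
  | add f g hf hg => simp only [map_add, hf, hg, eval_add, add_zero]
  | monomial n r => simp [polyInt_monomial]

end Path

/-! ### Weak equivalences -/

section WeakEquiv

variable {k : Type u} [Field k] {t : Kind} {p : Parity}

theorem weakEquiv_id (P : Operad k t p) : weakEquiv k t p (𝟙 P) := by
  intro c i j l hij hjl
  exact ⟨fun x _ h => h, fun y hy => ⟨y, hy, 0, by rw [map_zero]; exact sub_self y⟩⟩

/-- With the next two lemmas, this is two out of three for quasi-isomorphisms, checked on
representatives. -/
theorem weakEquiv_comp {P Q R : Operad k t p} {f : P ⟶ Q} {g : Q ⟶ R} (hf : weakEquiv k t p f)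
    (hg : weakEquiv k t p g) : weakEquiv k t p (f ≫ g) := by
  intro c i j l hij hjl
  constructor
  · intro x hx hy
    refine (hf c i j l hij hjl).1 x hx ?_
    exact (hg c i j l hij hjl).1 _ (by rw [← f.app_d, hx, map_zero]) hy
  · intro y hy
    obtain ⟨y', hy', z, hz⟩ := (hg c i j l hij hjl).2 y hy
    obtain ⟨x, hx, w, hw⟩ := (hf c i j l hij hjl).2 y' hy'
    refine ⟨x, hx, g.app c i w + z, ?_⟩
    rw [Operad.comp_app, map_add, ← g.app_d, ← hw, ← hz, map_sub]
    abel

theorem weakEquiv_of_comp_left {P Q R : Operad k t p} {f : P ⟶ Q} {g : Q ⟶ R}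
    (hf : weakEquiv k t p f) (hfg : weakEquiv k t p (f ≫ g)) : weakEquiv k t p g := by
  intro c i j l hij hjl
  constructor
  · rintro y hy ⟨z, hz⟩
    obtain ⟨x, hx, w, hw⟩ := (hf c i j l hij hjl).2 y hy
    obtain ⟨v, hv⟩ := (hfg c i j l hij hjl).1 x hx ⟨g.app c i w + z, by
      rw [Operad.comp_app, map_add, ← g.app_d, ← hw, hz, map_sub]
      abel⟩
    refine ⟨f.app c i v - w, ?_⟩
    rw [map_sub, ← hw, ← f.app_d, hv]
    abel
  · intro y hy
    obtain ⟨x, hx, z, hz⟩ := (hfg c i j l hij hjl).2 y hy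
    exact ⟨f.app c j x, by rw [← f.app_d, hx, map_zero], z, hz⟩

theorem weakEquiv_of_comp_right {P Q R : Operad k t p} {f : P ⟶ Q} {g : Q ⟶ R}
    (hg : weakEquiv k t p g) (hfg : weakEquiv k t p (f ≫ g)) : weakEquiv k t p f := by
  intro c i j l hij hjl
  constructor
  · rintro x hx ⟨y, hy⟩
    exact (hfg c i j l hij hjl).1 x hx ⟨g.app c i y, by rw [Operad.comp_app, ← hy, g.app_d]⟩
  · intro y hy
    obtain ⟨x, hx, z, hz⟩ := (hfg c i j l hij hjl).2 (g.app c j y)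
      (by rw [← g.app_d, hy, map_zero])
    obtain ⟨w, hw⟩ := (hg c i j l hij hjl).1 (f.app c j x - y)
      (by rw [map_sub, ← f.app_d, hx, hy, map_zero, sub_zero])
      ⟨z, by rw [← hz, map_sub, Operad.comp_app]⟩
    exact ⟨x, hx, w, hw.symm⟩

/-- The kernel of `φ` has no cohomology. -/
def AcyclicKernel {P Q : Operad k t p} (φ : P ⟶ Q) : Prop :=
  ∀ (c : Vertex t) (i j l : ℤ) (hij : i + 1 = j) (hjl : j + 1 = l) (x : P.obj c j),
    φ.app c j x = 0 → P.d hjl x = 0 → ∃ z : P.obj c i, φ.app c i z = 0 ∧ P.d hij z = x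

/-- The long exact sequence of a surjection, on elements: a preimage of a boundary or of a cycle is
corrected by an element of the kernel. Together with the converse below, it lets acyclic surjections
be treated by solving equations inside the kernel. -/
theorem AcyclicKernel.weakEquiv {P Q : Operad k t p} {φ : P ⟶ Q} (h : AcyclicKernel φ)
    (hs : ∀ c i, Function.Surjective (φ.app c i)) : weakEquiv k t p φ := by
  intro c i j l hij hjl
  constructor
  · rintro x hx ⟨y, hy⟩
    obtain ⟨y, rfl⟩ := hs c i y
    obtain ⟨z, -, hz⟩ := h c i j l hij hjl (x - P.d hij y)
      (by rw [map_sub, φ.app_d, hy, sub_self]) (by rw [map_sub, hx, P.d_d, sub_zero])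
    exact ⟨z + y, by rw [map_add, hz, sub_add_cancel]⟩
  · intro y hy
    obtain ⟨x, rfl⟩ := hs c j y
    obtain ⟨z, hz, hz'⟩ := h c j l (l + 1) hjl rfl (P.d hjl x) (by rw [φ.app_d, hy]) (P.d_d _ _ _)
    refine ⟨x - z, by rw [map_sub, hz', sub_self], 0, ?_⟩
    rw [map_sub, hz, map_zero, sub_zero, sub_self]

theorem weakEquiv.acyclicKernel {P Q : Operad k t p} {φ : P ⟶ Q} (h : weakEquiv k t p φ)
    (hs : ∀ c i, Function.Surjective (φ.app c i)) : AcyclicKernel φ := by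
  intro c i j l hij hjl x hx hx'
  obtain ⟨z, hz⟩ := (h c i j l hij hjl).1 x hx' ⟨0, by rw [hx, map_zero]⟩
  -- The primitive `z` of `x` need not lie in the kernel, but its image is a cycle. Up to a boundary
  -- this image lifts to a cycle `y`, and the boundary lifts as well by surjectivity, so `z - y + d
  -- v` is a primitive in the kernel.
  obtain ⟨y, hy, v, hv⟩ := (h c (i - 1) i j (by omega) hij).2 (φ.app c i z)
    (by rw [← φ.app_d, hz, hx])
  obtain ⟨v, rfl⟩ := hs c (i - 1) v
  refine ⟨z - y + P.d (show i - 1 + 1 = i by omega) v, ?_, ?_⟩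
  · rw [map_add, map_sub, φ.app_d, ← hv]
    abel
  · rw [map_add, map_sub, hz, hy, P.d_d, sub_zero, add_zero]

end WeakEquiv

/-! ### Pullbacks -/

section Pullback

variable {k : Type u} [Field k] {t : Kind} {p : Parity}

/-- The fibre product of operads. -/
def pullbackObj {A B C : Operad k t p} (f : A ⟶ C) (g : B ⟶ C) : Operad k t p where
  obj c i := {x : A.obj c i × B.obj c i // x ∈ LinearMap.eqLocus
    (f.app c i ∘ₗ LinearMap.fst k _ _) (g.app c i ∘ₗ LinearMap.snd k _ _)}
  d h := ((A.d h).prodMap (B.d h)).restrict fun x hx => by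
    change f.app _ _ (A.d h x.1) = g.app _ _ (B.d h x.2)
    rw [f.app_d, g.app_d]
    exact congrArg _ hx
  act σ {_ _} h {_} := ((A.act σ h).prodMap (B.act σ h)).restrict fun x hx => by
    change f.app _ _ (A.act σ h x.1) = g.app _ _ (B.act σ h x.2)
    rw [f.app_act, g.app_act]
    exact congrArg _ hx
  glue a b {_ _ _} h {_ _ _} hl := LinearMap.mk₂ k
    (fun x y => ⟨(A.glue a b h hl x.1.1 y.1.1, B.glue a b h hl x.1.2 y.1.2), by
      change f.app _ _ (A.glue a b h hl x.1.1 y.1.1) = g.app _ _ (B.glue a b h hl x.1.2 y.1.2)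
      rw [f.app_glue, g.app_glue]
      exact congrArg₂ (fun u v => C.glue a b h hl u v) x.2 y.2⟩)
    (fun x x' y => Subtype.ext (Prod.ext (LinearMap.map_add₂ _ _ _ _) (LinearMap.map_add₂ _ _ _ _)))
    (fun r x y => Subtype.ext (Prod.ext (LinearMap.map_smul₂ _ _ _ _)
      (LinearMap.map_smul₂ _ _ _ _)))
    (fun x y y' => Subtype.ext (Prod.ext (map_add _ _ _) (map_add _ _ _)))
    (fun r x y => Subtype.ext (Prod.ext (map_smul _ _ _) (map_smul _ _ _)))
  loop a b {_ _} h {_ _} hl := ((A.loop a b h hl).prodMap (B.loop a b h hl)).restrict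
    fun x hx => by
      change f.app _ _ (A.loop a b h hl x.1) = g.app _ _ (B.loop a b h hl x.2)
      rw [f.app_loop, g.app_loop]
      exact congrArg _ hx
  d_d h h' x := Subtype.ext (Prod.ext (A.d_d h h' _) (B.d_d h h' _))
  act_id σ {_} h {_} x hσ := Subtype.ext (Prod.ext (A.act_id σ h _ hσ) (B.act_id σ h _ hσ))
  act_act σ τ {_ _ _} h h' h'' {_} x :=
    Subtype.ext (Prod.ext (A.act_act σ τ h h' h'' _) (B.act_act σ τ h h' h'' _))
  act_d σ {_ _} h {_ _} hij x := Subtype.ext (Prod.ext (A.act_d σ h hij _) (B.act_d σ h hij _))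
  act_glue σ {_ _ _ _ _ _ _ _} h h' h₁ h₂ h₀ {_ _ _} hl x y := Subtype.ext
    (Prod.ext (A.act_glue σ h h' h₁ h₂ h₀ hl _ _) (B.act_glue σ h h' h₁ h₂ h₀ hl _ _))
  act_loop σ {_ _ _ _ _ _} h h' h₁ h₀ {_ _} hl x := Subtype.ext
    (Prod.ext (A.act_loop σ h h' h₁ h₀ hl _) (B.act_loop σ h h' h₁ h₀ hl _))
  d_glue {_ _ _ _ _} h {_ _ _ _ _ _} hl hi hj hl' h₁ h₂ x y := Subtype.ext
    (Prod.ext (A.d_glue h hl hi hj hl' h₁ h₂ _ _) (B.d_glue h hl hi hj hl' h₁ h₂ _ _))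
  d_loop {_ _ _ _} h {_ _ _ _} hl hi hl' h₁ x := Subtype.ext
    (Prod.ext (A.d_loop h hl hi hl' h₁ _) (B.d_loop h hl hi hl' h₁ _))
  glue_symm {_ _ _ _ _} h h' {_ _ _} hl hl' x y := Subtype.ext
    (Prod.ext (A.glue_symm h h' hl hl' _ _) (B.glue_symm h h' hl hl' _ _))
  loop_symm {_ _ _ _} h h' {_ _} hl x := Subtype.ext
    (Prod.ext (A.loop_symm h h' hl _) (B.loop_symm h h' hl _))
  glue_glue {_ _ _ _ _ _ _ _ _ _} h₁₂ h₁ h₂₃ h₃ {_ _ _ _ _ _} hm hr hn hr' x y z := Subtype.ext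
    (Prod.ext (A.glue_glue h₁₂ h₁ h₂₃ h₃ hm hr hn hr' _ _ _)
      (B.glue_glue h₁₂ h₁ h₂₃ h₃ hm hr hn hr' _ _ _))
  loop_loop {_ _ _ _ _ _ _ _} h₁ h₁' h₂ h₂' {_ _ _} hl hr x := Subtype.ext
    (Prod.ext (A.loop_loop h₁ h₁' h₂ h₂' hl hr _) (B.loop_loop h₁ h₁' h₂ h₂' hl hr _))
  loop_glue {_ _ _ _ _ _ _ _ _} h h' h₁ h₁' {_ _ _ _ _} hl hr hm hr' x y := Subtype.ext
    (Prod.ext (A.loop_glue h h' h₁ h₁' hl hr hm hr' _ _)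
      (B.loop_glue h h' h₁ h₁' hl hr hm hr' _ _))
  loop_glue' {_ _ _ _ _ _ _ _ _} h h₁ h' h₁' {_ _ _ _} hl hr x y := Subtype.ext
    (Prod.ext (A.loop_glue' h h₁ h' h₁' hl hr _ _) (B.loop_glue' h h₁ h' h₁' hl hr _ _))

variable {A B C : Operad k t p} (f : A ⟶ C) (g : B ⟶ C)

/-- The first projection of the fibre product. -/
def pullbackFst : pullbackObj f g ⟶ A where
  app c i := LinearMap.fst k _ _ ∘ₗ Submodule.subtype _
  app_d _ _ := rfl
  app_act _ _ _ _ _ _ := rfl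
  app_glue _ _ _ _ _ _ _ := rfl
  app_loop _ _ _ _ _ := rfl

/-- The second projection of the fibre product. -/
def pullbackSnd : pullbackObj f g ⟶ B where
  app c i := LinearMap.snd k _ _ ∘ₗ Submodule.subtype _
  app_d _ _ := rfl
  app_act _ _ _ _ _ _ := rfl
  app_glue _ _ _ _ _ _ _ := rfl
  app_loop _ _ _ _ _ := rfl

theorem pullback_condition : pullbackFst f g ≫ f = pullbackSnd f g ≫ g :=
  Operad.hom_ext fun c i x => x.2

variable {f g}

/-- Morphisms to the fibre product. -/
def pullbackLift {X : Operad k t p} (a : X ⟶ A) (b : X ⟶ B) (h : a ≫ f = b ≫ g) :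
    X ⟶ pullbackObj f g where
  app c i := ((a.app c i).prod (b.app c i)).codRestrict _
    fun x => (congrArg (fun e : X ⟶ C => e.app c i x) h :)
  app_d h x := Subtype.ext (Prod.ext (a.app_d h x) (b.app_d h x))
  app_act σ _ _ h _ x := Subtype.ext (Prod.ext (a.app_act σ h x) (b.app_act σ h x))
  app_glue h _ _ _ hl x y := Subtype.ext (Prod.ext (a.app_glue h hl x y) (b.app_glue h hl x y))
  app_loop h _ _ hl x := Subtype.ext (Prod.ext (a.app_loop h hl x) (b.app_loop h hl x))

end Pullback

/-! ### Path objects and cofibrant operads -/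

section Cofibrant

open Polynomial

variable {k : Type u} [Field k] {t : Kind} {p : Parity}

theorem polyApply_d (A : Operad k t p) (φ : k[X] →ₗ[k] k[X]) {c : Vertex t} {i j i' j' : ℤ}
    (h : i = j) (h' : i' = j') (hi : i + 1 = i') (hj : j + 1 = j') (x : (polyObj A).obj c i) :
    polyApply A φ h' ((polyObj A).d hi x) = (polyObj A).d hj (polyApply A φ h x) := by
  subst h h'
  induction x using polyObj_induction with
  | zero => simp only [map_zero]
  | mk f x => rfl
  | add x y hx hy => simp only [map_add, hx, hy]

theorem polyDeriv_int [CharZero k] (A : Operad k t p) {c : Vertex t} {i j : ℤ} (h : i = j)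
    (h' : j = i) (x : (polyObj A).obj c i) :
    (polyDeriv A).app h' (polyApply A (polyInt k) h x) = x := by
  subst h
  induction x using polyObj_induction with
  | zero => simp only [map_zero]
  | mk f x =>
    change polyMk A c i (derivative (polyInt k f)) x = _
    rw [derivative_polyInt]
  | add x y hx hy => simp only [map_add, hx, hy]

theorem polyInt_deriv [CharZero k] (A : Operad k t p) {c : Vertex t} {i j : ℤ} (h : i = j)
    (h' : j = i) (x : (polyObj A).obj c i) :
    polyApply A (polyInt k) h' ((polyDeriv A).app h x) =
      x - (polyConst A).app c i ((polyEval 0 A).app c i x) := by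
  subst h
  induction x using polyObj_induction with
  | zero => simp only [map_zero, sub_zero]
  | mk f x =>
    change polyMk A c i (polyInt k (derivative f)) x =
      polyMk A c i f x - polyMk A c i 1 (f.eval 0 • x)
    rw [polyInt_derivative, map_sub, LinearMap.sub_apply, map_smul, ← LinearMap.smul_apply,
      ← map_smul, smul_eq_C_mul, mul_one]
  | add x y hx hy => simp only [map_add, hx, hy]; abel

theorem polyEval_int (A : Operad k t p) {c : Vertex t} {i j : ℤ} (h : i = j)
    (x : (polyObj A).obj c i) : (polyEval 0 A).app c j (polyApply A (polyInt k) h x) = 0 := by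
  subst h
  induction x using polyObj_induction with
  | zero => simp only [map_zero]
  | mk f x => rw [polyApply_mk, polyEval_mk, eval_polyInt, zero_smul]
  | add x y hx hy => simp only [map_add, hx, hy, add_zero]

/-- The Poincaré lemma for `k[t, dt]`. For a closed element `x + dt y` the derivative of `x` is `d
y`. The integral of `y` has derivative `y`, and its differential is the integral of the derivative
of `x`, which is `x` since `x` vanishes at `0`. -/
theorem pathEval_acyclicKernel [CharZero k] (A : Operad k t p) :
    AcyclicKernel (pathEval 0 A) := by
  rintro c i j l hij hjl ⟨x, y⟩ hx hd
  replace hx : (polyEval 0 A).app c j x = 0 := hx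
  have hd₂ : (polyDeriv A).app (show j = l - 1 by omega) x - (polyObj A).d _ y = 0 :=
    congrArg Prod.snd hd
  rw [sub_eq_zero] at hd₂
  refine ⟨(polyApply A (polyInt k) (show j - 1 = i by omega) y, 0), polyEval_int A _ y, ?_⟩
  refine Prod.ext ?_ ?_
  · change (polyObj A).d hij (polyApply A (polyInt k) _ y) = x
    rw [← polyApply_d A _ _ (show l - 1 = j by omega) (show j - 1 + 1 = l - 1 by omega), ← hd₂,
      polyInt_deriv, hx, map_zero, sub_zero]
  · change (polyDeriv A).app _ (polyApply A (polyInt k) _ y) - (polyObj A).d _ 0 = y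
    rw [polyDeriv_int, map_zero, sub_zero]

theorem pathEval_surjective (r : k) (A : Operad k t p) (c : Vertex t) (i : ℤ) :
    Function.Surjective ((pathEval r A).app c i) := fun x =>
  ⟨(pathConst A).app c i x,
    (congrArg (fun e : A ⟶ A => e.app c i x) (pathConst_eval r A) :)⟩

/-- Constant paths are a section of the acyclic surjection given by evaluation at `0`; two out of
three applies. -/
theorem pathConst_weakEquiv [CharZero k] (A : Operad k t p) : weakEquiv k t p (pathConst A) :=
  weakEquiv_of_comp_right ((pathEval_acyclicKernel A).weakEquiv (pathEval_surjective 0 A))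
    (by rw [pathConst_eval]; exact weakEquiv_id A)

/-- A morphism from a cofibrant operad lifts along a weak equivalence up to a path homotopy. -/
theorem IsCofibrant.exists_lift [CharZero k] {A B Q : Operad k t p} {f : A ⟶ B}
    (hf : weakEquiv k t p f) (hQ : IsCofibrant Q) {π : Q ⟶ B} (hπ : weakEquiv k t p π) :
    ∃ (g : Q ⟶ A) (H : Q ⟶ pathObj B), weakEquiv k t p g ∧ H ≫ pathEval 0 B = g ≫ f ∧
      H ≫ pathEval 1 B = π := by
  -- The space of pairs of a point of `A` and a path in `B` that starts at its image projects to `A`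
  -- by an acyclic surjection, as a base change of evaluation at `0`.
  have hfst : weakEquiv k t p (pullbackFst f (pathEval 0 B)) := by
    refine AcyclicKernel.weakEquiv ?_ fun c i x => ?_
    · rintro c i j l hij hjl ⟨⟨x, ω⟩, hω⟩ hx hd
      replace hx : x = 0 := hx
      subst hx
      replace hω : f.app c j 0 = (pathEval 0 B).app c j ω := hω
      obtain ⟨z, hz, hz'⟩ := pathEval_acyclicKernel B c i j l hij hjl ω
        (by rw [← hω, map_zero]) (congrArg (fun y => y.1.2) hd)
      refine ⟨⟨(0, z), ?_⟩, rfl, Subtype.ext (Prod.ext (map_zero (A.d hij)) hz')⟩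
      change f.app c i 0 = (pathEval 0 B).app c i z
      rw [hz, map_zero]
    · obtain ⟨ω, hω⟩ := pathEval_surjective 0 B c i (f.app c i x)
      exact ⟨⟨(x, ω), hω.symm⟩, rfl⟩
  -- The section that takes a point to the constant path at its image; it is a weak equivalence
  -- because its composite with the projection is the identity.
  have hsect : 𝟙 A ≫ f = (f ≫ pathConst B) ≫ pathEval 0 B := by
    rw [Category.assoc, pathConst_eval, Category.comp_id, Category.id_comp]
  have hsect' : weakEquiv k t p (pullbackLift (𝟙 A) (f ≫ pathConst B) hsect) :=
    weakEquiv_of_comp_right hfst (weakEquiv_id A)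
  -- On the section, the evaluation at the other end of the path is `f`, so it is a weak equivalence
  -- by two out of three. Once it is seen to be surjective, `π` lifts along it.
  have hev : weakEquiv k t p (pullbackSnd f (pathEval 0 B) ≫ pathEval 1 B) := by
    refine weakEquiv_of_comp_left hsect' ?_
    have e : pullbackLift (𝟙 A) (f ≫ pathConst B) hsect ≫ pullbackSnd f (pathEval 0 B) ≫
        pathEval 1 B = f ≫ pathConst B ≫ pathEval 1 B := rfl
    rw [e, pathConst_eval, Category.comp_id]
    exact hf
  obtain ⟨g, hg⟩ := hQ _ hev (fun c i x => by
    -- The path `X ⊗ x` runs from `0` to `x`, so it lies over the point `0` of `A` whatever `f` is.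
    refine ⟨⟨(0, (polyMk B c i Polynomial.X x, 0)), ?_⟩, ?_⟩
    · change f.app c i 0 = (polyEval 0 B).app c i (polyMk B c i X x)
      rw [polyEval_mk, eval_X, zero_smul, map_zero]
    · change (polyEval 1 B).app c i (polyMk B c i X x) = x
      rw [polyEval_mk, eval_X, one_smul]) π
  refine ⟨g ≫ pullbackFst _ _, g ≫ pullbackSnd _ _, ?_, ?_, ?_⟩
  · exact weakEquiv_comp (weakEquiv_of_comp_right hev (by rw [hg]; exact hπ)) hfst
  · rw [Category.assoc, Category.assoc, pullback_condition]
  · rw [Category.assoc, hg]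

/-- The two ends of a path become equal in the localization at the weak equivalences. -/
theorem localization_pathEval [CharZero k] (A : Operad k t p) :
    (weakEquiv k t p).Q.map (pathEval 0 A) = (weakEquiv k t p).Q.map (pathEval 1 A) := by
  have := MorphismProperty.Q_inverts _ _ (pathConst_weakEquiv A)
  rw [← cancel_epi ((weakEquiv k t p).Q.map (pathConst A)), ← Functor.map_comp,
    ← Functor.map_comp, pathConst_eval, pathConst_eval]

/-- The modular envelope sends path homotopies to equalities in the localization. -/
theorem localization_envelope_eq [CharZero k] {X Y : Operad k .cyclic p} (H : X ⟶ pathObj Y) :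
    (weakEquiv k .modular p).Q.map ((envelope k p).map (H ≫ pathEval 0 Y)) =
      (weakEquiv k .modular p).Q.map ((envelope k p).map (H ≫ pathEval 1 Y)) := by
  let K : envelopeObj X ⟶ pathObj (envelopeObj Y) := (envelope k p).map H ≫ envelopePath Y
  have e (r : k) : (envelope k p).map (H ≫ pathEval r Y) = K ≫ pathEval r (envelopeObj Y) :=
    ((envelope k p).map_comp _ _).trans
      (congrArg ((envelope k p).map H ≫ ·) (envelopePath_eval r Y).symm)
  have e' (r : k) := (congrArg (weakEquiv k .modular p).Q.map (e r)).trans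
    ((weakEquiv k .modular p).Q.map_comp K (pathEval r (envelopeObj Y)))
  refine (e' 0).trans (Eq.trans ?_ (e' 1).symm)
  rw [localization_pathEval]

/-- The identity of `Y` lifts along `f` up to a path homotopy, and the envelope turns the homotopy
into an equality in the localization. Keeping track that `g` is a weak equivalence allows the
argument to be repeated for `g`. -/
theorem localization_envelope_inverse [CharZero k] {X Y : Operad k .cyclic p} (hY : IsCofibrant Y)
    {f : X ⟶ Y} (hf : weakEquiv k .cyclic p f) :
    ∃ g : Y ⟶ X, weakEquiv k .cyclic p g ∧
      (envelope k p ⋙ (weakEquiv k .modular p).Q).map g ≫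
        (envelope k p ⋙ (weakEquiv k .modular p).Q).map f = 𝟙 _ := by
  obtain ⟨g, H, hg, h₀, h₁⟩ := hY.exists_lift hf (weakEquiv_id Y)
  refine ⟨g, hg, ?_⟩
  rw [← Functor.map_comp, ← h₀, Functor.comp_map, localization_envelope_eq, h₁]
  exact (envelope k p ⋙ (weakEquiv k .modular p).Q).map_id Y

/-- The modular envelope sends weak equivalences between cofibrant operads to isomorphisms in the
localization at the weak equivalences. -/
theorem localization_envelope_isIso [CharZero k] {X Y : Operad k .cyclic p} (hX : IsCofibrant X)
    (hY : IsCofibrant Y) {f : X ⟶ Y} (hf : weakEquiv k .cyclic p f) :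
    IsIso ((envelope k p ⋙ (weakEquiv k .modular p).Q).map f) := by
  obtain ⟨g, hg, e⟩ := localization_envelope_inverse hY hf
  -- Now `g` has `f` as an inverse on one side and `h` on the other, hence is invertible in the
  -- localization, and so is `f`.
  obtain ⟨h, hh, e'⟩ := localization_envelope_inverse hX hg
  have : IsIso ((envelope k p ⋙ (weakEquiv k .modular p).Q).map g) := by
    refine ⟨_, e, ?_⟩
    have e'' := congrArg ((envelope k p ⋙ (weakEquiv k .modular p).Q).map h ≫ ·) e
    simp only [← Category.assoc, e', Category.id_comp, Category.comp_id] at e''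
    rw [e'', e']
  exact IsIso.of_isIso_fac_left e

/-- Cofibrant replacements of an operad have isomorphic modular envelopes in the localization at
the weak equivalences. -/
theorem nonempty_envelope_iso [CharZero k] {D O Q : Operad k .cyclic p} (hD : IsCofibrant D)
    (hQ : IsCofibrant Q) {κ : D ⟶ O} (hκ : weakEquiv k .cyclic p κ) {π : Q ⟶ O}
    (hπ : weakEquiv k .cyclic p π) :
    Nonempty ((weakEquiv k .modular p).Q.obj ((envelope k p).obj Q) ≅
      (weakEquiv k .modular p).Q.obj ((envelope k p).obj D)) := by
  -- Only the weak equivalence `Q → D` is needed here; the homotopy over the common target is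
  -- discarded.
  obtain ⟨g, -, hg, -, -⟩ := hQ.exists_lift hκ hπ
  have := localization_envelope_isIso hQ hD hg
  exact ⟨asIso ((envelope k p ⋙ (weakEquiv k .modular p).Q).map g)⟩

end Cofibrant

/-! ### Combinatorics of one-edge graphs -/

section Vertices

variable {t : Kind}

/-- The image of a vertex under a relabelling. -/
def Vertex.relabel (σ : Equiv.Perm ℕ) (c : Vertex t) : Vertex t :=
  ⟨c.genus, c.legs.map σ.toEmbedding, by rw [Finset.card_map]; exact c.stable, c.allowed⟩

theorem Vertex.isRelabel (σ : Equiv.Perm ℕ) (c : Vertex t) : IsRelabel σ c (c.relabel σ) :=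
  ⟨rfl, rfl⟩

theorem Vertex.relabel_relabel (σ τ : Equiv.Perm ℕ) (c : Vertex t) :
    (c.relabel σ).relabel τ = c.relabel (τ * σ) := by
  refine Vertex.ext rfl ?_
  simp only [Vertex.relabel, Finset.map_map]
  rfl

theorem Vertex.mem_relabel {σ : Equiv.Perm ℕ} {c : Vertex t} {x : ℕ} :
    x ∈ (c.relabel σ).legs ↔ σ⁻¹ x ∈ c.legs := by
  simp [Vertex.relabel, Equiv.Perm.inv_def]

theorem Vertex.relabel_eq_self {σ : Equiv.Perm ℕ} {c : Vertex t} (h : ∀ m ∈ c.legs, σ m = m) :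
    c.relabel σ = c := by
  refine Vertex.ext rfl ?_
  ext x
  simp only [Vertex.relabel, Finset.mem_map, Equiv.coe_toEmbedding]
  constructor
  · rintro ⟨y, hy, rfl⟩
    rwa [h y hy]
  · exact fun hx => ⟨x, hx, h x hx⟩

theorem Vertex.isRelabel_self {σ : Equiv.Perm ℕ} {c : Vertex t} (h : ∀ m ∈ c.legs, σ m = m) :
    IsRelabel σ c c := by
  have := c.isRelabel σ
  rwa [Vertex.relabel_eq_self h] at this

theorem IsRelabel.card {σ : Equiv.Perm ℕ} {c c' : Vertex t} (h : IsRelabel σ c c') :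
    c'.legs.card = c.legs.card := by
  rw [h.legs, Finset.card_map]

theorem IsGlue.relabel {a b : ℕ} {c₁ c₂ c : Vertex t} (h : IsGlue a b c₁ c₂ c)
    {σ : Equiv.Perm ℕ} {a' b' : ℕ} (ha : σ a = a') (hb : σ b = b') {c₁' c₂' c' : Vertex t}
    (h₁ : IsRelabel σ c₁ c₁') (h₂ : IsRelabel σ c₂ c₂') (h₀ : IsRelabel σ c c') :
    IsGlue a' b' c₁' c₂' c' := by
  subst ha hb
  refine ⟨?_, ?_, ?_, ?_, ?_⟩
  · rw [h₁.legs]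
    exact Finset.mem_map_of_mem _ h.left_mem
  · rw [h₂.legs]
    exact Finset.mem_map_of_mem _ h.right_mem
  · rw [h₁.legs, h₂.legs]
    exact (Finset.disjoint_map _).2 h.disjoint
  · rw [h₀.genus, h₁.genus, h₂.genus, h.genus]
  · have e : ∀ (s : Finset ℕ) (x : ℕ), (s.map σ.toEmbedding).erase (σ x) =
        (s.erase x).map σ.toEmbedding := fun s x => (Finset.map_erase σ.toEmbedding s x).symm
    rw [h₀.legs, h₁.legs, h₂.legs, h.legs, Finset.map_union, e, e]

theorem IsGlue.symm {a b : ℕ} {c₁ c₂ c : Vertex t} (h : IsGlue a b c₁ c₂ c) :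
    IsGlue b a c₂ c₁ c :=
  ⟨h.right_mem, h.left_mem, h.disjoint.symm, by rw [h.genus, add_comm],
    by rw [h.legs, Finset.union_comm]⟩

theorem IsGlue.card {a b : ℕ} {c₁ c₂ c : Vertex t} (h : IsGlue a b c₁ c₂ c) :
    c₁.legs.card + c₂.legs.card = c.legs.card + 2 := by
  have hd : Disjoint (c₁.legs.erase a) (c₂.legs.erase b) :=
    h.disjoint.mono (Finset.erase_subset _ _) (Finset.erase_subset _ _)
  rw [h.legs, Finset.card_union_of_disjoint hd, Finset.card_erase_of_mem h.left_mem,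
    Finset.card_erase_of_mem h.right_mem]
  have h₁ := Finset.card_pos.2 ⟨a, h.left_mem⟩
  have h₂ := Finset.card_pos.2 ⟨b, h.right_mem⟩
  omega

theorem Vertex.three_le_card (c : Vertex .cyclic) : 3 ≤ c.legs.card := by
  have h := c.stable
  have h₀ : c.genus = 0 := c.allowed
  omega

/-- A vertex of genus zero has at least three legs, and contracting an edge loses two. This strict
inequality makes induction on the number of legs possible. -/
theorem IsGlue.left_card_lt {a b : ℕ} {c₁ c₂ c : Vertex .cyclic} (h : IsGlue a b c₁ c₂ c) :
    c₁.legs.card < c.legs.card := by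
  have := h.card
  have := c₂.three_le_card
  omega

theorem IsGlue.right_card_lt {a b : ℕ} {c₁ c₂ c : Vertex .cyclic} (h : IsGlue a b c₁ c₂ c) :
    c₂.legs.card < c.legs.card := h.symm.left_card_lt

/-- If an edge `b' — a'` and an edge `a — b` form a path `u — v — r`, then they can be
contracted in the other order. -/
theorem IsGlue.exists_assoc {a b a' b' : ℕ} {l r u v c : Vertex .cyclic} (h : IsGlue a b l r c)
    (h' : IsGlue a' b' u v l) (hav : a ∈ v.legs) (ha' : a' ∉ c.legs) (hb' : b' ∉ c.legs)
    (h₁ : a' ≠ b) (h₂ : b' ≠ b) (h₃ : b' ≠ a) :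
    ∃ w : Vertex .cyclic, IsGlue a b v r w ∧ IsGlue a' b' u w c := by
  have e := h.legs
  have e' := h'.legs
  have d := Finset.disjoint_left.1 h.disjoint
  have d' := Finset.disjoint_left.1 h'.disjoint
  have m := h.right_mem
  have m' := h'.left_mem
  have m'' := h'.right_mem
  have hvr : Disjoint v.legs r.legs := by
    rw [Finset.disjoint_left]
    grind
  have hd : Disjoint (v.legs.erase a) (r.legs.erase b) :=
    hvr.mono (Finset.erase_subset _ _) (Finset.erase_subset _ _)
  have hu : u.genus = 0 := u.allowed
  have hv : v.genus = 0 := v.allowed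
  have hr : r.genus = 0 := r.allowed
  have hc : c.genus = 0 := c.allowed
  -- The new middle vertex is the contraction of `a — b` alone; it is stable because `v` and `r`
  -- have at least three legs each.
  refine ⟨⟨0, v.legs.erase a ∪ r.legs.erase b, ?_, rfl⟩, ⟨hav, m, hvr, ?_, rfl⟩,
    ⟨m', ?_, ?_, ?_, ?_⟩⟩
  · rw [Finset.card_union_of_disjoint hd, Finset.card_erase_of_mem hav,
      Finset.card_erase_of_mem m]
    have := v.three_le_card
    have := r.three_le_card
    omega
  · rw [hv, hr]
  · simp only [Finset.mem_union, Finset.mem_erase]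
    exact Or.inl ⟨h₃, m''⟩
  · rw [Finset.disjoint_left]
    grind
  · rw [hc, hu]
    rfl
  · ext x
    grind

theorem IsGlue.unique {a b : ℕ} {c₁ c₂ c c' : Vertex t} (h : IsGlue a b c₁ c₂ c)
    (h' : IsGlue a b c₁ c₂ c') : c = c' :=
  Vertex.ext (h.genus.trans h'.genus.symm) (h.legs.trans h'.legs.symm)

/-- A permutation that fixes a set of labels and moves two other labels to given places. -/
theorem exists_perm_of_ne {L : Finset ℕ} {a b a' b' : ℕ} (hab : a ≠ b) (ha : a ∉ L) (hb : b ∉ L)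
    (hab' : a' ≠ b') (ha' : a' ∉ L) (hb' : b' ∉ L) :
    ∃ σ : Equiv.Perm ℕ, (∀ m ∈ L, σ m = m) ∧ σ a = a' ∧ σ b = b' := by
  -- The first transposition takes `a` to `a'`; the second takes the new position of `b` to `b'` and
  -- leaves `a'` alone.
  refine ⟨Equiv.swap b' (Equiv.swap a a' b) * Equiv.swap a a', ?_, ?_, ?_⟩
  · intro m hm
    have h₁ : Equiv.swap a a' m = m := Equiv.swap_apply_of_ne_of_ne (by grind) (by grind)
    rw [Equiv.Perm.mul_apply, h₁]
    refine Equiv.swap_apply_of_ne_of_ne (by grind) fun h => ?_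
    rw [← h₁] at h
    exact hb ((Equiv.swap a a').injective h ▸ hm)
  · rw [Equiv.Perm.mul_apply, Equiv.swap_apply_left]
    refine Equiv.swap_apply_of_ne_of_ne hab' fun h => ?_
    have := Equiv.swap_apply_left a a'
    exact hab ((Equiv.swap a a').injective (this.trans h))
  · rw [Equiv.Perm.mul_apply, Equiv.swap_apply_right]

/-- The decompositions of a vertex into two vertices joined by an edge. -/
abbrev VSplit (a b : ℕ) (c : Vertex t) : Type :=
  {s : Vertex t × Vertex t // IsGlue a b s.1 s.2 c}

instance (a b : ℕ) (c : Vertex t) : Finite (VSplit a b c) := by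
  have hfin := finite_vertex (t := t) c.genus (insert a (insert b c.legs))
  refine ((hfin.prod hfin).subset fun s (h : IsGlue a b s.1 s.2 c) => ?_).to_subtype
  have hg := h.genus
  constructor
  · refine ⟨by omega, fun x hx => ?_⟩
    rw [h.legs]
    simp only [Finset.mem_insert, Finset.mem_union, Finset.mem_erase]
    tauto
  · refine ⟨by omega, fun x hx => ?_⟩
    rw [h.legs]
    simp only [Finset.mem_insert, Finset.mem_union, Finset.mem_erase]
    tauto

noncomputable instance (a b : ℕ) (c : Vertex t) : Fintype (VSplit a b c) := Fintype.ofFinite _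

/-- Relabelling of decompositions. -/
def VSplit.relabel {a b : ℕ} {c : Vertex t} {σ : Equiv.Perm ℕ} {a' b' : ℕ} (ha : σ a = a')
    (hb : σ b = b') {c' : Vertex t} (h : IsRelabel σ c c') : VSplit a b c ≃ VSplit a' b' c' where
  toFun s := ⟨(s.1.1.relabel σ, s.1.2.relabel σ),
    s.2.relabel ha hb (s.1.1.isRelabel σ) (s.1.2.isRelabel σ) h⟩
  invFun s := ⟨(s.1.1.relabel σ⁻¹, s.1.2.relabel σ⁻¹),
    s.2.relabel (Equiv.Perm.inv_eq_iff_eq.2 ha.symm) (Equiv.Perm.inv_eq_iff_eq.2 hb.symm)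
      (s.1.1.isRelabel σ⁻¹) (s.1.2.isRelabel σ⁻¹) h.symm⟩
  left_inv s := Subtype.ext (Prod.ext
    (by simp only [Vertex.relabel_relabel]; exact Vertex.relabel_eq_self (by simp))
    (by simp only [Vertex.relabel_relabel]; exact Vertex.relabel_eq_self (by simp)))
  right_inv s := Subtype.ext (Prod.ext
    (by simp only [Vertex.relabel_relabel]; exact Vertex.relabel_eq_self (by simp))
    (by simp only [Vertex.relabel_relabel]; exact Vertex.relabel_eq_self (by simp)))

/-- The decomposition with the two vertices interchanged. -/
def VSplit.symm {a b : ℕ} {c : Vertex t} : VSplit a b c ≃ VSplit b a c where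
  toFun s := ⟨(s.1.2, s.1.1), s.2.symm⟩
  invFun s := ⟨(s.1.2, s.1.1), s.2.symm⟩
  left_inv _ := rfl
  right_inv _ := rfl

end Vertices

/-! ### Relabelling elements and contractions -/

section Act

variable {k : Type u} [Field k] {t : Kind} {p : Parity}

theorem VMod.act_eq_self (A : VMod k t) {σ : Equiv.Perm ℕ} {c : Vertex t} (h : IsRelabel σ c c)
    (hσ : ∀ m ∈ c.legs, σ m = m) {i : ℤ} (x : A.obj c i) : A.act σ h x = x :=
  A.act_id σ h x hσ

theorem Operad.act_glue_of_eq (A : Operad k t p) (σ : Equiv.Perm ℕ) {a b a' b' : ℕ}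
    (ha : σ a = a') (hb : σ b = b') {c₁ c₂ c c₁' c₂' c' : Vertex t}
    (h : IsGlue a b c₁ c₂ c) (h' : IsGlue a' b' c₁' c₂' c') (h₁ : IsRelabel σ c₁ c₁')
    (h₂ : IsRelabel σ c₂ c₂') (h₀ : IsRelabel σ c c') {i j l : ℤ} (hl : i + j + p.deg = l)
    (x : A.obj c₁ i) (y : A.obj c₂ j) :
    A.act σ h₀ (A.glue a b h hl x y) = A.glue a' b' h' hl (A.act σ h₁ x) (A.act σ h₂ y) := by
  subst ha hb
  exact A.act_glue σ h h' h₁ h₂ h₀ hl x y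

end Act

/-! ### The Maurer–Cartan equation in an odd cyclic operad -/

section MaurerCartan

theorem odd_zero_zero : (0 : ℤ) + 0 + Parity.odd.deg = 1 := rfl

theorem odd_one_zero : (1 : ℤ) + 0 + Parity.odd.deg = 2 := rfl

theorem odd_zero_one : (0 : ℤ) + 1 + Parity.odd.deg = 2 := rfl

variable {k : Type u} [Field k] (T : Operad k .cyclic .odd) (θ : ∀ c, T.obj c 0)

/-- The sum of the contractions of all one-edge graphs, each with its two orientations. -/
noncomputable def bracket (a b : ℕ) (c : Vertex .cyclic) : T.obj c 1 :=
  ∑ s : VSplit a b c, T.glue a b s.2 odd_zero_zero (θ s.1.1) (θ s.1.2)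

/-- Equivariance of a family of elements, for vertices with less than `n` legs. -/
def EquivariantBelow (n : ℕ) : Prop :=
  ∀ (σ : Equiv.Perm ℕ) {c c' : Vertex .cyclic} (h : IsRelabel σ c c'), c.legs.card < n →
    T.act σ h (θ c) = θ c'

/-- The Maurer–Cartan equation, for vertices with less than `n` legs. -/
def MaurerCartanBelow (n : ℕ) : Prop :=
  ∀ (a b : ℕ) (c : Vertex .cyclic), a ≠ b → a ∉ c.legs → b ∉ c.legs → c.legs.card < n →
    T.d (zero_add 1) (θ c) = -(1 / 2 : k) • bracket T θ a b c

variable {T θ}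

/-- Relabelling permutes the decompositions of a vertex. As only vertices with fewer legs occur in
them, equivariance below `n` gives the claim for vertices with up to `n` legs. -/
theorem act_bracket {n : ℕ} (hθ : EquivariantBelow T θ n) (σ : Equiv.Perm ℕ) {a b a' b' : ℕ}
    (ha : σ a = a') (hb : σ b = b') {c c' : Vertex .cyclic} (h : IsRelabel σ c c')
    (hc : c.legs.card ≤ n) : T.act σ h (bracket T θ a b c) = bracket T θ a' b' c' := by
  unfold bracket
  rw [map_sum]
  refine Fintype.sum_equiv (VSplit.relabel ha hb h) _ _ fun s => ?_
  change _ = T.glue a' b' (s.2.relabel ha hb (s.1.1.isRelabel σ) (s.1.2.isRelabel σ) h)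
    odd_zero_zero (θ (s.1.1.relabel σ)) (θ (s.1.2.relabel σ))
  rw [T.act_glue_of_eq σ ha hb s.2 _ (s.1.1.isRelabel σ) (s.1.2.isRelabel σ) h, hθ σ (s.1.1.isRelabel σ) (s.2.left_card_lt.trans_le hc),
    hθ σ (s.1.2.isRelabel σ) (s.2.right_card_lt.trans_le hc)]

/-- The names of the two ends of the edge do not matter: a permutation that fixes the legs of `c`
exchanges one pair of names for the other. -/
theorem bracket_eq {n : ℕ} (hθ : EquivariantBelow T θ n) {a b a' b' : ℕ} {c : Vertex .cyclic}
    (hab : a ≠ b) (ha : a ∉ c.legs) (hb : b ∉ c.legs) (hab' : a' ≠ b') (ha' : a' ∉ c.legs)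
    (hb' : b' ∉ c.legs) (hc : c.legs.card ≤ n) :
    bracket T θ a b c = bracket T θ a' b' c := by
  obtain ⟨σ, hσ, hσa, hσb⟩ := exists_perm_of_ne hab ha hb hab' ha' hb'
  rw [← act_bracket hθ σ hσa hσb (Vertex.isRelabel_self hσ) hc, T.act_eq_self _ hσ]

/-- The two-edge graphs that arise by expanding twice. -/
abbrev TwoEdge (a b a' b' : ℕ) (c : Vertex .cyclic) : Type :=
  Σ s : VSplit a b c, VSplit a' b' s.1.1

theorem TwoEdge.ext {a b a' b' : ℕ} {c : Vertex .cyclic} {x y : TwoEdge a b a' b' c}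
    (h₁ : x.1.1.1 = y.1.1.1) (h₂ : x.1.1.2 = y.1.1.2) (h₃ : x.2.1.1 = y.2.1.1)
    (h₄ : x.2.1.2 = y.2.1.2) : x = y := by
  obtain ⟨⟨⟨l, r⟩, h⟩, ⟨⟨u, v⟩, h'⟩⟩ := x
  obtain ⟨⟨⟨l', r'⟩, g⟩, ⟨⟨u', v'⟩, g'⟩⟩ := y
  dsimp only at h₁ h₂ h₃ h₄
  subst h₁ h₂ h₃ h₄
  rfl

variable (T θ) in
/-- The contraction of a two-edge graph. -/
def TwoEdge.term {a b a' b' : ℕ} {c : Vertex .cyclic} (x : TwoEdge a b a' b' c) : T.obj c 2 :=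
  T.glue a b x.1.2 odd_one_zero
    (T.glue a' b' x.2.2 odd_zero_zero (θ x.2.1.1) (θ x.2.1.2)) (θ x.1.1.2)

/-- These are the paths `u — v — r` in which `v` is the middle vertex, with `a'`, `b'` the ends of
the edge contracted first. Reading the path backwards contracts the two edges in the opposite order,
which changes the sign in an odd operad. So the reversal is an involution under which the terms
cancel in pairs. -/
theorem sum_twoEdge_right [CharZero k] {a b a' b' : ℕ} {c : Vertex .cyclic}
    (hθ : EquivariantBelow T θ c.legs.card) (hab : a ≠ b) (ha : a ∉ c.legs) (hb : b ∉ c.legs)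
    (hab' : a' ≠ b') (ha' : a' ∉ c.legs) (hb' : b' ∉ c.legs) (h₁ : a' ≠ a) (h₂ : a' ≠ b)
    (h₃ : b' ≠ a) (h₄ : b' ≠ b) :
    ∑ x : TwoEdge a b a' b' c with a ∈ x.2.1.2.legs, x.term T θ = 0 := by
  classical
  -- Backwards, the path begins at `r`, so the edge `b — a` must take the names `a'`, `b'` and the
  -- edge `b' — a'` the names `a`, `b`.
  let ρ : Equiv.Perm ℕ := Equiv.swap a b' * Equiv.swap b a'
  have ρa : ρ a = b' := by
    simp only [ρ, Equiv.Perm.mul_apply, Equiv.swap_apply_of_ne_of_ne hab h₁.symm,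
      Equiv.swap_apply_left]
  have ρb' : ρ b' = a := by
    simp only [ρ, Equiv.Perm.mul_apply, Equiv.swap_apply_of_ne_of_ne h₄ hab'.symm,
      Equiv.swap_apply_right]
  have ρb : ρ b = a' := by
    simp only [ρ, Equiv.Perm.mul_apply, Equiv.swap_apply_left,
      Equiv.swap_apply_of_ne_of_ne h₁ hab']
  have ρa' : ρ a' = b := by
    simp only [ρ, Equiv.Perm.mul_apply, Equiv.swap_apply_right,
      Equiv.swap_apply_of_ne_of_ne hab.symm h₄.symm]
  have ρm : ∀ m, m ≠ a → m ≠ b → m ≠ a' → m ≠ b' → ρ m = m := fun m m₁ m₂ m₃ m₄ => by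
    simp only [ρ, Equiv.Perm.mul_apply, Equiv.swap_apply_of_ne_of_ne m₂ m₃,
      Equiv.swap_apply_of_ne_of_ne m₁ m₄]
  have ρρ : ∀ v : Vertex .cyclic, (v.relabel ρ).relabel ρ = v := fun v => by
    rw [Vertex.relabel_relabel]
    refine Vertex.relabel_eq_self fun m _ => ?_
    rw [Equiv.Perm.mul_apply]
    grind
  have ρc : ∀ m ∈ c.legs, ρ m = m := fun m hm => by grind
  have hc := Vertex.isRelabel_self ρc
  have hw : ∀ x : TwoEdge a b a' b' c, a ∈ x.2.1.2.legs → ∃ w : Vertex .cyclic,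
      IsGlue a b x.2.1.2 x.1.1.2 w ∧ IsGlue a' b' x.2.1.1 w c := fun x hx =>
    x.1.2.exists_assoc x.2.2 hx ha' hb' h₂ h₄ h₃
  have : Nonempty (Vertex .cyclic) := ⟨c⟩
  choose! w hw using hw
  -- The reversed graph: `w` is the contraction of `v` and `r`, so `r` and `v` are now joined first
  -- and `u` comes last. Off the relevant subset the value is irrelevant.
  let g : TwoEdge a b a' b' c → TwoEdge a b a' b' c := fun x =>
    if hx : a ∈ x.2.1.2.legs then
      ⟨⟨((w x).relabel ρ, x.2.1.1.relabel ρ), (hw x hx).2.symm.relabel ρb' ρa'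
        ((w x).isRelabel ρ) (x.2.1.1.isRelabel ρ) hc⟩,
      ⟨(x.1.1.2.relabel ρ, x.2.1.2.relabel ρ), (hw x hx).1.symm.relabel ρb ρa
        (x.1.1.2.isRelabel ρ) (x.2.1.2.isRelabel ρ) ((w x).isRelabel ρ)⟩⟩
    else x
  have g_eq : ∀ (x : TwoEdge a b a' b' c) (hx : a ∈ x.2.1.2.legs), g x =
      ⟨⟨((w x).relabel ρ, x.2.1.1.relabel ρ), (hw x hx).2.symm.relabel ρb' ρa'
        ((w x).isRelabel ρ) (x.2.1.1.isRelabel ρ) hc⟩,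
      ⟨(x.1.1.2.relabel ρ, x.2.1.2.relabel ρ), (hw x hx).1.symm.relabel ρb ρa
        (x.1.1.2.isRelabel ρ) (x.2.1.2.isRelabel ρ) ((w x).isRelabel ρ)⟩⟩ :=
    fun x hx => dif_pos hx
  have g_mem : ∀ x : TwoEdge a b a' b' c, a ∈ x.2.1.2.legs → a ∈ (g x).2.1.2.legs :=
      fun x hx => by
    rw [g_eq x hx]
    change a ∈ (x.2.1.2.relabel ρ).legs
    rw [Vertex.mem_relabel, Equiv.Perm.inv_eq_iff_eq.2 ρb'.symm]
    exact x.2.2.right_mem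
  -- Both terms are rewritten as `u` contracted with the contraction of `v` and `r`. Associativity
  -- gives a minus sign for the first one; the second is reordered by the symmetry of contractions,
  -- without sign since one factor always has degree zero, and by equivariance.
  have key : ∀ x : TwoEdge a b a' b' c, a ∈ x.2.1.2.legs →
      x.term T θ + (g x).term T θ = 0 := fun x hx => by
    have hlt := x.1.2.left_card_lt
    have hr := hθ ρ (x.1.1.2.isRelabel ρ) x.1.2.right_card_lt
    have hu := hθ ρ (x.2.1.1.isRelabel ρ) (x.2.2.left_card_lt.trans hlt)
    have hv := hθ ρ (x.2.1.2.isRelabel ρ) (x.2.2.right_card_lt.trans hlt)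
    have e₁ : x.term T θ = -T.glue a' b' (hw x hx).2 odd_zero_one (θ x.2.1.1)
        (T.glue a b (hw x hx).1 odd_zero_zero (θ x.2.1.2) (θ x.1.1.2)) := by
      unfold TwoEdge.term
      rw [T.glue_glue x.2.2 x.1.2 (hw x hx).1 (hw x hx).2 odd_zero_zero odd_one_zero odd_zero_zero
        odd_zero_one]
      simp [Parity.deg, sgn_one]
    have e₂ : (g x).term T θ = T.glue a' b' (hw x hx).2 odd_zero_one (θ x.2.1.1)
        (T.glue a b (hw x hx).1 odd_zero_zero (θ x.2.1.2) (θ x.1.1.2)) := by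
      rw [g_eq x hx]
      simp only [TwoEdge.term]
      rw [← hr, ← hu, ← hv, ← T.act_glue_of_eq ρ ρb ρa (hw x hx).1.symm _ _ _
        ((w x).isRelabel ρ), ← T.act_glue_of_eq ρ ρb' ρa' (hw x hx).2.symm _ _ _ hc,
        T.act_eq_self _ ρc, T.glue_symm (hw x hx).1 _ odd_zero_zero odd_zero_zero,
        T.glue_symm (hw x hx).2 _ odd_zero_one odd_one_zero]
      simp [sgn_zero]
    rw [e₁, e₂, neg_add_cancel]
  refine Finset.sum_involution (fun x _ => g x) (fun x hx => key x (Finset.mem_filter.1 hx).2)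
    (fun x hx hne h => hne ?_)
    (fun x hx => Finset.mem_filter.2 ⟨Finset.mem_univ _, g_mem x (Finset.mem_filter.1 hx).2⟩)
    (fun x hx => ?_)
  -- At a fixed point of the involution twice the term vanishes, hence so does the term in
  -- characteristic zero.
  · have := key x (Finset.mem_filter.1 hx).2
    rw [h, ← two_smul k] at this
    exact (smul_eq_zero.1 this).resolve_left two_ne_zero
  · replace hx := (Finset.mem_filter.1 hx).2
    have hx' := g_mem x hx
    have eg : ∀ y : TwoEdge a b a' b' c, a ∈ y.2.1.2.legs →
        (g y).1.1.1 = (w y).relabel ρ ∧ (g y).1.1.2 = y.2.1.1.relabel ρ ∧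
        (g y).2.1.1 = y.1.1.2.relabel ρ ∧ (g y).2.1.2 = y.2.1.2.relabel ρ := fun y hy => by
      rw [g_eq y hy]
      exact ⟨rfl, rfl, rfl, rfl⟩
    obtain ⟨a₁, a₂, a₃, a₄⟩ := eg x hx
    obtain ⟨b₁, b₂, b₃, b₄⟩ := eg (g x) hx'
    refine TwoEdge.ext ?_ ?_ ?_ ?_
    · rw [b₁, ← ρρ x.1.1.1]
      congr 1
      -- In the reversed graph, contracting the new middle vertex with the new last one gives back
      -- the relabelled contraction of `u` and `v`, and the result of a contraction is unique.
      have e := (hw (g x) hx').1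
      rw [a₄, a₂] at e
      exact e.unique (x.2.2.symm.relabel ρb' ρa' (x.2.1.2.isRelabel ρ) (x.2.1.1.isRelabel ρ)
        (x.1.1.1.isRelabel ρ))
    · rw [b₂, a₃, ρρ]
    · rw [b₃, a₂, ρρ]
    · rw [b₄, a₄, ρρ]

/-- The leg `a` lies on `v` or on `u`. Interchanging `u` and `v` together with the names `a'` and
`b'` matches the two halves of the sum, without sign because `θ` has degree zero, so both halves
vanish. -/
theorem sum_twoEdge [CharZero k] {a b a' b' : ℕ} {c : Vertex .cyclic}
    (hθ : EquivariantBelow T θ c.legs.card) (hab : a ≠ b) (ha : a ∉ c.legs) (hb : b ∉ c.legs)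
    (hab' : a' ≠ b') (ha' : a' ∉ c.legs) (hb' : b' ∉ c.legs) (h₁ : a' ≠ a) (h₂ : a' ≠ b)
    (h₃ : b' ≠ a) (h₄ : b' ≠ b) : ∑ x : TwoEdge a b a' b' c, x.term T θ = 0 := by
  classical
  let τ := Equiv.swap a' b'
  have hl : ∀ s : VSplit a b c, ∀ m ∈ s.1.1.legs, τ m = m := fun s m hm => by
    have e := s.2.legs
    exact Equiv.swap_apply_of_ne_of_ne (by grind) (by grind)
  have τa : τ a = a := Equiv.swap_apply_of_ne_of_ne h₁.symm h₃.symm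
  let e : TwoEdge a b a' b' c ≃ TwoEdge a b a' b' c := Equiv.sigmaCongrRight fun s =>
    VSplit.symm.trans (VSplit.relabel (Equiv.swap_apply_right a' b')
      (Equiv.swap_apply_left a' b') (Vertex.isRelabel_self (hl s)))
  have he : ∀ x, (e x).term T θ = x.term T θ := fun x => by
    have hlt := x.1.2.left_card_lt
    have hu := hθ τ (x.2.1.1.isRelabel τ) (x.2.2.left_card_lt.trans hlt)
    have hv := hθ τ (x.2.1.2.isRelabel τ) (x.2.2.right_card_lt.trans hlt)
    change T.glue a b x.1.2 odd_one_zero (T.glue a' b'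
      (x.2.2.symm.relabel (Equiv.swap_apply_right a' b') (Equiv.swap_apply_left a' b')
        (x.2.1.2.isRelabel τ) (x.2.1.1.isRelabel τ) (Vertex.isRelabel_self (hl x.1)))
      odd_zero_zero (θ (x.2.1.2.relabel τ)) (θ (x.2.1.1.relabel τ))) (θ x.1.1.2) = _
    rw [← hu, ← hv, ← T.act_glue_of_eq τ (Equiv.swap_apply_right a' b')
      (Equiv.swap_apply_left a' b') x.2.2.symm _ _ _ (Vertex.isRelabel_self (hl x.1)),
      T.act_eq_self _ (hl x.1), T.glue_symm x.2.2 _ odd_zero_zero odd_zero_zero]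
    simp [sgn_zero, TwoEdge.term]
  rw [← Finset.sum_filter_add_sum_filter_not Finset.univ
    (fun x : TwoEdge a b a' b' c => a ∈ x.2.1.2.legs),
    sum_twoEdge_right hθ hab ha hb hab' ha' hb' h₁ h₂ h₃ h₄, zero_add,
    ← sum_twoEdge_right hθ hab ha hb hab' ha' hb' h₁ h₂ h₃ h₄]
  refine Finset.sum_equiv e (fun x => ?_) fun x _ => (he x).symm
  have e₂ : (e x).2.1.2 = x.2.1.1.relabel τ := rfl
  simp only [Finset.mem_filter, Finset.mem_univ, true_and, e₂]
  rw [Vertex.mem_relabel, Equiv.Perm.inv_eq_iff_eq.2 τa.symm]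
  have m := x.1.2.left_mem
  have e' := x.2.2.legs
  have d := Finset.disjoint_left.1 x.2.2.disjoint
  grind

/-- The Bianchi identity. The Leibniz rule puts `dθ` on either end of the edge; the two sums agree
by symmetry. The Maurer–Cartan equation, needed only for vertices with fewer legs, turns them into a
sum over two-edge graphs, which is zero. -/
theorem d_bracket [CharZero k] {a b : ℕ} {c : Vertex .cyclic}
    (hθ : EquivariantBelow T θ c.legs.card) (hMC : MaurerCartanBelow T θ c.legs.card)
    (hab : a ≠ b) (ha : a ∉ c.legs) (hb : b ∉ c.legs) :
    T.d (one_add_one_eq_two (R := ℤ)) (bracket T θ a b c) = 0 := by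
  -- Fresh names for the second edge; by the Maurer–Cartan hypothesis any names off the legs are
  -- allowed.
  obtain ⟨a', ha'⟩ := Infinite.exists_notMem_finset (insert a (insert b c.legs))
  obtain ⟨b', hb'⟩ := Infinite.exists_notMem_finset (insert a' (insert a (insert b c.legs)))
  simp only [Finset.mem_insert, not_or] at ha' hb'
  obtain ⟨h₁, h₂, ha'⟩ := ha'
  obtain ⟨h₀, h₃, h₄, hb'⟩ := hb'
  let τ := Equiv.swap a b
  have τc : ∀ m ∈ c.legs, τ m = m := fun m hm =>
    Equiv.swap_apply_of_ne_of_ne (by grind) (by grind)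
  have hc := Vertex.isRelabel_self τc
  have hl : ∀ s : VSplit a b c, T.glue a b s.2 odd_one_zero (T.d (zero_add 1) (θ s.1.1))
      (θ s.1.2) = -(1 / 2 : k) • ∑ y : VSplit a' b' s.1.1,
        TwoEdge.term T θ (⟨s, y⟩ : TwoEdge a b a' b' c) := fun s => by
    have e := s.2.legs
    rw [hMC a' b' s.1.1 (Ne.symm h₀) (by grind) (by grind) s.2.left_card_lt, bracket, map_smul,
      map_sum, LinearMap.smul_apply, LinearMap.sum_apply]
    rfl
  -- The two orientations of the edge are exchanged, and the transposition `τ` restores the names of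
  -- its ends.
  have hr : ∑ s : VSplit a b c, T.glue a b s.2 odd_zero_one (θ s.1.1)
      (T.d (zero_add 1) (θ s.1.2)) = ∑ s : VSplit a b c, T.glue a b s.2 odd_one_zero
        (T.d (zero_add 1) (θ s.1.1)) (θ s.1.2) := by
    refine Fintype.sum_equiv (VSplit.symm.trans (VSplit.relabel (Equiv.swap_apply_right a b)
      (Equiv.swap_apply_left a b) hc)) _ _ fun s => ?_
    change _ = T.glue a b (s.2.symm.relabel (Equiv.swap_apply_right a b)
      (Equiv.swap_apply_left a b) (s.1.2.isRelabel τ) (s.1.1.isRelabel τ) hc) odd_one_zero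
        (T.d (zero_add 1) (θ (s.1.2.relabel τ))) (θ (s.1.1.relabel τ))
    rw [← hθ τ (s.1.1.isRelabel τ) s.2.left_card_lt, ← hθ τ (s.1.2.isRelabel τ)
      s.2.right_card_lt, ← T.act_d, ← T.act_glue_of_eq τ (Equiv.swap_apply_right a b)
      (Equiv.swap_apply_left a b) s.2.symm _ _ _ hc, T.act_eq_self _ τc,
      T.glue_symm s.2 _ odd_zero_one odd_one_zero]
    simp [sgn_zero]
  have hs : ∀ s : VSplit a b c, T.d (one_add_one_eq_two (R := ℤ))
      (T.glue a b s.2 odd_zero_zero (θ s.1.1) (θ s.1.2)) =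
      -(T.glue a b s.2 odd_one_zero (T.d (zero_add 1) (θ s.1.1)) (θ s.1.2)) -
        T.glue a b s.2 odd_zero_one (θ s.1.1) (T.d (zero_add 1) (θ s.1.2)) := fun s => by
    rw [T.d_glue s.2 odd_zero_zero (zero_add 1) (zero_add 1) one_add_one_eq_two odd_one_zero
      odd_zero_one]
    simp [Parity.deg, sgn_one, sgn_zero]
    abel
  rw [bracket, map_sum, Finset.sum_congr rfl fun s _ => hs s, Finset.sum_sub_distrib,
    Finset.sum_neg_distrib, hr, Finset.sum_congr rfl fun s _ => hl s, ← Finset.smul_sum,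
    ← Fintype.sum_sigma' (fun s y => TwoEdge.term T θ (⟨s, y⟩ : TwoEdge a b a' b' c)),
    sum_twoEdge hθ hab ha hb (Ne.symm h₀) ha' hb' h₁ h₂ h₃ h₄]
  simp

end MaurerCartan

/-- Fubini for finitely supported sums. It serves to merge the sums over decompositions and over
degrees, and the nested sums of an iterated contraction. -/
theorem finsum_sigma {ι M : Type*} {κ : ι → Type*} [AddCommMonoid M] (f : (Σ i, κ i) → M)
    (hf : f.HasFiniteSupport) : ∑ᶠ x, f x = ∑ᶠ i, ∑ᶠ j, f ⟨i, j⟩ := by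
  classical
  let s : Finset (Σ i, κ i) := Set.Finite.toFinset hf
  have hs : ∀ x, f x ≠ 0 → x ∈ s := fun x hx => (Set.Finite.mem_toFinset hf).2 hx
  let t : ∀ i, Finset (κ i) := fun i =>
    s.preimage (Sigma.mk i) (sigma_mk_injective.injOn)
  have h₁ : ∀ i, ∑ᶠ j, f ⟨i, j⟩ = ∑ j ∈ t i, f ⟨i, j⟩ := fun i =>
    finsum_eq_sum_of_support_subset _ fun j hj => by
      simpa [t] using hs ⟨i, j⟩ hj
  have h₂ : ∑ᶠ i, ∑ᶠ j, f ⟨i, j⟩ = ∑ i ∈ s.image Sigma.fst, ∑ᶠ j, f ⟨i, j⟩ :=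
    finsum_eq_sum_of_support_subset _ fun i hi => by
      obtain ⟨j, hj⟩ : ∃ j, f ⟨i, j⟩ ≠ 0 := by
        by_contra! h
        exact hi (finsum_eq_zero_of_forall_eq_zero h)
      exact Finset.mem_coe.2 (Finset.mem_image_of_mem Sigma.fst (hs _ hj))
  rw [h₂, Finset.sum_congr rfl fun i _ => h₁ i, Finset.sum_sigma',
    finsum_eq_sum_of_support_subset f (s := (s.image Sigma.fst).sigma t)]
  intro x hx
  have := hs x hx
  simp only [Finset.coe_sigma, Set.mem_sigma_iff, Finset.mem_coe, Finset.mem_image, t,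
    Finset.mem_preimage]
  exact ⟨⟨x, this, rfl⟩, this⟩

/-! ### The tensor product of cyclic operads of opposite parities -/

section Tensor

open TensorProduct

variable {k : Type u} [Field k] {p : Parity}

/-! ### Operations in fixed bidegrees, without Koszul signs between the two factors -/

section Bigraded

variable {P : Operad k .cyclic p} {A : Operad k .cyclic p.flip}

variable (P A) in
/-- The differential of the first factor. -/
noncomputable def biDLeft {c : Vertex .cyclic} {i i' : ℤ} (h : i + 1 = i') (j : ℤ) :
    P.obj c i ⊗[k] A.obj c j →ₗ[k] P.obj c i' ⊗[k] A.obj c j :=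
  (P.d h).rTensor _

variable (P A) in
/-- The differential of the second factor. -/
noncomputable def biDRight {c : Vertex .cyclic} (i : ℤ) {j j' : ℤ} (h : j + 1 = j') :
    P.obj c i ⊗[k] A.obj c j →ₗ[k] P.obj c i ⊗[k] A.obj c j' :=
  (A.d h).lTensor _

variable (P A) in
/-- The tensor product of the contractions. -/
noncomputable def biGlue (a b : ℕ) {c₁ c₂ c : Vertex .cyclic} (h : IsGlue a b c₁ c₂ c)
    {i₁ j₁ i₂ j₂ i j : ℤ} (hi : i₁ + i₂ + p.deg = i) (hj : j₁ + j₂ + p.flip.deg = j) :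
    P.obj c₁ i₁ ⊗[k] A.obj c₁ j₁ →ₗ[k] P.obj c₂ i₂ ⊗[k] A.obj c₂ j₂ →ₗ[k]
      P.obj c i ⊗[k] A.obj c j :=
  TensorProduct.map₂ (P.glue a b h hi) (A.glue a b h hj)

variable (P A) in
/-- The diagonal action. -/
noncomputable def biAct (σ : Equiv.Perm ℕ) {c c' : Vertex .cyclic} (h : IsRelabel σ c c')
    (i j : ℤ) : P.obj c i ⊗[k] A.obj c j →ₗ[k] P.obj c' i ⊗[k] A.obj c' j :=
  TensorProduct.map (P.act σ h) (A.act σ h)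

variable {c₁ c₂ c₃ c : Vertex .cyclic}

theorem biDLeft_biDLeft {i i' i'' j : ℤ} (h : i + 1 = i') (h' : i' + 1 = i'')
    (x : P.obj c i ⊗[k] A.obj c j) : biDLeft P A h' j (biDLeft P A h j x) = 0 := by
  unfold biDLeft
  induction x with
  | zero => simp only [map_zero]
  | add x y hx hy => simp only [map_add, hx, hy, add_zero]
  | tmul x y => simp [P.d_d]

theorem biDRight_biDRight {i j j' j'' : ℤ} (h : j + 1 = j') (h' : j' + 1 = j'')
    (x : P.obj c i ⊗[k] A.obj c j) : biDRight P A i h' (biDRight P A i h x) = 0 := by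
  unfold biDRight
  induction x with
  | zero => simp only [map_zero]
  | add x y hx hy => simp only [map_add, hx, hy, add_zero]
  | tmul x y => simp [A.d_d]

theorem biDLeft_biDRight {i i' j j' : ℤ} (h : i + 1 = i') (h' : j + 1 = j')
    (x : P.obj c i ⊗[k] A.obj c j) :
    biDLeft P A h j' (biDRight P A i h' x) = biDRight P A i' h' (biDLeft P A h j x) := by
  unfold biDLeft biDRight
  induction x with
  | zero => simp only [map_zero]
  | add x y hx hy => simp only [map_add, hx, hy]
  | tmul x y => simp

theorem biDLeft_biGlue {a b : ℕ} (h : IsGlue a b c₁ c₂ c) {i₁ j₁ i₂ j₂ i j i₁' i₂' i' : ℤ}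
    (hi : i₁ + i₂ + p.deg = i) (hj : j₁ + j₂ + p.flip.deg = j) (h₁ : i₁ + 1 = i₁')
    (h₂ : i₂ + 1 = i₂') (h₀ : i + 1 = i') (g₁ : i₁' + i₂ + p.deg = i')
    (g₂ : i₁ + i₂' + p.deg = i') (x : P.obj c₁ i₁ ⊗[k] A.obj c₁ j₁)
    (y : P.obj c₂ i₂ ⊗[k] A.obj c₂ j₂) :
    biDLeft P A h₀ j (biGlue P A a b h hi hj x y) = sgn k p.deg •
      (biGlue P A a b h g₁ hj (biDLeft P A h₁ j₁ x) y +
        sgn k i₁ • biGlue P A a b h g₂ hj x (biDLeft P A h₂ j₂ y)) := by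
  unfold biDLeft biGlue
  induction x with
  | zero => simp only [map_zero, LinearMap.zero_apply, smul_zero, add_zero]
  | add x x' hx hx' =>
    simp only [map_add, LinearMap.add_apply, hx, hx', smul_add]
    abel
  | tmul x u =>
    induction y with
    | zero => simp only [map_zero, smul_zero, add_zero]
    | add y y' hy hy' =>
      simp only [map_add, hy, hy', smul_add]
      abel
    | tmul y v => simp [P.d_glue h hi h₁ h₂ h₀ g₁ g₂, add_tmul, smul_tmul']

theorem biDRight_biGlue {a b : ℕ} (h : IsGlue a b c₁ c₂ c) {i₁ j₁ i₂ j₂ i j j₁' j₂' j' : ℤ}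
    (hi : i₁ + i₂ + p.deg = i) (hj : j₁ + j₂ + p.flip.deg = j) (h₁ : j₁ + 1 = j₁')
    (h₂ : j₂ + 1 = j₂') (h₀ : j + 1 = j') (g₁ : j₁' + j₂ + p.flip.deg = j')
    (g₂ : j₁ + j₂' + p.flip.deg = j') (x : P.obj c₁ i₁ ⊗[k] A.obj c₁ j₁)
    (y : P.obj c₂ i₂ ⊗[k] A.obj c₂ j₂) :
    biDRight P A i h₀ (biGlue P A a b h hi hj x y) = sgn k p.flip.deg •
      (biGlue P A a b h hi g₁ (biDRight P A i₁ h₁ x) y +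
        sgn k j₁ • biGlue P A a b h hi g₂ x (biDRight P A i₂ h₂ y)) := by
  unfold biDRight biGlue
  induction x with
  | zero => simp only [map_zero, LinearMap.zero_apply, smul_zero, add_zero]
  | add x x' hx hx' =>
    simp only [map_add, LinearMap.add_apply, hx, hx', smul_add]
    abel
  | tmul x u =>
    induction y with
    | zero => simp only [map_zero, smul_zero, add_zero]
    | add y y' hy hy' =>
      simp only [map_add, hy, hy', smul_add]
      abel
    | tmul y v => simp [A.d_glue h hj h₁ h₂ h₀ g₁ g₂, tmul_add, tmul_smul]

theorem biGlue_symm {a b : ℕ} (h : IsGlue a b c₁ c₂ c) (h' : IsGlue b a c₂ c₁ c)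
    {i₁ j₁ i₂ j₂ i j : ℤ} (hi : i₁ + i₂ + p.deg = i) (hj : j₁ + j₂ + p.flip.deg = j)
    (hi' : i₂ + i₁ + p.deg = i) (hj' : j₂ + j₁ + p.flip.deg = j)
    (x : P.obj c₁ i₁ ⊗[k] A.obj c₁ j₁) (y : P.obj c₂ i₂ ⊗[k] A.obj c₂ j₂) :
    biGlue P A b a h' hi' hj' y x = sgn k (i₁ * i₂ + j₁ * j₂) • biGlue P A a b h hi hj x y := by
  unfold biGlue
  induction x with
  | zero => simp only [map_zero, LinearMap.zero_apply, smul_zero]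
  | add x x' hx hx' => simp only [map_add, LinearMap.add_apply, hx, hx', smul_add]
  | tmul x u =>
    induction y with
    | zero => simp only [map_zero, LinearMap.zero_apply, smul_zero]
    | add y y' hy hy' => simp only [map_add, LinearMap.add_apply, hy, hy', smul_add]
    | tmul y v =>
      simp [P.glue_symm h h' hi hi', A.glue_symm h h' hj hj', tmul_smul, ← smul_tmul', smul_smul,
        sgn_add, mul_comm]

theorem biGlue_biGlue {a b u v : ℕ} {c₁₂ c₂₃ : Vertex .cyclic} (h₁₂ : IsGlue a b c₁ c₂ c₁₂)
    (h₁ : IsGlue u v c₁₂ c₃ c) (h₂₃ : IsGlue u v c₂ c₃ c₂₃) (h₃ : IsGlue a b c₁ c₂₃ c)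
    {i₁ j₁ i₂ j₂ i₃ j₃ i₁₂ j₁₂ i₂₃ j₂₃ i j : ℤ} (hi₁₂ : i₁ + i₂ + p.deg = i₁₂)
    (hj₁₂ : j₁ + j₂ + p.flip.deg = j₁₂) (hi : i₁₂ + i₃ + p.deg = i)
    (hj : j₁₂ + j₃ + p.flip.deg = j) (hi₂₃ : i₂ + i₃ + p.deg = i₂₃)
    (hj₂₃ : j₂ + j₃ + p.flip.deg = j₂₃) (hi' : i₁ + i₂₃ + p.deg = i)
    (hj' : j₁ + j₂₃ + p.flip.deg = j) (x : P.obj c₁ i₁ ⊗[k] A.obj c₁ j₁)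
    (y : P.obj c₂ i₂ ⊗[k] A.obj c₂ j₂) (z : P.obj c₃ i₃ ⊗[k] A.obj c₃ j₃) :
    biGlue P A u v h₁ hi hj (biGlue P A a b h₁₂ hi₁₂ hj₁₂ x y) z =
      sgn k (p.deg * (i₁ + 1) + p.flip.deg * (j₁ + 1)) •
        biGlue P A a b h₃ hi' hj' x (biGlue P A u v h₂₃ hi₂₃ hj₂₃ y z) := by
  unfold biGlue
  induction x with
  | zero => simp only [map_zero, LinearMap.zero_apply, smul_zero]
  | add x x' hx hx' => simp only [map_add, LinearMap.add_apply, hx, hx', smul_add]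
  | tmul x x' =>
    induction y with
    | zero => simp only [map_zero, LinearMap.zero_apply, smul_zero]
    | add y y' hy hy' => simp only [map_add, LinearMap.add_apply, hy, hy', smul_add]
    | tmul y y' =>
      induction z with
      | zero => simp only [map_zero, smul_zero]
      | add z z' hz hz' => simp only [map_add, hz, hz', smul_add]
      | tmul z z' =>
        simp [P.glue_glue h₁₂ h₁ h₂₃ h₃ hi₁₂ hi hi₂₃ hi', A.glue_glue h₁₂ h₁ h₂₃ h₃ hj₁₂ hj hj₂₃ hj',
          tmul_smul, ← smul_tmul', smul_smul, sgn_add, mul_comm]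

theorem biAct_biDLeft (σ : Equiv.Perm ℕ) {c c' : Vertex .cyclic} (h : IsRelabel σ c c')
    {i i' j : ℤ} (h' : i + 1 = i') (x : P.obj c i ⊗[k] A.obj c j) :
    biAct P A σ h i' j (biDLeft P A h' j x) = biDLeft P A h' j (biAct P A σ h i j x) := by
  unfold biAct biDLeft
  induction x with
  | zero => simp only [map_zero]
  | add x y hx hy => simp only [map_add, hx, hy]
  | tmul x y => simp [P.act_d]

theorem biAct_biDRight (σ : Equiv.Perm ℕ) {c c' : Vertex .cyclic} (h : IsRelabel σ c c')
    {i j j' : ℤ} (h' : j + 1 = j') (x : P.obj c i ⊗[k] A.obj c j) :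
    biAct P A σ h i j' (biDRight P A i h' x) = biDRight P A i h' (biAct P A σ h i j x) := by
  unfold biAct biDRight
  induction x with
  | zero => simp only [map_zero]
  | add x y hx hy => simp only [map_add, hx, hy]
  | tmul x y => simp [A.act_d]

theorem biAct_biGlue (σ : Equiv.Perm ℕ) {a b : ℕ} {c₁' c₂' c' : Vertex .cyclic}
    (h : IsGlue a b c₁ c₂ c) (h' : IsGlue (σ a) (σ b) c₁' c₂' c') (h₁ : IsRelabel σ c₁ c₁')
    (h₂ : IsRelabel σ c₂ c₂') (h₀ : IsRelabel σ c c') {i₁ j₁ i₂ j₂ i j : ℤ}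
    (hi : i₁ + i₂ + p.deg = i) (hj : j₁ + j₂ + p.flip.deg = j)
    (x : P.obj c₁ i₁ ⊗[k] A.obj c₁ j₁) (y : P.obj c₂ i₂ ⊗[k] A.obj c₂ j₂) :
    biAct P A σ h₀ i j (biGlue P A a b h hi hj x y) =
      biGlue P A (σ a) (σ b) h' hi hj (biAct P A σ h₁ i₁ j₁ x) (biAct P A σ h₂ i₂ j₂ y) := by
  unfold biAct biGlue
  induction x with
  | zero => simp only [map_zero, LinearMap.zero_apply]
  | add x x' hx hx' => simp only [map_add, LinearMap.add_apply, hx, hx']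
  | tmul x u =>
    induction y with
    | zero => simp only [map_zero]
    | add y y' hy hy' => simp only [map_add, hy, hy']
    | tmul y v => simp [P.act_glue σ h h' h₁ h₂ h₀ hi, A.act_glue σ h h' h₁ h₂ h₀ hj]

end Bigraded

end Tensor

/-! ### The product totalization, with its Koszul signs, is an odd cyclic operad -/

section TensorTotal

open TensorProduct

variable {k : Type u} [Field k] {p : Parity} (P : Operad k .cyclic p)
  (A : Operad k .cyclic p.flip)

/-- The product totalization of the tensor product. -/
abbrev TensorObj (c : Vertex .cyclic) (n : ℤ) : Type u :=
  ∀ s : {s : ℤ × ℤ // s.1 + s.2 = n}, P.obj c s.1.1 ⊗[k] A.obj c s.1.2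

/-- The part of the differential that comes from the first factor. -/
noncomputable def tensorDLeft {c : Vertex .cyclic} {n n' : ℤ} (h : n + 1 = n') :
    TensorObj P A c n →ₗ[k] TensorObj P A c n' :=
  LinearMap.pi fun s => biDLeft P A (show s.1.1 - 1 + 1 = s.1.1 by omega) s.1.2 ∘ₗ
    LinearMap.proj (⟨(s.1.1 - 1, s.1.2), by have := s.2; dsimp only; omega⟩ :
      {s : ℤ × ℤ // s.1 + s.2 = n})

/-- The part of the differential that comes from the second factor. -/
noncomputable def tensorDRight {c : Vertex .cyclic} {n n' : ℤ} (h : n + 1 = n') :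
    TensorObj P A c n →ₗ[k] TensorObj P A c n' :=
  LinearMap.pi fun s => sgn k s.1.1 • biDRight P A s.1.1
    (show s.1.2 - 1 + 1 = s.1.2 by omega) ∘ₗ
      LinearMap.proj (⟨(s.1.1, s.1.2 - 1), by have := s.2; dsimp only; omega⟩ :
        {s : ℤ × ℤ // s.1 + s.2 = n})

/-- The total action. -/
noncomputable def tensorAct (σ : Equiv.Perm ℕ) {c c' : Vertex .cyclic} (h : IsRelabel σ c c')
    (n : ℤ) : TensorObj P A c n →ₗ[k] TensorObj P A c' n :=
  LinearMap.pi fun s => biAct P A σ h s.1.1 s.1.2 ∘ₗ LinearMap.proj s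

/-- The pairs of bidegrees that contribute to a contraction. -/
@[ext]
structure BiSplit (p : Parity) (m n i j : ℤ) where
  i₁ : ℤ
  j₁ : ℤ
  i₂ : ℤ
  j₂ : ℤ
  left : i₁ + j₁ = m
  right : i₂ + j₂ = n
  fst : i₁ + i₂ + p.deg = i
  snd : j₁ + j₂ + p.flip.deg = j

variable {P A}

/-- The degree of the source is a free variable subject to an equation, so that no transport between
equal bidegrees is needed later. -/
theorem tensorDLeft_apply {c : Vertex .cyclic} {n n' : ℤ} (h : n + 1 = n')
    (φ : TensorObj P A c n) {i i' j : ℤ} (hi : i + 1 = i') (hs : i' + j = n') :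
    tensorDLeft P A h φ ⟨(i', j), hs⟩ = biDLeft P A hi j (φ ⟨(i, j), by dsimp only; omega⟩) := by
  obtain rfl : i = i' - 1 := by omega
  rfl

theorem tensorDRight_apply {c : Vertex .cyclic} {n n' : ℤ} (h : n + 1 = n')
    (φ : TensorObj P A c n) {i j j' : ℤ} (hj : j + 1 = j') (hs : i + j' = n') :
    tensorDRight P A h φ ⟨(i, j'), hs⟩ =
      sgn k i • biDRight P A i hj (φ ⟨(i, j), by dsimp only; omega⟩) := by
  obtain rfl : j = j' - 1 := by omega
  rfl

/-- The sum of `q.i₁` and `q.i₂` is prescribed, so boundedness of `P` on one side bounds both of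
them, and `q.i₁` determines the rest. Contractions in the product totalization are therefore finite
sums with no condition on `A`. -/
theorem finite_biSplit (hP : P.IsFiniteType) (c₁ c₂ : Vertex .cyclic) (m n i j : ℤ) :
    {q : BiSplit p m n i j | ¬ (Subsingleton (P.obj c₁ q.i₁) ∨
      Subsingleton (P.obj c₂ q.i₂))}.Finite := by
  have key : ∃ M N : ℤ, ∀ q : BiSplit p m n i j, ¬ (Subsingleton (P.obj c₁ q.i₁) ∨
      Subsingleton (P.obj c₂ q.i₂)) → M ≤ q.i₁ ∧ q.i₁ ≤ N := by
    rcases hP.bounded with h | h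
    · obtain ⟨M, hM⟩ := h c₁
      obtain ⟨N, hN⟩ := h c₂
      refine ⟨M, i - p.deg - N, fun q hq => ⟨?_, ?_⟩⟩
      · by_contra hc
        exact hq (Or.inl (hM _ (by omega)))
      · by_contra hc
        exact hq (Or.inr (hN _ (by have := q.fst; omega)))
    · obtain ⟨M, hM⟩ := h c₁
      obtain ⟨N, hN⟩ := h c₂
      refine ⟨i - p.deg - N, M, fun q hq => ⟨?_, ?_⟩⟩
      · by_contra hc
        exact hq (Or.inr (hN _ (by have := q.fst; omega)))
      · by_contra hc
        exact hq (Or.inl (hM _ (by omega)))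
  obtain ⟨M, N, h⟩ := key
  refine Set.Finite.of_finite_image (f := BiSplit.i₁)
    ((Set.finite_Icc M N).subset (Set.image_subset_iff.2 fun q hq => h q hq)) ?_
  intro q _ q' _ e
  have := q.left; have := q.right; have := q.fst
  have := q'.left; have := q'.right; have := q'.fst
  exact BiSplit.ext e (by omega) (by omega) (by omega)

/-- A family over pairs of bidegrees, that vanishes when one of the two components does, has
finite support. -/
theorem hasFiniteSupport_biSplit (hP : P.IsFiniteType) (c₁ c₂ : Vertex .cyclic) {m n i j : ℤ}
    {M : Type*} [AddCommGroup M] (F : BiSplit p m n i j → M)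
    (h₁ : ∀ q, Subsingleton (P.obj c₁ q.i₁) → F q = 0)
    (h₂ : ∀ q, Subsingleton (P.obj c₂ q.i₂) → F q = 0) : F.HasFiniteSupport :=
  (finite_biSplit hP c₁ c₂ m n i j).subset fun q hq hc => hq (hc.elim (h₁ q) (h₂ q))

theorem _root_.Function.HasFiniteSupport.comp_bijective {α β M : Type*} [Zero M] {f : β → M}
    (hf : f.HasFiniteSupport) {e : α → β} (he : Function.Bijective e) :
    Function.HasFiniteSupport fun x => f (e x) :=
  Set.Finite.preimage he.injective.injOn hf

theorem _root_.Function.HasFiniteSupport.const_smul {α M : Type*} [AddCommGroup M] [Module k M]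
    {f : α → M} (hf : f.HasFiniteSupport) (r : k) : Function.HasFiniteSupport fun x => r • f x :=
  Set.Finite.subset hf fun x hx hc => hx (by simp only [hc, smul_zero])

theorem hasFiniteSupport_sigma {ι M : Type*} {κ : ι → Type*} [Zero M] {f : (Σ i, κ i) → M}
    {S : Set ι} (hS : S.Finite) (hf : ∀ i, i ∉ S → ∀ j, f ⟨i, j⟩ = 0)
    (hi : ∀ i, Function.HasFiniteSupport fun j => f ⟨i, j⟩) : f.HasFiniteSupport := by
  refine (hS.biUnion fun i _ => (hi i).image (Sigma.mk i)).subset ?_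
  rintro ⟨i, j⟩ hx
  refine Set.mem_biUnion (x := i) ?_ ⟨j, hx, rfl⟩
  by_contra h
  exact hx (hf i h j)

theorem _root_.Function.HasFiniteSupport.map {α M N : Type*} [AddCommGroup M] [Module k M]
    [AddCommGroup N] [Module k N] {f : α → M} (hf : f.HasFiniteSupport) (g : M →ₗ[k] N) :
    Function.HasFiniteSupport fun x => g (f x) :=
  Set.Finite.subset hf fun x hx hc => hx (by simp only [hc, map_zero])

/-- The Koszul sign of a contraction. -/
def BiSplit.sign {m n i j : ℤ} (q : BiSplit p m n i j) : ℤ :=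
  -- The contraction of `A` moves past the two elements of `P`, and the first element of `A` moves
  -- past the second element of `P`.
  p.flip.deg * (q.i₁ + q.i₂) + q.j₁ * q.i₂

/-- The contribution of a pair of bidegrees to a contraction. -/
noncomputable def tensorTerm (a b : ℕ) {c₁ c₂ c : Vertex .cyclic} (h : IsGlue a b c₁ c₂ c)
    {m n i j : ℤ} (φ : TensorObj P A c₁ m) (ψ : TensorObj P A c₂ n) (q : BiSplit p m n i j) :
    P.obj c i ⊗[k] A.obj c j :=
  sgn k q.sign • biGlue P A a b h q.fst q.snd (φ ⟨(q.i₁, q.j₁), q.left⟩)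
    (ψ ⟨(q.i₂, q.j₂), q.right⟩)

theorem hasFiniteSupport_tensorTerm (hP : P.IsFiniteType) {a b : ℕ} {c₁ c₂ c : Vertex .cyclic}
    (h : IsGlue a b c₁ c₂ c) {m n i j : ℤ} (φ : TensorObj P A c₁ m) (ψ : TensorObj P A c₂ n) :
    Function.HasFiniteSupport (tensorTerm a b h φ ψ : BiSplit p m n i j → _) := by
  refine hasFiniteSupport_biSplit hP c₁ c₂ _ (fun q hq => ?_) fun q hq => ?_
  · rw [tensorTerm, Subsingleton.elim (φ ⟨(q.i₁, q.j₁), q.left⟩) 0, map_zero,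
      LinearMap.zero_apply, smul_zero]
  · rw [tensorTerm, Subsingleton.elim (ψ ⟨(q.i₂, q.j₂), q.right⟩) 0, map_zero, smul_zero]

/-- The total contraction. -/
noncomputable def tensorGlue (hP : P.IsFiniteType) (A : Operad k .cyclic p.flip) (a b : ℕ)
    {c₁ c₂ c : Vertex .cyclic} (h : IsGlue a b c₁ c₂ c) (m n l : ℤ) :
    TensorObj P A c₁ m →ₗ[k] TensorObj P A c₂ n →ₗ[k] TensorObj P A c l :=
  LinearMap.mk₂ k (fun φ ψ s => ∑ᶠ q : BiSplit p m n s.1.1 s.1.2, tensorTerm a b h φ ψ q)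
    (fun φ φ' ψ => funext fun s => by
      rw [Pi.add_apply, ← finsum_add_distrib (hasFiniteSupport_tensorTerm hP h φ ψ)
        (hasFiniteSupport_tensorTerm hP h φ' ψ)]
      refine finsum_congr fun q => ?_
      simp [tensorTerm])
    (fun r φ ψ => funext fun s => by
      rw [Pi.smul_apply, smul_finsum]
      refine finsum_congr fun q => ?_
      simp [tensorTerm, smul_comm r])
    (fun φ ψ ψ' => funext fun s => by
      rw [Pi.add_apply, ← finsum_add_distrib (hasFiniteSupport_tensorTerm hP h φ ψ)
        (hasFiniteSupport_tensorTerm hP h φ ψ')]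
      refine finsum_congr fun q => ?_
      simp [tensorTerm])
    (fun r φ ψ => funext fun s => by
      rw [Pi.smul_apply, smul_finsum]
      refine finsum_congr fun q => ?_
      simp [tensorTerm, smul_comm r])

theorem tensorGlue_apply (hP : P.IsFiniteType) {a b : ℕ} {c₁ c₂ c : Vertex .cyclic}
    (h : IsGlue a b c₁ c₂ c) {m n l : ℤ} (φ : TensorObj P A c₁ m) (ψ : TensorObj P A c₂ n)
    (s : {s : ℤ × ℤ // s.1 + s.2 = l}) :
    tensorGlue hP A a b h m n l φ ψ s = ∑ᶠ q : BiSplit p m n s.1.1 s.1.2, tensorTerm a b h φ ψ q :=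
  rfl

theorem sgn_smul_eq_neg {M : Type*} [AddCommGroup M] [Module k M] {a b : ℤ}
    (h : (a : ZMod 2) = b + 1) (x : M) : sgn k a • x = -(sgn k b • x) := by
  rw [sgn_congr (show (a : ZMod 2) = (b + 1 : ℤ) by push_cast; exact h), sgn_add, sgn_one, mul_neg,
    mul_one, neg_smul]

theorem Parity.cast_deg_flip (p : Parity) : (p.flip.deg : ZMod 2) = 1 + p.deg := by
  cases p <;> rfl

/-- The Leibniz rule of an odd operad for the first differential. In each bidegree `P` contributes
two terms, which are reindexed by raising the first degree of the left or of the right factor; the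
signs agree modulo two. -/
theorem tensorDLeft_tensorGlue (hP : P.IsFiniteType) {a b : ℕ} {c₁ c₂ c : Vertex .cyclic}
    (h : IsGlue a b c₁ c₂ c) {m n l m' n' l' : ℤ} (hl : m + n + 1 = l) (hm : m + 1 = m')
    (hn : n + 1 = n') (hl' : l + 1 = l') (φ : TensorObj P A c₁ m) (ψ : TensorObj P A c₂ n) :
    tensorDLeft P A hl' (tensorGlue hP A a b h m n l φ ψ) =
      -(tensorGlue hP A a b h m' n l' (tensorDLeft P A hm φ) ψ +
        sgn k m • tensorGlue hP A a b h m n' l' φ (tensorDLeft P A hn ψ)) := by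
  funext ⟨⟨i', j⟩, hs⟩
  have hi : i' - 1 + 1 = i' := by omega
  dsimp only at hs
  rw [tensorDLeft_apply hl' _ hi, tensorGlue_apply, map_finsum _
    (hasFiniteSupport_tensorTerm hP h φ ψ), Pi.neg_apply, Pi.add_apply, Pi.smul_apply,
    tensorGlue_apply, tensorGlue_apply, smul_finsum]
  let e₁ : BiSplit p m n (i' - 1) j → BiSplit p m' n i' j := fun q =>
    ⟨q.i₁ + 1, q.j₁, q.i₂, q.j₂, by have := q.left; omega, q.right, by have := q.fst; omega, q.snd⟩
  let e₂ : BiSplit p m n (i' - 1) j → BiSplit p m n' i' j := fun q =>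
    ⟨q.i₁, q.j₁, q.i₂ + 1, q.j₂, q.left, by have := q.right; omega, by have := q.fst; omega, q.snd⟩
  have he₁ : Function.Bijective e₁ := by
    refine Function.bijective_iff_has_inverse.2 ⟨fun q => ⟨q.i₁ - 1, q.j₁, q.i₂, q.j₂,
      by have := q.left; omega, q.right, by have := q.fst; omega, q.snd⟩, fun q => ?_, fun q => ?_⟩
    · exact BiSplit.ext (by simp [e₁]) rfl rfl rfl
    · exact BiSplit.ext (by simp [e₁]) rfl rfl rfl
  have he₂ : Function.Bijective e₂ := by
    refine Function.bijective_iff_has_inverse.2 ⟨fun q => ⟨q.i₁, q.j₁, q.i₂ - 1, q.j₂,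
      q.left, by have := q.right; omega, by have := q.fst; omega, q.snd⟩, fun q => ?_, fun q => ?_⟩
    · exact BiSplit.ext rfl rfl (by simp [e₂]) rfl
    · exact BiSplit.ext rfl rfl (by simp [e₂]) rfl
  have f₁ := (hasFiniteSupport_tensorTerm hP h (tensorDLeft P A hm φ) ψ).comp_bijective he₁
  have f₂ := ((hasFiniteSupport_tensorTerm hP h φ (tensorDLeft P A hn ψ)).comp_bijective
    he₂).const_smul (sgn k m)
  rw [← finsum_comp e₁ he₁, ← finsum_comp e₂ he₂, ← finsum_add_distrib f₁ f₂,
    ← finsum_neg_distrib]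
  refine finsum_congr fun q => ?_
  simp only [tensorTerm, e₁, e₂, map_smul]
  rw [tensorDLeft_apply hm φ (rfl : q.i₁ + 1 = _), tensorDLeft_apply hn ψ (rfl : q.i₂ + 1 = _),
    biDLeft_biGlue h q.fst q.snd (rfl : q.i₁ + 1 = _) (rfl : q.i₂ + 1 = _) hi
      (by have := q.fst; omega) (by have := q.fst; omega)]
  simp only [BiSplit.sign, smul_add, neg_add, smul_smul, ← sgn_add]
  have := p.deg_mul_self
  have e := p.cast_deg_flip
  have e' := congrArg (fun x : ℤ => (x : ZMod 2)) q.left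
  push_cast at e'
  refine congrArg₂ _ (sgn_smul_eq_neg ?_ _) (sgn_smul_eq_neg ?_ _)
  · push_cast
    grind
  · push_cast
    grind

/-- The same argument with the second degrees raised. The sign in `tensorDRight` depends on the
first degree of the result, so `q.fst` also enters the comparison of signs. -/
theorem tensorDRight_tensorGlue (hP : P.IsFiniteType) {a b : ℕ} {c₁ c₂ c : Vertex .cyclic}
    (h : IsGlue a b c₁ c₂ c) {m n l m' n' l' : ℤ} (hl : m + n + 1 = l) (hm : m + 1 = m')
    (hn : n + 1 = n') (hl' : l + 1 = l') (φ : TensorObj P A c₁ m) (ψ : TensorObj P A c₂ n) :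
    tensorDRight P A hl' (tensorGlue hP A a b h m n l φ ψ) =
      -(tensorGlue hP A a b h m' n l' (tensorDRight P A hm φ) ψ +
        sgn k m • tensorGlue hP A a b h m n' l' φ (tensorDRight P A hn ψ)) := by
  funext ⟨⟨i, j'⟩, hs⟩
  have hj : j' - 1 + 1 = j' := by omega
  dsimp only at hs
  rw [tensorDRight_apply hl' _ hj, tensorGlue_apply, map_finsum _
    (hasFiniteSupport_tensorTerm hP h φ ψ), Pi.neg_apply, Pi.add_apply, Pi.smul_apply,
    tensorGlue_apply, tensorGlue_apply, smul_finsum, smul_finsum]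
  let e₁ : BiSplit p m n i (j' - 1) → BiSplit p m' n i j' := fun q =>
    ⟨q.i₁, q.j₁ + 1, q.i₂, q.j₂, by have := q.left; omega, q.right, q.fst, by have := q.snd; omega⟩
  let e₂ : BiSplit p m n i (j' - 1) → BiSplit p m n' i j' := fun q =>
    ⟨q.i₁, q.j₁, q.i₂, q.j₂ + 1, q.left, by have := q.right; omega, q.fst, by have := q.snd; omega⟩
  have he₁ : Function.Bijective e₁ := by
    refine Function.bijective_iff_has_inverse.2 ⟨fun q => ⟨q.i₁, q.j₁ - 1, q.i₂, q.j₂,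
      by have := q.left; omega, q.right, q.fst, by have := q.snd; omega⟩, fun q => ?_, fun q => ?_⟩
    · exact BiSplit.ext rfl (by simp [e₁]) rfl rfl
    · exact BiSplit.ext rfl (by simp [e₁]) rfl rfl
  have he₂ : Function.Bijective e₂ := by
    refine Function.bijective_iff_has_inverse.2 ⟨fun q => ⟨q.i₁, q.j₁, q.i₂, q.j₂ - 1,
      q.left, by have := q.right; omega, q.fst, by have := q.snd; omega⟩, fun q => ?_, fun q => ?_⟩
    · exact BiSplit.ext rfl rfl rfl (by simp [e₂])
    · exact BiSplit.ext rfl rfl rfl (by simp [e₂])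
  have f₁ := (hasFiniteSupport_tensorTerm hP h (tensorDRight P A hm φ) ψ).comp_bijective he₁
  have f₂ := ((hasFiniteSupport_tensorTerm hP h φ (tensorDRight P A hn ψ)).comp_bijective
    he₂).const_smul (sgn k m)
  rw [← finsum_comp e₁ he₁, ← finsum_comp e₂ he₂, ← finsum_add_distrib f₁ f₂,
    ← finsum_neg_distrib]
  refine finsum_congr fun q => ?_
  simp only [tensorTerm, e₁, e₂, map_smul]
  rw [tensorDRight_apply hm φ (rfl : q.j₁ + 1 = _), tensorDRight_apply hn ψ (rfl : q.j₂ + 1 = _),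
    biDRight_biGlue h q.fst q.snd (rfl : q.j₁ + 1 = _) (rfl : q.j₂ + 1 = _) hj
      (by have := q.snd; omega) (by have := q.snd; omega)]
  simp only [BiSplit.sign, map_smul, LinearMap.smul_apply, smul_add, neg_add, smul_smul,
    ← sgn_add]
  have := p.deg_mul_self
  have e := p.cast_deg_flip
  have e' := congrArg (fun x : ℤ => (x : ZMod 2)) q.left
  push_cast at e'
  have e'' := congrArg (fun x : ℤ => (x : ZMod 2)) q.fst
  push_cast at e''
  refine congrArg₂ _ (sgn_smul_eq_neg ?_ _) (sgn_smul_eq_neg ?_ _)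
  · push_cast
    grind
  · push_cast
    grind

/-- Interchanging the factors costs `i₁ i₂ + j₁ j₂` from the two operads and replaces `j₁ i₂` by `j₂
i₁` in the Koszul sign; altogether this is the product of the total degrees. -/
theorem tensorGlue_symm (hP : P.IsFiniteType) {a b : ℕ} {c₁ c₂ c : Vertex .cyclic}
    (h : IsGlue a b c₁ c₂ c) (h' : IsGlue b a c₂ c₁ c) {m n l : ℤ}
    (φ : TensorObj P A c₁ m) (ψ : TensorObj P A c₂ n) :
    tensorGlue hP A b a h' n m l ψ φ = sgn k (m * n) • tensorGlue hP A a b h m n l φ ψ := by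
  funext s
  rw [Pi.smul_apply, tensorGlue_apply, tensorGlue_apply, smul_finsum]
  let e : BiSplit p n m s.1.1 s.1.2 → BiSplit p m n s.1.1 s.1.2 := fun q =>
    ⟨q.i₂, q.j₂, q.i₁, q.j₁, q.right, q.left, by have := q.fst; omega, by have := q.snd; omega⟩
  have he : Function.Bijective e := Function.bijective_iff_has_inverse.2 ⟨fun q =>
    ⟨q.i₂, q.j₂, q.i₁, q.j₁, q.right, q.left, by have := q.fst; omega, by have := q.snd; omega⟩,
    fun q => rfl, fun q => rfl⟩
  refine finsum_eq_of_bijective e he fun q => ?_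
  simp only [tensorTerm, e]
  rw [biGlue_symm h h' (by have := q.fst; omega) (by have := q.snd; omega) q.fst q.snd]
  simp only [BiSplit.sign, smul_smul, ← sgn_add]
  have e₁ := congrArg (fun x : ℤ => (x : ZMod 2)) q.left
  have e₂ := congrArg (fun x : ℤ => (x : ZMod 2)) q.right
  push_cast at e₁ e₂
  refine sgn_smul_congr ?_ rfl
  push_cast
  grind

/-- Both sides are sums over triples of bidegrees, the intermediate bidegree being determined by the
two others that enter it. Termwise this is associativity in `P` and in `A`. -/
theorem tensorGlue_tensorGlue (hP : P.IsFiniteType) {a b u v : ℕ}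
    {c₁ c₂ c₃ c₁₂ c₂₃ c : Vertex .cyclic} (h₁₂ : IsGlue a b c₁ c₂ c₁₂)
    (h₁ : IsGlue u v c₁₂ c₃ c) (h₂₃ : IsGlue u v c₂ c₃ c₂₃) (h₃ : IsGlue a b c₁ c₂₃ c)
    {m n r mn nr l : ℤ} (hmn : m + n + 1 = mn) (hl : mn + r + 1 = l) (hnr : n + r + 1 = nr)
    (hl' : m + nr + 1 = l) (φ : TensorObj P A c₁ m) (ψ : TensorObj P A c₂ n)
    (χ : TensorObj P A c₃ r) :
    tensorGlue hP A u v h₁ mn r l (tensorGlue hP A a b h₁₂ m n mn φ ψ) χ = sgn k (m + 1) •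
      tensorGlue hP A a b h₃ m nr l φ (tensorGlue hP A u v h₂₃ n r nr ψ χ) := by
  funext s
  rw [Pi.smul_apply, tensorGlue_apply, tensorGlue_apply, smul_finsum]
  let F : (Σ q : BiSplit p mn r s.1.1 s.1.2, BiSplit p m n q.i₁ q.j₁) →
      P.obj c s.1.1 ⊗[k] A.obj c s.1.2 := fun x =>
    sgn k x.1.sign • biGlue P A u v h₁ x.1.fst x.1.snd (tensorTerm a b h₁₂ φ ψ x.2)
      (χ ⟨(x.1.i₂, x.1.j₂), x.1.right⟩)
  let G : (Σ q : BiSplit p m nr s.1.1 s.1.2, BiSplit p n r q.i₂ q.j₂) →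
      P.obj c s.1.1 ⊗[k] A.obj c s.1.2 := fun x =>
    sgn k (m + 1) • sgn k x.1.sign • biGlue P A a b h₃ x.1.fst x.1.snd
      (φ ⟨(x.1.i₁, x.1.j₁), x.1.left⟩) (tensorTerm u v h₂₃ ψ χ x.2)
  have hF : ∀ q : BiSplit p mn r s.1.1 s.1.2,
      tensorTerm u v h₁ (tensorGlue hP A a b h₁₂ m n mn φ ψ) χ q = ∑ᶠ y, F ⟨q, y⟩ := fun q => by
    rw [tensorTerm, tensorGlue_apply]
    exact map_finsum (sgn k q.sign • (biGlue P A u v h₁ q.fst q.snd).flip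
      (χ ⟨(q.i₂, q.j₂), q.right⟩)) (hasFiniteSupport_tensorTerm hP h₁₂ φ ψ)
  have hG : ∀ q : BiSplit p m nr s.1.1 s.1.2,
      sgn k (m + 1) • tensorTerm a b h₃ φ (tensorGlue hP A u v h₂₃ n r nr ψ χ) q =
        ∑ᶠ y, G ⟨q, y⟩ := fun q => by
    rw [tensorTerm, tensorGlue_apply]
    exact map_finsum (sgn k (m + 1) • sgn k q.sign • biGlue P A a b h₃ q.fst q.snd
      (φ ⟨(q.i₁, q.j₁), q.left⟩)) (hasFiniteSupport_tensorTerm hP h₂₃ ψ χ)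
  have fF : F.HasFiniteSupport := by
    refine hasFiniteSupport_sigma (finite_biSplit hP c₁₂ c₃ mn r s.1.1 s.1.2) (fun q hq y => ?_)
      fun q => (hasFiniteSupport_tensorTerm hP h₁₂ φ ψ).map
        (sgn k q.sign • (biGlue P A u v h₁ q.fst q.snd).flip (χ ⟨(q.i₂, q.j₂), q.right⟩))
    simp only [Set.mem_ofPred_eq, not_not] at hq
    simp only [F]
    rcases hq with hq | hq
    · rw [Subsingleton.elim (tensorTerm a b h₁₂ φ ψ y) 0, map_zero, LinearMap.zero_apply, smul_zero]
    · rw [Subsingleton.elim (χ ⟨(q.i₂, q.j₂), q.right⟩) 0, map_zero, smul_zero]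
  -- The bijection keeps the bidegrees of the three elements and replaces the intermediate bidegree
  -- of the first pair by that of the last pair.
  let e : (Σ q : BiSplit p mn r s.1.1 s.1.2, BiSplit p m n q.i₁ q.j₁) →
      (Σ q : BiSplit p m nr s.1.1 s.1.2, BiSplit p n r q.i₂ q.j₂) := fun x =>
    ⟨⟨x.2.i₁, x.2.j₁, x.2.i₂ + x.1.i₂ + p.deg, x.2.j₂ + x.1.j₂ + p.flip.deg, x.2.left,
      by have := x.2.right; have := x.1.right; have := p.deg_flip; omega,
      by have := x.1.fst; have := x.2.fst; omega, by have := x.1.snd; have := x.2.snd; omega⟩,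
      ⟨x.2.i₂, x.2.j₂, x.1.i₂, x.1.j₂, x.2.right, x.1.right, rfl, rfl⟩⟩
  have he : Function.Bijective e := by
    refine Function.bijective_iff_has_inverse.2 ⟨fun x =>
      ⟨⟨x.1.i₁ + x.2.i₁ + p.deg, x.1.j₁ + x.2.j₁ + p.flip.deg, x.2.i₂, x.2.j₂,
        by have := x.2.left; have := x.1.left; have := p.deg_flip; omega, x.2.right,
        by have := x.1.fst; have := x.2.fst; omega, by have := x.1.snd; have := x.2.snd; omega⟩,
      ⟨x.1.i₁, x.1.j₁, x.2.i₁, x.2.j₁, x.1.left, x.2.left, rfl, rfl⟩⟩, ?_, ?_⟩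
    · rintro ⟨⟨i, j, i₃, j₃, g₁, g₂, g₃, g₄⟩, ⟨i₁, j₁, i₂, j₂, g₅, g₆, g₇, g₈⟩⟩
      dsimp only at g₇ g₈
      subst g₇ g₈
      rfl
    · rintro ⟨⟨i₁, j₁, i, j, g₁, g₂, g₃, g₄⟩, ⟨i₂, j₂, i₃, j₃, g₅, g₆, g₇, g₈⟩⟩
      dsimp only at g₇ g₈
      subst g₇ g₈
      rfl
  have hFG : ∀ x, F x = G (e x) := by
    rintro ⟨⟨i, j, i₃, j₃, g₁, g₂, g₃, g₄⟩, ⟨i₁, j₁, i₂, j₂, g₅, g₆, g₇, g₈⟩⟩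
    have key := biGlue_biGlue (P := P) (A := A) h₁₂ h₁ h₂₃ h₃ (i₂₃ := i₂ + i₃ + p.deg)
      (j₂₃ := j₂ + j₃ + p.flip.deg) g₇ g₈ g₃ g₄ rfl rfl
      (by dsimp only at g₇; omega) (by dsimp only at g₈; omega)
      (φ ⟨(i₁, j₁), g₅⟩) (ψ ⟨(i₂, j₂), g₆⟩) (χ ⟨(i₃, j₃), g₂⟩)
    simp only [F, G, e, tensorTerm, map_smul, LinearMap.smul_apply, BiSplit.sign]
    refine (congrArg _ (congrArg _ key)).trans ?_
    simp only [smul_smul, ← sgn_add]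
    have e₁ := congrArg (fun x : ℤ => (x : ZMod 2)) g₅
    have e₂ := congrArg (fun y : ℤ => (y : ZMod 2)) g₇
    have e₃ := congrArg (fun y : ℤ => (y : ZMod 2)) g₈
    have := p.deg_mul_self
    have e := p.cast_deg_flip
    push_cast at e₁ e₂ e₃
    refine sgn_smul_congr ?_ rfl
    push_cast
    grind
  have fG : G.HasFiniteSupport := by
    have h := fF
    rw [funext hFG] at h
    have := Set.Finite.image e h
    refine this.subset fun y hy => ?_
    obtain ⟨x, rfl⟩ := he.2 y
    exact ⟨x, hy, rfl⟩
  rw [finsum_congr hF, finsum_congr hG, ← finsum_sigma F fF, ← finsum_sigma G fG]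
  exact finsum_eq_of_bijective e he hFG

theorem tensorAct_tensorGlue (hP : P.IsFiniteType) (σ : Equiv.Perm ℕ) {a b : ℕ}
    {c₁ c₂ c c₁' c₂' c' : Vertex .cyclic} (h : IsGlue a b c₁ c₂ c)
    (h' : IsGlue (σ a) (σ b) c₁' c₂' c') (h₁ : IsRelabel σ c₁ c₁') (h₂ : IsRelabel σ c₂ c₂')
    (h₀ : IsRelabel σ c c') {m n l : ℤ} (φ : TensorObj P A c₁ m) (ψ : TensorObj P A c₂ n) :
    tensorAct P A σ h₀ l (tensorGlue hP A a b h m n l φ ψ) =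
      tensorGlue hP A (σ a) (σ b) h' m n l (tensorAct P A σ h₁ m φ) (tensorAct P A σ h₂ n ψ) := by
  funext s
  rw [tensorGlue_apply]
  refine (map_finsum (biAct P A σ h₀ s.1.1 s.1.2)
    (hasFiniteSupport_tensorTerm hP h φ ψ)).trans (finsum_congr fun q => ?_)
  rw [tensorTerm, map_smul, biAct_biGlue σ h h' h₁ h₂ h₀]
  rfl

theorem tensorDLeft_tensorDLeft {c : Vertex .cyclic} {n n' n'' : ℤ} (h : n + 1 = n')
    (h' : n' + 1 = n'') (φ : TensorObj P A c n) :
    tensorDLeft P A h' (tensorDLeft P A h φ) = 0 := by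
  funext ⟨⟨i, j⟩, hs⟩
  rw [tensorDLeft_apply h' _ (sub_add_cancel i 1), tensorDLeft_apply h _ (sub_add_cancel _ 1),
    biDLeft_biDLeft]
  rfl

theorem tensorDRight_tensorDRight {c : Vertex .cyclic} {n n' n'' : ℤ} (h : n + 1 = n')
    (h' : n' + 1 = n'') (φ : TensorObj P A c n) :
    tensorDRight P A h' (tensorDRight P A h φ) = 0 := by
  funext ⟨⟨i, j⟩, hs⟩
  rw [tensorDRight_apply h' _ (sub_add_cancel j 1), tensorDRight_apply h _ (sub_add_cancel _ 1),
    map_smul, biDRight_biDRight, smul_zero, smul_zero]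
  rfl

/-- In fixed bidegrees the two differentials commute. The first one raises the degree on which the
sign of the second depends, so in total they anticommute. -/
theorem tensorDLeft_tensorDRight {c : Vertex .cyclic} {n n' n'' : ℤ} (h : n + 1 = n')
    (h' : n' + 1 = n'') (φ : TensorObj P A c n) :
    tensorDLeft P A h' (tensorDRight P A h φ) = -tensorDRight P A h' (tensorDLeft P A h φ) := by
  funext ⟨⟨i, j⟩, hs⟩
  rw [Pi.neg_apply, tensorDLeft_apply h' _ (sub_add_cancel i 1),
    tensorDRight_apply h _ (sub_add_cancel j 1), tensorDRight_apply h' _ (sub_add_cancel j 1),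
    tensorDLeft_apply h _ (sub_add_cancel i 1), map_smul, biDLeft_biDRight]
  refine sgn_smul_eq_neg ?_ _
  push_cast
  grind

/-- The tensor product of two cyclic operads of opposite parities, as an odd cyclic operad. -/
noncomputable def tensorOperad (hP : P.IsFiniteType) (A : Operad k .cyclic p.flip) :
    Operad k .cyclic .odd where
  obj := TensorObj P A
  d h := tensorDLeft P A h + tensorDRight P A h
  act σ {_ _} h {n} := tensorAct P A σ h n
  glue a b {_ _ _} h {m n l} _ := tensorGlue hP A a b h m n l
  loop a b {_ _} h := h.false.elim
  d_d h h' φ := by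
    simp only [LinearMap.add_apply, map_add, tensorDLeft_tensorDLeft, tensorDRight_tensorDRight,
      tensorDLeft_tensorDRight]
    abel
  act_id σ {_} h {_} φ hσ := by
    funext s
    change TensorProduct.map (P.act σ h) (A.act σ h) (φ s) = φ s
    generalize φ s = x
    induction x with
    | zero => simp only [map_zero]
    | add x y hx hy => simp only [map_add, hx, hy]
    | tmul x y => simp [P.act_id σ h x hσ, A.act_id σ h y hσ]
  act_act σ τ {_ _ _} h h' h'' {_} φ := by
    funext s
    change TensorProduct.map (P.act τ h') (A.act τ h')
      (TensorProduct.map (P.act σ h) (A.act σ h) (φ s)) =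
        TensorProduct.map (P.act (τ * σ) h'') (A.act (τ * σ) h'') (φ s)
    generalize φ s = x
    induction x with
    | zero => simp only [map_zero]
    | add x y hx hy => simp only [map_add, hx, hy]
    | tmul x y => simp [P.act_act σ τ h h' h'', A.act_act σ τ h h' h'']
  act_d σ {_ _} h {_ _} hij φ := by
    funext s
    simp only [LinearMap.add_apply, map_add]
    refine congrArg₂ (· + ·) (biAct_biDLeft (P := P) (A := A) σ h _ _) ?_
    refine (map_smul (biAct P A σ h _ _) _ _).trans ?_
    exact congrArg (sgn k s.1.1 • ·) (biAct_biDRight (P := P) (A := A) σ h _ _)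
  act_glue σ {_ _ _ _ _ _ _ _} h h' h₁ h₂ h₀ {_ _ _} _ φ ψ :=
    tensorAct_tensorGlue hP σ h h' h₁ h₂ h₀ φ ψ
  act_loop σ {_ _ _ _ _ _} h := h.false.elim
  d_glue {_ _ _ _ _} h {m n m' n' l l'} hl hm hn hl' _ _ φ ψ := by
    simp only [LinearMap.add_apply, map_add]
    rw [tensorDLeft_tensorGlue hP h hl hm hn hl', tensorDRight_tensorGlue hP h hl hm hn hl']
    simp only [Parity.deg, sgn_one, smul_add, neg_smul, one_smul]
    abel
  d_loop {_ _ _ _} h := h.false.elim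
  glue_symm {_ _ _ _ _} h h' {_ _ _} _ _ φ ψ := tensorGlue_symm hP h h' φ ψ
  loop_symm {_ _ _ _} h := h.false.elim
  glue_glue {_ _ _ _ _ _ _ _ _ _} h₁₂ h₁ h₂₃ h₃ {m _ _ _ _ _} hm hr hn hr' φ ψ χ := by
    rw [tensorGlue_tensorGlue hP h₁₂ h₁ h₂₃ h₃ hm hr hn hr']
    simp [Parity.deg]
  loop_loop {_ _ _ _ _ _ _ _} h := h.false.elim
  loop_glue {_ _ _ _ _ _ _ _ _} _ h := h.false.elim
  loop_glue' {_ _ _ _ _ _ _ _ _} _ h := h.false.elim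

end TensorTotal

/-! ### Acyclic kernels are contractible -/

section Homotopy

variable {k : Type u} [Field k] {t : Kind} {p : Parity}

/-- Over a field, the differential from the kernel onto its image has a linear section, and this
extends to the whole component. Its values off the image play no role. -/
theorem AcyclicKernel.exists_section {A B : Operad k t p} {φ : A ⟶ B} (h : AcyclicKernel φ)
    (c : Vertex t) {i j : ℤ} (hij : i + 1 = j) : ∃ S : A.obj c j →ₗ[k] A.obj c i,
      ∀ (l : ℤ) (hjl : j + 1 = l) (x : A.obj c j), φ.app c j x = 0 → A.d hjl x = 0 →
        φ.app c i (S x) = 0 ∧ A.d hij (S x) = x := by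
  let f : LinearMap.ker (φ.app c i) →ₗ[k] A.obj c j := A.d hij ∘ₗ Submodule.subtype _
  obtain ⟨r, hr⟩ := f.rangeRestrict.exists_rightInverse_of_surjective
    (LinearMap.range_rangeRestrict f)
  obtain ⟨S, hS⟩ := LinearMap.exists_extend (Submodule.subtype _ ∘ₗ r)
  refine ⟨S, fun l hjl x hx hx' => ?_⟩
  obtain ⟨z, hz, hz'⟩ := h c i j l hij hjl x hx hx'
  have hm : x ∈ LinearMap.range f := ⟨⟨z, hz⟩, hz'⟩
  have e : S x = (r ⟨x, hm⟩ : A.obj c i) := LinearMap.congr_fun hS ⟨x, hm⟩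
  rw [e]
  exact ⟨(r ⟨x, hm⟩).2, congrArg Subtype.val (LinearMap.congr_fun hr ⟨x, hm⟩)⟩

/-- An acyclic kernel is contractible. -/
theorem AcyclicKernel.exists_homotopy {A B : Operad k t p} {φ : A ⟶ B} (h : AcyclicKernel φ)
    (c : Vertex t) : ∃ H : ∀ {i j : ℤ}, i + 1 = j → (A.obj c j →ₗ[k] A.obj c i),
      ∀ {i j l : ℤ} (hij : i + 1 = j) (hjl : j + 1 = l) (x : A.obj c j), φ.app c j x = 0 →
        φ.app c i (H hij x) = 0 ∧ A.d hij (H hij x) + H hjl (A.d hjl x) = x := by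
  choose S hS using fun (i j : ℤ) (hij : i + 1 = j) => h.exists_section c hij
  -- With `S` choosing primitives of cycles in the kernel, `x - S (d x)` is a cycle there, and `H x`
  -- is its chosen primitive. Since `H (d x) = S (d x)`, the two terms of the homotopy identity add
  -- up to `x`.
  refine ⟨fun {i j} hij => S i j hij ∘ₗ (LinearMap.id - S j (j + 1) rfl ∘ₗ A.d rfl), ?_⟩
  intro i j l hij hjl x hx
  subst hjl
  have h₁ := hS j (j + 1) rfl (j + 1 + 1) rfl (A.d rfl x) (by rw [φ.app_d, hx, map_zero])
    (A.d_d _ _ _)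
  have h₂ := hS i j hij (j + 1) rfl (x - S j (j + 1) rfl (A.d rfl x))
    (by rw [map_sub, hx, h₁.1, sub_zero]) (by rw [map_sub, h₁.2, sub_self])
  refine ⟨h₂.1, ?_⟩
  simp only [LinearMap.comp_apply, LinearMap.sub_apply, LinearMap.id_apply, A.d_d, map_zero,
    sub_zero]
  rw [h₂.2, sub_add_cancel]

end Homotopy

/-! ### Tensoring an acyclic surjection with an operad of finite type -/

section TensorMap

open TensorProduct

variable {k : Type u} [Field k] {p : Parity}

/-- A linear map that vanishes on the kernel of `π` does so after extension of scalars. -/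
theorem lTensor_eq_zero {V X Y Z : Type*} [AddCommGroup V] [Module k V] [AddCommGroup X]
    [Module k X] [AddCommGroup Y] [Module k Y] [AddCommGroup Z] [Module k Z] {π : X →ₗ[k] Y}
    (hπ : Function.Surjective π) {F : X →ₗ[k] Z} (hF : ∀ x, π x = 0 → F x = 0) {x : V ⊗[k] X}
    (hx : π.lTensor V x = 0) : F.lTensor V x = 0 := by
  obtain ⟨s, hs⟩ := π.exists_rightInverse_of_surjective (LinearMap.range_eq_top.2 hπ)
  -- Such a map factors through `π`, by means of a linear section; the factorization survives the
  -- tensor product.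
  have e : F = (F ∘ₗ s) ∘ₗ π := by
    ext y
    have := hF (y - s (π y)) (by
      rw [map_sub, sub_eq_zero]
      exact (LinearMap.congr_fun hs (π y)).symm)
    rw [map_sub, sub_eq_zero] at this
    exact this
  rw [e, LinearMap.lTensor_comp, LinearMap.comp_apply, hx, map_zero]

variable {P : Operad k .cyclic p} {A B : Operad k .cyclic p.flip}

/-- Functoriality of the tensor product in the second factor. -/
noncomputable def tensorMap (hP : P.IsFiniteType) (φ : A ⟶ B) :
    tensorOperad hP A ⟶ tensorOperad hP B where
  app c n := LinearMap.pi fun s => (φ.app c s.1.2).lTensor (P.obj c s.1.1) ∘ₗ LinearMap.proj s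
  app_d {c n n'} h x := by
    funext s
    have h₁ : ∀ {i i' j : ℤ} (h : i + 1 = i') (y : P.obj c i ⊗[k] A.obj c j),
        (φ.app c j).lTensor _ (biDLeft P A h j y) = biDLeft P B h j ((φ.app c j).lTensor _ y) := by
      intro i i' j h y
      unfold biDLeft
      induction y with
      | zero => simp only [map_zero]
      | add x y hx hy => simp only [map_add, hx, hy]
      | tmul x y => simp
    have h₂ : ∀ {i j j' : ℤ} (h : j + 1 = j') (y : P.obj c i ⊗[k] A.obj c j),
        (φ.app c j').lTensor _ (biDRight P A i h y) =
          biDRight P B i h ((φ.app c j).lTensor _ y) := by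
      intro i j j' h y
      unfold biDRight
      induction y with
      | zero => simp only [map_zero]
      | add x y hx hy => simp only [map_add, hx, hy]
      | tmul x y => simp [φ.app_d]
    refine (map_add ((φ.app c s.1.2).lTensor _) _ _).trans (congrArg₂ (· + ·) (h₁ _ _) ?_)
    exact (map_smul ((φ.app c s.1.2).lTensor _) _ _).trans (congrArg (sgn k s.1.1 • ·) (h₂ _ _))
  app_act σ {c c'} h {n} x := by
    funext s
    change (φ.app c' s.1.2).lTensor _ (biAct P A σ h s.1.1 s.1.2 (x s)) =
      biAct P B σ h s.1.1 s.1.2 ((φ.app c s.1.2).lTensor _ (x s))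
    unfold biAct
    generalize x s = y
    induction y with
    | zero => simp only [map_zero]
    | add x y hx hy => simp only [map_add, hx, hy]
    | tmul x y => simp [φ.app_act]
  app_glue {a b c₁ c₂ c} h {m n l} _ x y := by
    funext s
    have h₁ : ∀ {i₁ j₁ i₂ j₂ i j : ℤ} (hi : i₁ + i₂ + p.deg = i) (hj : j₁ + j₂ + p.flip.deg = j)
        (x : P.obj c₁ i₁ ⊗[k] A.obj c₁ j₁) (y : P.obj c₂ i₂ ⊗[k] A.obj c₂ j₂),
        (φ.app c j).lTensor _ (biGlue P A a b h hi hj x y) =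
          biGlue P B a b h hi hj ((φ.app c₁ j₁).lTensor _ x) ((φ.app c₂ j₂).lTensor _ y) := by
      intro i₁ j₁ i₂ j₂ i j hi hj x y
      unfold biGlue
      induction x with
      | zero => simp only [map_zero, LinearMap.zero_apply]
      | add x x' hx hx' => simp only [map_add, LinearMap.add_apply, hx, hx']
      | tmul x u =>
        induction y with
        | zero => simp only [map_zero]
        | add y y' hy hy' => simp only [map_add, hy, hy']
        | tmul y v => simp [φ.app_glue]
    refine (map_finsum ((φ.app c s.1.2).lTensor _)
      (hasFiniteSupport_tensorTerm hP h x y)).trans (finsum_congr fun q => ?_)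
    exact (map_smul ((φ.app c s.1.2).lTensor _) _ _).trans
      (congrArg (sgn k q.sign • ·) (h₁ _ _ _ _))
  app_loop h := h.false.elim

theorem tensorMap_surjective (hP : P.IsFiniteType) {φ : A ⟶ B}
    (hs : ∀ c i, Function.Surjective (φ.app c i)) (c : Vertex .cyclic) (n : ℤ) :
    Function.Surjective ((tensorMap hP φ).app c n) := by
  intro y
  choose x hx using fun s : {s : ℤ × ℤ // s.1 + s.2 = n} =>
    LinearMap.lTensor_surjective (P.obj c s.1.1) (hs c s.1.2) (y s)
  exact ⟨x, funext hx⟩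

/-- A contraction of the kernel, applied to the second factor with the sign `(-1)^i`, anticommutes
with the first differential and contracts the second one. It gives a primitive bidegree by bidegree,
so no convergence argument is needed for the product totalization. -/
theorem acyclicKernel_tensorMap (hP : P.IsFiniteType) {φ : A ⟶ B} (h : AcyclicKernel φ)
    (hs : ∀ c i, Function.Surjective (φ.app c i)) : AcyclicKernel (tensorMap hP φ) := by
  intro c n m l hnm hml r hr hr'
  obtain ⟨H, hH⟩ := h.exists_homotopy c
  have hr₀ : ∀ (i j : ℤ) (hs : i + j = m), (φ.app c j).lTensor _ (r ⟨(i, j), hs⟩) = 0 :=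
    fun i j hs => congrFun hr ⟨(i, j), hs⟩
  let z : TensorObj P A c n := fun s => sgn k s.1.1 •
    (H (show s.1.2 + 1 = s.1.2 + 1 from rfl)).lTensor _
      (r ⟨(s.1.1, s.1.2 + 1), by have := s.2; dsimp only; omega⟩)
  have hz : ∀ (i j j' : ℤ) (hs : i + j = n) (hj : j + 1 = j'), z ⟨(i, j), hs⟩ =
      sgn k i • (H hj).lTensor _ (r ⟨(i, j'), by dsimp only; omega⟩) := by
    rintro i j _ hs rfl
    rfl
  refine ⟨z, funext fun s => ?_, funext ?_⟩
  · change (φ.app c s.1.2).lTensor _ (z s) = 0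
    refine (map_smul ((φ.app c s.1.2).lTensor _) _ _).trans ?_
    have e := lTensor_eq_zero (V := P.obj c s.1.1) (hs c (s.1.2 + 1))
      (F := φ.app c s.1.2 ∘ₗ H (show s.1.2 + 1 = s.1.2 + 1 from rfl))
      (fun x hx => (hH rfl rfl x hx).1)
      (hr₀ s.1.1 (s.1.2 + 1) (by have := s.2; omega))
    rw [LinearMap.lTensor_comp] at e
    exact (congrArg (sgn k s.1.1 • ·) e).trans (smul_zero _)
  · rintro ⟨⟨i, j⟩, hij⟩
    dsimp only at hij
    have hij' : i + (j + 1) = l := by omega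
    -- Closedness of `r` one step up in the second degree: it replaces the first differential of
    -- `r`, after the contraction, by the second one.
    have e : tensorDLeft P A hml r ⟨(i, j + 1), hij'⟩ +
        tensorDRight P A hml r ⟨(i, j + 1), hij'⟩ = 0 := congrFun hr' ⟨(i, j + 1), hij'⟩
    rw [tensorDLeft_apply hml r (sub_add_cancel i 1), tensorDRight_apply hml r rfl] at e
    have e' := congrArg ((H (show j + 1 = j + 1 from rfl)).lTensor _) e
    change tensorDLeft P A hnm z ⟨(i, j), hij⟩ + tensorDRight P A hnm z ⟨(i, j), hij⟩ = _
    rw [tensorDLeft_apply hnm z (sub_add_cancel i 1), tensorDRight_apply hnm z (sub_add_cancel j 1),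
      hz _ _ _ _ rfl, hz _ _ _ _ (sub_add_cancel j 1)]
    have e₁ : ∀ y : P.obj c (i - 1) ⊗[k] A.obj c (j + 1),
        (H (show j + 1 = j + 1 from rfl)).lTensor _ (biDLeft P A (sub_add_cancel i 1) (j + 1) y) =
        biDLeft P A (sub_add_cancel i 1) j ((H (show j + 1 = j + 1 from rfl)).lTensor _ y) := by
      intro y
      unfold biDLeft
      induction y with
      | zero => simp only [map_zero]
      | add x y hx hy => simp only [map_add, hx, hy]
      | tmul x y => simp
    have e₂ := lTensor_eq_zero (V := P.obj c i) (hs c j)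
      (F := A.d (sub_add_cancel j 1) ∘ₗ H (sub_add_cancel j 1) +
        H (show j + 1 = j + 1 from rfl) ∘ₗ A.d rfl - LinearMap.id)
      (fun x hx => sub_eq_zero.2 (hH (sub_add_cancel j 1) rfl x hx).2) (hr₀ i j hij)
    simp only [LinearMap.lTensor_sub, LinearMap.lTensor_add, LinearMap.lTensor_comp,
      LinearMap.lTensor_id, LinearMap.sub_apply, LinearMap.add_apply, LinearMap.comp_apply,
      LinearMap.id_apply, sub_eq_zero] at e₂
    rw [map_add, e₁, map_smul, map_zero] at e'
    have q := sgn_mul_self k i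
    have q' : sgn k (i - 1) = -sgn k i := by
      rw [sgn_sub, sgn_one, mul_neg_one]
    refine Eq.trans ?_ e₂
    rw [map_smul, map_smul, q', eq_neg_of_add_eq_zero_left e', smul_neg, neg_smul, neg_neg,
      smul_smul, q, one_smul, smul_smul, q, one_smul, add_comm]
    rfl

end TensorMap

/-! ### Lifting solutions of the Maurer–Cartan equation -/

section Extension

/-- A bijection between finite sets of labels is the restriction of a permutation. -/
theorem exists_perm_extending {L L' : Finset ℕ} (e : L ≃ L') :
    ∃ σ : Equiv.Perm ℕ, ∀ m : L, σ m = e m := by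
  classical
  have i₁ : Infinite {x // x ∉ L} := (Finset.finite_toSet L).infinite_compl.to_subtype
  have i₂ : Infinite {x // x ∉ L'} := (Finset.finite_toSet L').infinite_compl.to_subtype
  obtain ⟨d₁⟩ := nonempty_denumerable {x // x ∉ L}
  obtain ⟨d₂⟩ := nonempty_denumerable {x // x ∉ L'}
  -- The complements of two finite sets of labels are countably infinite, so the bijection extends
  -- by any bijection between them.
  refine ⟨(Equiv.sumCompl (· ∈ L)).symm.trans ((Equiv.sumCongr e (Denumerable.equiv₂ _ _)).trans
    (Equiv.sumCompl (· ∈ L'))), fun m => ?_⟩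
  simp [Equiv.sumCompl_symm_apply_of_pos m.2]

variable {k : Type u} [Field k] {t : Kind}

/-- The permutation `τ⁻¹ * σ` fixes the legs of `c`, hence acts trivially. So only the bijection of
legs matters, which makes averages over finitely many bijections meaningful. -/
theorem VMod.act_congr (A : VMod k t) {σ τ : Equiv.Perm ℕ} {c c' : Vertex t}
    (hσ : IsRelabel σ c c') (hτ : IsRelabel τ c c') (h : ∀ m ∈ c.legs, σ m = τ m) {i : ℤ}
    (x : A.obj c i) : A.act σ hσ x = A.act τ hτ x := by
  have hf : ∀ m ∈ c.legs, (τ⁻¹ * σ) m = m := fun m hm => by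
    rw [Equiv.Perm.mul_apply, h m hm]
    exact τ.symm_apply_apply m
  have e := A.act_act (τ⁻¹ * σ) τ (Vertex.isRelabel_self hf) hτ
    (by rwa [mul_inv_cancel_left]) x
  rw [A.act_eq_self _ hf] at e
  rw [e]
  simp only [mul_inv_cancel_left]

theorem isRelabel_of_equiv {c c' : Vertex .cyclic} (e : c.legs ≃ c'.legs) {σ : Equiv.Perm ℕ}
    (h : ∀ m : c.legs, σ m = e m) : IsRelabel σ c c' := by
  have g : c.genus = 0 := c.allowed
  have g' : c'.genus = 0 := c'.allowed
  refine ⟨g'.trans g.symm, ?_⟩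
  ext x
  simp only [Finset.mem_map, Equiv.coe_toEmbedding]
  constructor
  · intro hx
    exact ⟨e.symm ⟨x, hx⟩, (e.symm ⟨x, hx⟩).2, by rw [h, Equiv.apply_symm_apply]⟩
  · rintro ⟨m, hm, rfl⟩
    exact (h ⟨m, hm⟩) ▸ (e ⟨m, hm⟩).2

/-- The action of a bijection between the legs of two vertices of genus zero. -/
noncomputable def VMod.actEquiv (A : VMod k .cyclic) {c c' : Vertex .cyclic}
    (e : c.legs ≃ c'.legs) (i : ℤ) : A.obj c i →ₗ[k] A.obj c' i :=
  A.act (exists_perm_extending e).choose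
    (isRelabel_of_equiv e (exists_perm_extending e).choose_spec)

theorem VMod.actEquiv_eq (A : VMod k .cyclic) {c c' : Vertex .cyclic} (e : c.legs ≃ c'.legs)
    {σ : Equiv.Perm ℕ} (hσ : IsRelabel σ c c') (h : ∀ m : c.legs, σ m = e m) {i : ℤ}
    (x : A.obj c i) : A.actEquiv e i x = A.act σ hσ x :=
  A.act_congr _ _ (fun m hm =>
    ((exists_perm_extending e).choose_spec ⟨m, hm⟩).trans (h ⟨m, hm⟩).symm) _

end Extension

/-! ### Averaging over bijections of legs, and the inductive lifting argument -/

section Lifting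

variable {k : Type u} [Field k] {T T' : Operad k .cyclic .odd}

/-- The mean of the transports of an element along all bijections between the legs. -/
noncomputable def mean (T : VMod k .cyclic) {c₀ : Vertex .cyclic} {i : ℤ} (x : T.obj c₀ i)
    (c : Vertex .cyclic) : T.obj c i :=
  (Fintype.card (c₀.legs ≃ c.legs) : k)⁻¹ • ∑ e : c₀.legs ≃ c.legs, T.actEquiv e i x

/-- Composition with `σ` is a bijection between the two index sets of bijections, so the mean is
equivariant no matter what `x` is. -/
theorem act_mean (T : VMod k .cyclic) {c₀ : Vertex .cyclic} {i : ℤ} (x : T.obj c₀ i)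
    (σ : Equiv.Perm ℕ) {c c' : Vertex .cyclic} (h : IsRelabel σ c c') :
    T.act σ h (mean T x c) = mean T x c' := by
  have hm : ∀ m, m ∈ c.legs ↔ σ m ∈ c'.legs := fun m => by simp [h.legs]
  let ρ : (c₀.legs ≃ c.legs) ≃ (c₀.legs ≃ c'.legs) :=
    Equiv.equivCongr (Equiv.refl _) (σ.subtypeEquiv hm)
  unfold mean
  rw [map_smul, map_sum, Fintype.card_congr ρ]
  congr 1
  refine Fintype.sum_equiv ρ _ _ fun e => ?_
  obtain ⟨τ, hτ⟩ := exists_perm_extending e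
  have r := isRelabel_of_equiv e hτ
  have hρ : ∀ m : c₀.legs, (σ * τ) m = ρ e m := fun m => by
    rw [Equiv.Perm.mul_apply, hτ]
    rfl
  rw [T.actEquiv_eq e r hτ, T.actEquiv_eq (ρ e) (isRelabel_of_equiv _ hρ) hρ]
  exact T.act_act τ σ r h _ x

/-- An average of equal elements. Equal numbers of legs make the index set nonempty, and
characteristic zero allows division by its cardinality; without a bijection the mean would be zero
by default. -/
theorem mean_eq [CharZero k] (T : VMod k .cyclic) {c₀ c : Vertex .cyclic}
    (hc : c.legs.card = c₀.legs.card) {i : ℤ} {x : T.obj c₀ i} {y : T.obj c i}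
    (h : ∀ e : c₀.legs ≃ c.legs, T.actEquiv e i x = y) : mean T x c = y := by
  have : Nonempty (c₀.legs ≃ c.legs) := ⟨Finset.equivOfCardEq hc.symm⟩
  have hN : (Fintype.card (c₀.legs ≃ c.legs) : k) ≠ 0 :=
    Nat.cast_ne_zero.2 Fintype.card_pos.ne'
  rw [mean, Finset.sum_congr rfl fun e _ => h e, Finset.sum_const, Finset.card_univ,
    ← Nat.cast_smul_eq_nsmul k, smul_smul, inv_mul_cancel₀ hN, one_smul]

/-- Only vertices with fewer legs occur in the quadratic term, so changing `θ` at vertices with as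
many legs as `c` does not affect it. -/
theorem bracket_congr {θ θ' : ∀ c, T.obj c 0} {a b : ℕ} {c : Vertex .cyclic}
    (h : ∀ v : Vertex .cyclic, v.legs.card < c.legs.card → θ v = θ' v) :
    bracket T θ a b c = bracket T θ' a b c := by
  unfold bracket
  refine Finset.sum_congr rfl fun s _ => ?_
  rw [h _ s.2.left_card_lt, h _ s.2.right_card_lt]

theorem app_bracket (Φ : T ⟶ T') (θ : ∀ c, T.obj c 0) (a b : ℕ) (c : Vertex .cyclic) :
    Φ.app c 1 (bracket T θ a b c) = bracket T' (fun c => Φ.app c 0 (θ c)) a b c := by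
  unfold bracket
  rw [map_sum]
  exact Finset.sum_congr rfl fun s _ => Φ.app_glue _ _ _ _

theorem EquivariantBelow.congr {n : ℕ} {θ θ' : ∀ c, T.obj c 0}
    (h : EquivariantBelow T θ n) (e : ∀ v : Vertex .cyclic, v.legs.card < n → θ v = θ' v) :
    EquivariantBelow T θ' n := fun σ c c' hc hn => by
  rw [← e c hn, ← e c' (by rwa [hc.card]), h σ hc hn]

theorem MaurerCartanBelow.congr {n : ℕ} {θ θ' : ∀ c, T.obj c 0}
    (h : MaurerCartanBelow T θ n) (e : ∀ v : Vertex .cyclic, v.legs.card < n → θ v = θ' v) :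
    MaurerCartanBelow T θ' n := fun a b c hab ha hb hn => by
  rw [← e c hn, h a b c hab ha hb hn, bracket_congr fun v hv => e v (hv.trans hn)]

/-- The solution of the Maurer–Cartan equation can be lifted at vertices with `n` legs. -/
theorem exists_lift_step [CharZero k] {Φ : T ⟶ T'} (ha : AcyclicKernel Φ)
    (hs : ∀ c i, Function.Surjective (Φ.app c i)) {β : ∀ c, T'.obj c 0}
    (hβ : ∀ n, EquivariantBelow T' β n) (hβ' : ∀ n, MaurerCartanBelow T' β n) {n : ℕ}
    {θ : ∀ c, T.obj c 0} (hθ : EquivariantBelow T θ n) (hθ' : MaurerCartanBelow T θ n)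
    (hΦ : ∀ c : Vertex .cyclic, c.legs.card < n → Φ.app c 0 (θ c) = β c) :
    ∃ θ' : ∀ c, T.obj c 0, EquivariantBelow T θ' (n + 1) ∧ MaurerCartanBelow T θ' (n + 1) ∧
      (∀ c : Vertex .cyclic, c.legs.card < n + 1 → Φ.app c 0 (θ' c) = β c) ∧
      ∀ c : Vertex .cyclic, c.legs.card < n → θ c = θ' c := by
  classical
  -- For `n < 3` there is no vertex of genus zero with `n` legs, and nothing has to be lifted.
  by_cases hn : ∃ c : Vertex .cyclic, c.legs.card = n
  swap
  · have hlt : ∀ c : Vertex .cyclic, c.legs.card < n + 1 → c.legs.card < n := fun c h =>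
      lt_of_le_of_ne (Nat.lt_succ_iff.1 h) fun e => hn ⟨c, e⟩
    exact ⟨θ, fun σ c c' h hc => hθ σ h (hlt c hc),
      fun a b c h₁ h₂ h₃ hc => hθ' a b c h₁ h₂ h₃ (hlt c hc), fun c hc => hΦ c (hlt c hc),
      fun _ _ => rfl⟩
  obtain ⟨c₀, rfl⟩ := hn
  obtain ⟨a, ha₀⟩ := Infinite.exists_notMem_finset c₀.legs
  obtain ⟨b, hb₀⟩ := Infinite.exists_notMem_finset (insert a c₀.legs)
  simp only [Finset.mem_insert, not_or] at hb₀
  obtain ⟨hab, hb₀⟩ := hb₀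
  obtain ⟨x, hx⟩ := hs c₀ 0 (β c₀)
  -- The failure of the Maurer–Cartan equation for an arbitrary lift `x`. It lies in the kernel
  -- because `β` solves the equation and `θ` lifts `β` at smaller vertices, and it is a cycle by the
  -- Bianchi identity. Hence it has a primitive `z` in the kernel, and `x - z` solves the equation
  -- at `c₀`.
  obtain ⟨z, hz, hz'⟩ := ha c₀ 0 1 2 (zero_add 1) one_add_one_eq_two
    (T.d (zero_add 1) x + (1 / 2 : k) • bracket T θ a b c₀)
    (by
      rw [map_add, map_smul, Φ.app_d, hx, app_bracket,
        hβ' (c₀.legs.card + 1) a b c₀ (Ne.symm hab) ha₀ hb₀ (Nat.lt_succ_self _),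
        bracket_congr (θ := fun c => Φ.app c 0 (θ c)) hΦ, neg_smul, neg_add_cancel])
    (by rw [map_add, T.d_d, map_smul, d_bracket hθ hθ' (Ne.symm hab) ha₀ hb₀, smul_zero, add_zero])
  have hy : Φ.app c₀ 0 (x - z) = β c₀ := by rw [map_sub, hz, hx, sub_zero]
  have hy' : T.d (zero_add 1) (x - z) = -(1 / 2 : k) • bracket T θ a b c₀ := by
    rw [map_sub, hz', neg_smul]
    abel
  generalize x - z = y at hy hy'
  -- In genus zero all vertices with the same number of legs are isomorphic, so one corrected
  -- element at `c₀`, averaged over bijections, serves all of them.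
  let θ' : ∀ c, T.obj c 0 := fun c => if c.legs.card = c₀.legs.card then mean T.toVMod y c else θ c
  have h₁ : ∀ c : Vertex .cyclic, c.legs.card = c₀.legs.card → θ' c = mean T.toVMod y c :=
    fun c hc => if_pos hc
  have h₂ : ∀ c : Vertex .cyclic, c.legs.card < c₀.legs.card → θ c = θ' c :=
    fun c hc => (if_neg hc.ne).symm
  refine ⟨θ', fun σ c c' h hc => ?_, fun a' b' c hab' ha' hb' hc => ?_, fun c hc => ?_, h₂⟩
  · rcases Nat.lt_succ_iff_lt_or_eq.1 hc with hc | hc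
    · exact (hθ.congr h₂) σ h hc
    · rw [h₁ c hc, h₁ c' (h.card.trans hc), act_mean]
  · rcases Nat.lt_succ_iff_lt_or_eq.1 hc with hc | hc
    · exact (hθ'.congr h₂) a' b' c hab' ha' hb' hc
    · rw [h₁ c hc, ← bracket_congr (θ := θ) (fun v hv => h₂ v (hv.trans_eq hc))]
      have e : T.d (zero_add 1) (mean T.toVMod y c) =
          mean T.toVMod (T.d (zero_add 1) y) c := by
        unfold mean
        rw [map_smul, map_sum]
        congr 1
        exact Finset.sum_congr rfl fun e _ => (T.act_d _ _ _ _).symm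
      rw [e]
      refine mean_eq _ hc fun e => ?_
      rw [hy', map_smul]
      congr 1
      obtain ⟨σ, hσ⟩ := exists_perm_extending e
      have r := isRelabel_of_equiv e hσ
      rw [VMod.actEquiv_eq _ e r hσ, act_bracket hθ σ rfl rfl r le_rfl]
      -- Transport along `σ` moves the auxiliary names `a` and `b`; as they stay off the legs, they
      -- may be replaced by `a'` and `b'`.
      have hm : ∀ m, m ∉ c₀.legs → σ m ∉ c.legs := fun m hm h => hm (by simpa [r.legs] using h)
      exact bracket_eq hθ (fun h => hab (σ.injective h).symm) (hm a ha₀) (hm b hb₀) hab' ha' hb'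
        hc.le
  · rcases Nat.lt_succ_iff_lt_or_eq.1 hc with hc | hc
    · rw [← h₂ c hc, hΦ c hc]
    · rw [h₁ c hc]
      have e : Φ.app c 0 (mean T.toVMod y c) = mean T'.toVMod (Φ.app c₀ 0 y) c := by
        unfold mean
        rw [map_smul, map_sum]
        congr 1
        exact Finset.sum_congr rfl fun e _ => Φ.app_act _ _ _
      rw [e]
      refine mean_eq _ hc fun e => ?_
      rw [hy]
      exact hβ (c₀.legs.card + 1) _ _ (Nat.lt_succ_self _)

/-- Equivariant solutions of the Maurer–Cartan equation lift along acyclic surjections. -/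
theorem exists_lift_maurerCartan [CharZero k] {Φ : T ⟶ T'} (ha : AcyclicKernel Φ)
    (hs : ∀ c i, Function.Surjective (Φ.app c i)) {β : ∀ c, T'.obj c 0}
    (hβ : ∀ n, EquivariantBelow T' β n) (hβ' : ∀ n, MaurerCartanBelow T' β n) :
    ∃ θ : ∀ c, T.obj c 0, (∀ n, EquivariantBelow T θ n) ∧ (∀ n, MaurerCartanBelow T θ n) ∧
      ∀ c, Φ.app c 0 (θ c) = β c := by
  let Good : ℕ → (∀ c, T.obj c 0) → Prop := fun n θ => EquivariantBelow T θ n ∧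
    MaurerCartanBelow T θ n ∧ ∀ c : Vertex .cyclic, c.legs.card < n → Φ.app c 0 (θ c) = β c
  have step : ∀ (n : ℕ) (θ : {θ // Good n θ}), ∃ θ' : {θ' // Good (n + 1) θ'},
      ∀ c : Vertex .cyclic, c.legs.card < n → θ.1 c = θ'.1 c := fun n θ => by
    obtain ⟨θ', h₁, h₂, h₃, h₄⟩ := exists_lift_step ha hs hβ hβ' θ.2.1 θ.2.2.1 θ.2.2.2
    exact ⟨⟨θ', h₁, h₂, h₃⟩, h₄⟩
  choose next hnext using step
  let start : {θ // Good 0 θ} := ⟨fun _ => 0, fun _ _ _ _ h => (Nat.not_lt_zero _ h).elim,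
    fun _ _ _ _ _ _ h => (Nat.not_lt_zero _ h).elim, fun _ h => (Nat.not_lt_zero _ h).elim⟩
  let seq : ∀ n, {θ // Good n θ} := fun n => Nat.rec start next n
  -- The stages stabilize at every vertex once they have passed its number of legs.
  have hseq : ∀ (n m : ℕ) (c : Vertex .cyclic), c.legs.card < n →
      (seq n).1 c = (seq (n + m)).1 c := fun n m c hc => by
    induction m with
    | zero => rfl
    | succ m ih => exact ih.trans (hnext (n + m) (seq (n + m)) c (by omega))
  -- The bounds are strict, so the value at `c` is settled at the stage one above its number of
  -- legs.
  let θ : ∀ c, T.obj c 0 := fun c => (seq (c.legs.card + 1)).1 c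
  have hθ : ∀ (n : ℕ) (c : Vertex .cyclic), c.legs.card < n → (seq n).1 c = θ c :=
      fun n c hc => by
    obtain ⟨m, rfl⟩ := Nat.exists_eq_add_of_le (Nat.succ_le_iff.2 hc)
    exact (hseq (c.legs.card + 1) m c (Nat.lt_succ_self _)).symm
  exact ⟨θ, fun n => (seq n).2.1.congr (hθ n), fun n => (seq n).2.2.1.congr (hθ n),
    fun c => (seq (c.legs.card + 1)).2.2.2 c (Nat.lt_succ_self _)⟩

end Lifting

/-! ### Morphisms out of the Feynman transform as solutions of the Maurer–Cartan equation -/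

section TensorEval

open TensorProduct

variable {k : Type u} [Field k]

section Linear

variable {V X : Type u} [AddCommGroup V] [Module k V] [AddCommGroup X] [Module k X]

variable (k V X) in
/-- A tensor as a linear map on functionals. -/
noncomputable def tensorEval : V ⊗[k] X →ₗ[k] Module.Dual k V →ₗ[k] X :=
  TensorProduct.lift (LinearMap.mk₂ k (fun v x => (Module.Dual.eval k V v).smulRight x)
    (fun v v' x => by ext f; simp [add_smul]) (fun r v x => by ext f; simp [mul_smul])
    (fun v x x' => by ext f; simp) (fun r v x => by ext f; simp [smul_comm r]))

@[simp]
theorem tensorEval_tmul (v : V) (x : X) (f : Module.Dual k V) :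
    tensorEval k V X (v ⊗ₜ x) f = f v • x := rfl

/-- For finite dimensional `V`, a map `g` is given by the tensor that pairs a basis with the values
of `g` on the dual basis. The same formula recovers a tensor from its map, which gives injectivity
below. -/
theorem tensorEval_surjective [Module.Finite k V] : Function.Surjective (tensorEval k V X) := by
  intro g
  refine ⟨∑ α, Module.Basis.ofVectorSpace k V α ⊗ₜ g ((Module.Basis.ofVectorSpace k V).coord α),
    LinearMap.ext fun f => ?_⟩
  rw [map_sum, LinearMap.sum_apply]
  simp only [tensorEval_tmul, ← map_smul]
  rw [← map_sum, Module.Basis.sum_dual_apply_smul_coord]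

theorem tensorEval_injective [Module.Finite k V] : Function.Injective (tensorEval k V X) := by
  have key : ∀ x : V ⊗[k] X, ∑ α, Module.Basis.ofVectorSpace k V α ⊗ₜ
      tensorEval k V X x ((Module.Basis.ofVectorSpace k V).coord α) = x := fun x => by
    induction x with
    | zero => simp
    | add x y hx hy => simp only [map_add, LinearMap.add_apply, tmul_add, Finset.sum_add_distrib,
        hx, hy]
    | tmul v x =>
      simp only [tensorEval_tmul, ← smul_tmul, ← sum_tmul]
      congr 1
      exact (Module.Basis.ofVectorSpace k V).sum_repr v
  intro x y h
  rw [← key x, ← key y, h]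

end Linear

theorem tensorEval_lTensor {V X Y : Type u} [AddCommGroup V] [Module k V] [AddCommGroup X]
    [Module k X] [AddCommGroup Y] [Module k Y] (φ : X →ₗ[k] Y) (x : V ⊗[k] X)
    (f : Module.Dual k V) : tensorEval k V Y (φ.lTensor V x) f = φ (tensorEval k V X x f) := by
  induction x with
  | zero => simp
  | add x y hx hy => simp only [map_add, LinearMap.add_apply, hx, hy]
  | tmul v x => simp

theorem tensorEval_rTensor {V W X : Type u} [AddCommGroup V] [Module k V] [AddCommGroup W]
    [Module k W] [AddCommGroup X] [Module k X] (φ : V →ₗ[k] W) (x : V ⊗[k] X)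
    (f : Module.Dual k W) :
    tensorEval k W X (φ.rTensor X x) f = tensorEval k V X x (f ∘ₗ φ) := by
  induction x with
  | zero => simp
  | add x y hx hy => simp only [map_add, LinearMap.add_apply, hx, hy]
  | tmul v x => simp

theorem tensorEval_map {V W X Y : Type u} [AddCommGroup V] [Module k V] [AddCommGroup W]
    [Module k W] [AddCommGroup X] [Module k X] [AddCommGroup Y] [Module k Y] (φ : V →ₗ[k] W)
    (ψ : X →ₗ[k] Y) (x : V ⊗[k] X) (f : Module.Dual k W) :
    tensorEval k W Y (TensorProduct.map φ ψ x) f = ψ (tensorEval k V X x (f ∘ₗ φ)) := by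
  induction x with
  | zero => simp
  | add x y hx hy => simp only [map_add, LinearMap.add_apply, hx, hy]
  | tmul v x => simp

/-- Expanding both factors in bases turns the product of tensors into the contraction that defines
the terms of `edgeSum`. This identifies the quadratic part of the differential of a Feynman
transform with the bracket. -/
theorem tensorEval_map₂ {V₁ V₂ V X₁ X₂ X : Type u} [AddCommGroup V₁] [Module k V₁]
    [AddCommGroup V₂] [Module k V₂] [AddCommGroup V] [Module k V] [AddCommGroup X₁] [Module k X₁]
    [AddCommGroup X₂] [Module k X₂] [AddCommGroup X] [Module k X] [Module.Finite k V₁]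
    [Module.Finite k V₂] (g : V₁ →ₗ[k] V₂ →ₗ[k] V) (g' : X₁ →ₗ[k] X₂ →ₗ[k] X)
    (x : V₁ ⊗[k] X₁) (y : V₂ ⊗[k] X₂) (f : Module.Dual k V) :
    tensorEval k V X (TensorProduct.map₂ g g' x y) f =
      contract (g.compr₂ f) (g'.compl₁₂ (tensorEval k V₁ X₁ x) (tensorEval k V₂ X₂ y)) := by
  rw [contract_eq_sum]
  induction x with
  | zero => simp
  | add x x' hx hx' =>
    simp only [map_add, LinearMap.add_apply, hx, hx', LinearMap.compl₁₂_apply, smul_add,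
      Finset.sum_add_distrib]
  | tmul v x =>
    induction y with
    | zero => simp
    | add y y' hy hy' =>
      simp only [map_add, LinearMap.add_apply, hy, hy', LinearMap.compl₁₂_apply, smul_add,
        Finset.sum_add_distrib]
    | tmul w y =>
      simp only [TensorProduct.map₂_apply_tmul, TensorProduct.map_tmul, tensorEval_tmul, LinearMap.compl₁₂_apply, map_smul,
        LinearMap.smul_apply, smul_smul, ← Finset.sum_smul, LinearMap.compr₂_apply]
      congr 1
      have e₁ : ∀ z : V₂, f (g v z) = ∑ α, (Module.Basis.ofVectorSpace k V₁).coord α v *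
          f (g (Module.Basis.ofVectorSpace k V₁ α) z) := fun z => by
        conv_lhs => rw [← (Module.Basis.ofVectorSpace k V₁).sum_repr v]
        simp
      have e₂ : ∀ u : V₁, f (g u w) = ∑ β, (Module.Basis.ofVectorSpace k V₂).coord β w *
          f (g u (Module.Basis.ofVectorSpace k V₂ β)) := fun u => by
        conv_lhs => rw [← (Module.Basis.ofVectorSpace k V₂).sum_repr w]
        simp
      rw [e₁]
      refine Finset.sum_congr rfl fun α _ => ?_
      rw [e₂, Finset.mul_sum]
      exact Finset.sum_congr rfl fun β _ => by ring

end TensorEval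

/-! ### The dictionary between linear maps on generators and Maurer–Cartan elements -/

section Correspondence

open TensorProduct

variable {k : Type u} [Field k] {p : Parity} {P : Operad k .cyclic p}
  {A : Operad k .cyclic p.flip}

/-- `θ` is the family of tensors that corresponds to the family `γ` of linear maps. -/
def Corresponds (θ : ∀ c, TensorObj P A c 0) (γ : ∀ c i, P.dual.obj c i →ₗ[k] A.obj c i) : Prop :=
  ∀ c j (f : Module.Dual k (P.obj c (-j))),
    tensorEval k (P.obj c (-j)) (A.obj c j) (θ c ⟨(-j, j), neg_add_cancel j⟩) f =
      γ c j (P.dualMk c j f)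

theorem exists_corresponds_left (hP : P.IsFiniteType)
    (γ : ∀ c i, P.dual.obj c i →ₗ[k] A.obj c i) : ∃ θ : ∀ c, TensorObj P A c 0,
      Corresponds θ γ := by
  have := hP.finite
  choose x hx using fun (c : Vertex .cyclic) (j : ℤ) =>
    tensorEval_surjective (γ c j ∘ₗ P.dualMk c j)
  -- A bidegree of total degree zero is `(-j, j)`, but only up to a propositional equality, so the
  -- tensor is transported along it.
  refine ⟨fun c s => (show -s.1.2 = s.1.1 by have := s.2; omega) ▸ x c s.1.2, fun c j f => ?_⟩
  exact LinearMap.congr_fun (hx c j) f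

theorem exists_corresponds_right (θ : ∀ c, TensorObj P A c 0) :
    ∃ γ : ∀ c i, P.dual.obj c i →ₗ[k] A.obj c i, Corresponds θ γ :=
  ⟨fun c i => tensorEval k (P.obj c (-i)) (A.obj c i) (θ c ⟨(-i, i), neg_add_cancel i⟩),
    fun _ _ _ => rfl⟩

/-- Tensors are separated by functionals since `P` is finite dimensional in each degree. The first
degree is written as `-i` to match the grading of the dual. -/
theorem tensorObj_ext (hP : P.IsFiniteType) {c : Vertex .cyclic} {n : ℤ} {x y : TensorObj P A c n}
    (h : ∀ (i j : ℤ) (hs : -i + j = n) (f : Module.Dual k (P.obj c (-i))),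
      tensorEval k _ _ (x ⟨(-i, j), hs⟩) f = tensorEval k _ _ (y ⟨(-i, j), hs⟩) f) : x = y := by
  have := hP.finite
  funext ⟨⟨i, j⟩, hs⟩
  obtain ⟨i, rfl⟩ : ∃ i', i = -i' := ⟨-i, (neg_neg i).symm⟩
  exact tensorEval_injective (LinearMap.ext fun f => h i j hs f)

theorem Corresponds.act {θ : ∀ c, TensorObj P A c 0} {γ : ∀ c i, P.dual.obj c i →ₗ[k] A.obj c i}
    (h : Corresponds θ γ) (σ : Equiv.Perm ℕ) {c c' : Vertex .cyclic} (hc : IsRelabel σ c c')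
    (j : ℤ) (f : Module.Dual k (P.obj c' (-j))) :
    tensorEval k (P.obj c' (-j)) (A.obj c' j)
      (tensorAct P A σ hc 0 (θ c) ⟨(-j, j), neg_add_cancel j⟩) f =
      A.act σ hc (γ c j (P.dualMk c j (f ∘ₗ P.act σ hc))) :=
  (tensorEval_map _ _ _ _).trans (congrArg _ (h c j _))

/-- The action on the dual is contragredient, so pairing the transported tensor with a functional
amounts to moving the functional back, applying `γ`, and transporting the value. -/
theorem Corresponds.equivariant (hP : P.IsFiniteType) {θ : ∀ c, TensorObj P A c 0}
    {γ : ∀ c i, P.dual.obj c i →ₗ[k] A.obj c i} (h : Corresponds θ γ) :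
    (∀ n, EquivariantBelow (tensorOperad hP A) θ n) ↔
      ∀ (σ : Equiv.Perm ℕ) {c c' : Vertex .cyclic} (hc : IsRelabel σ c c') {i : ℤ}
        (x : P.dual.obj c i), A.act σ hc (γ c i x) = γ c' i (P.dual.act σ hc x) := by
  constructor
  · intro hθ σ c c' hc i f
    have e : tensorAct P A σ hc 0 (θ c) = θ c' := hθ (c.legs.card + 1) σ hc (Nat.lt_succ_self _)
    have e₁ := h.act σ hc i (P.dual.act σ hc f)
    rw [e] at e₁
    refine Eq.trans ?_ (e₁.symm.trans (h c' i _))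
    refine congrArg (fun g => A.act σ hc (γ c i g)) (LinearMap.ext fun x => ?_)
    refine congrArg (show Module.Dual k (P.obj c (-i)) from f) ?_
    have hcc : IsRelabel (σ⁻¹ * σ) c c := by
      rw [inv_mul_cancel]
      exact Vertex.isRelabel_self fun _ _ => rfl
    refine Eq.symm ((P.act_act σ σ⁻¹ hc hc.symm hcc x).trans (P.act_id _ _ _ fun m _ => ?_))
    rw [inv_mul_cancel]
    rfl
  · intro hγ n σ c c' hc _
    refine tensorObj_ext hP fun i j hs f => ?_
    obtain rfl : i = j := by omega
    refine (h.act σ hc i f).trans (Eq.trans ?_ (h c' i f).symm)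
    refine (hγ σ hc _).trans (congrArg (γ c' i) (LinearMap.ext fun x => congrArg f ?_))
    have hcc : IsRelabel (σ * σ⁻¹) c' c' := by
      rw [mul_inv_cancel]
      exact Vertex.isRelabel_self fun _ _ => rfl
    refine (P.act_act σ⁻¹ σ hc.symm hc hcc x).trans (P.act_id _ _ _ fun m _ => ?_)
    rw [mul_inv_cancel]
    rfl

/-- The differential of `A` enters with the totalization sign `(-1)^i`, that of `P` without sign. As
the dual differential carries `-(-1)^i`, the common factor is `(-1)^i`. -/
theorem Corresponds.d (hP : P.IsFiniteType) {θ : ∀ c, TensorObj P A c 0}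
    {γ : ∀ c i, P.dual.obj c i →ₗ[k] A.obj c i} (h : Corresponds θ γ) (c : Vertex .cyclic)
    {i l : ℤ} (hl : i + 1 = l) (hs : -i + l = 1) (f : Module.Dual k (P.obj c (-i))) :
    tensorEval k (P.obj c (-i)) (A.obj c l)
      ((show TensorObj P A c 1 from (tensorOperad hP A).d (zero_add 1) (θ c)) ⟨(-i, l), hs⟩) f =
      sgn k i • (A.d hl (γ c i (P.dualMk c i f)) - γ c l (P.dual.d hl (P.dualMk c i f))) := by
  change tensorEval k _ _ (tensorDLeft P A (zero_add 1) (θ c) ⟨(-i, l), hs⟩ +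
    tensorDRight P A (zero_add 1) (θ c) ⟨(-i, l), hs⟩) f = _
  rw [tensorDLeft_apply _ _ (show -l + 1 = -i by omega), tensorDRight_apply _ _ hl, map_add,
    LinearMap.add_apply, map_smul, LinearMap.smul_apply]
  have e₁ := (tensorEval_rTensor (P.d (show -l + 1 = -i by omega)) (θ c ⟨(-l, l), by
    dsimp only; omega⟩) f).trans (h c l _)
  have e₂ := (tensorEval_lTensor (A.d hl) (θ c ⟨(-i, i), by dsimp only; omega⟩) f).trans
    (congrArg (A.d hl) (h c i f))
  have e₃ : P.dual.d hl (P.dualMk c i f) = -(sgn k i) •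
    P.dualMk c l (f ∘ₗ P.d (show -l + 1 = -i by omega)) := rfl
  refine (congrArg₂ (fun y z => y + sgn k (-i) • z) e₁ e₂).trans ?_
  rw [e₃, map_smul, smul_sub, smul_smul, mul_neg, sgn_mul_self, neg_one_smul, sub_neg_eq_add,
    sgn_congr (show ((-i : ℤ) : ZMod 2) = i by push_cast; grind), add_comm]

theorem Corresponds.glue (hP : P.IsFiniteType) {θ : ∀ c, TensorObj P A c 0}
    {γ : ∀ c i, P.dual.obj c i →ₗ[k] A.obj c i} (h : Corresponds θ γ) {a b : ℕ}
    {c : Vertex .cyclic} {i l : ℤ} (hl : i + 1 = l) (f : Module.Dual k (P.obj c (-i)))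
    (s : Split a b c (i + p.deg)) (g₁ : -s.i + -s.j + p.deg = -i)
    (g₂ : s.i + s.j + p.flip.deg = l) :
    tensorEval k (P.obj c (-i)) (A.obj c l) (biGlue P A a b s.isGlue g₁ g₂
      (θ s.left ⟨(-s.i, s.i), neg_add_cancel s.i⟩) (θ s.right ⟨(-s.j, s.j), neg_add_cancel s.j⟩)) f =
      splitTerm (P := P) (fun _ _ => LinearMap.id) γ hl f s := by
  have := hP.finite
  refine (tensorEval_map₂ _ _ _ _ _).trans ?_
  unfold splitTerm
  congr 1
  refine LinearMap.ext fun x => LinearMap.ext fun y => ?_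
  exact congrArg₂ (fun u v => A.glue a b s.isGlue g₂ u v) (h _ _ _) (h _ _ _)

/-- Total degree zero forces the bidegrees at the two vertices to be `(-s.i, s.i)` and `(-s.j,
s.j)`, so decompositions together with pairs of bidegrees are exactly the elements of `Split`. The
Koszul signs of the tensor contraction and of the edge sum differ by a factor that depends only on
`i`. -/
theorem Corresponds.bracket (hP : P.IsFiniteType) {θ : ∀ c, TensorObj P A c 0}
    {γ : ∀ c i, P.dual.obj c i →ₗ[k] A.obj c i} (h : Corresponds θ γ) (a b : ℕ)
    (c : Vertex .cyclic) {i l : ℤ} (hl : i + 1 = l) (hs : -i + l = 1)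
    (f : Module.Dual k (P.obj c (-i))) :
    tensorEval k (P.obj c (-i)) (A.obj c l) ((show TensorObj P A c 1 from
      GraphOperad.bracket (tensorOperad hP A) θ a b c) ⟨(-i, l), hs⟩) f =
      (sgn k i * sgn k (p.deg * i)) • ∑ᶠ s : Split a b c (i + p.deg),
        sgn k (s.i * s.j) • splitTerm (P := P) (fun _ _ => LinearMap.id) γ hl f s := by
  have e₀ : (show TensorObj P A c 1 from GraphOperad.bracket (tensorOperad hP A) θ a b c) =
      ∑ s : VSplit a b c, tensorGlue hP A a b s.2 0 0 1 (θ s.1.1) (θ s.1.2) := rfl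
  let E : P.obj c (-i) ⊗[k] A.obj c l →ₗ[k] A.obj c l := (tensorEval k _ _).flip f
  let F : (Σ s : VSplit a b c, BiSplit p 0 0 (-i) l) → A.obj c l := fun x =>
    E (tensorTerm a b x.1.2 (θ x.1.1.1) (θ x.1.1.2) x.2)
  have hfin : ∀ s : VSplit a b c, Function.HasFiniteSupport fun y => F ⟨s, y⟩ := fun s =>
    (hasFiniteSupport_tensorTerm hP s.2 (θ s.1.1) (θ s.1.2)).map E
  have fF : F.HasFiniteSupport :=
    hasFiniteSupport_sigma Set.finite_univ (fun s hs => (hs (Set.mem_univ s)).elim) hfin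
  have e₁ : E (∑ s : VSplit a b c, tensorGlue hP A a b s.2 0 0 1 (θ s.1.1) (θ s.1.2)
      ⟨(-i, l), hs⟩) = ∑ᶠ x, F x := by
    rw [finsum_sigma F fF, finsum_eq_sum_of_fintype, map_sum]
    refine Finset.sum_congr rfl fun s _ => ?_
    rw [tensorGlue_apply]
    exact map_finsum E (hasFiniteSupport_tensorTerm hP s.2 (θ s.1.1) (θ s.1.2))
  rw [e₀, Finset.sum_apply]
  refine e₁.trans ?_
  rw [smul_finsum]
  let e : Split a b c (i + p.deg) → Σ s : VSplit a b c, BiSplit p 0 0 (-i) l := fun s =>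
    ⟨⟨(s.left, s.right), s.isGlue⟩, ⟨-s.i, s.i, -s.j, s.j, neg_add_cancel _, neg_add_cancel _,
      by have := s.deg; omega, by have := s.deg; have := p.deg_flip; omega⟩⟩
  have he : Function.Bijective e := by
    refine Function.bijective_iff_has_inverse.2 ⟨fun x => ⟨x.1.1.1, x.1.1.2, x.1.2, x.2.j₁, x.2.j₂,
      by have := x.2.left; have := x.2.right; have := x.2.fst; omega⟩, fun s => rfl, ?_⟩
    rintro ⟨⟨⟨u, v⟩, g⟩, ⟨i₁, j₁, i₂, j₂, g₁, g₂, g₃, g₄⟩⟩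
    obtain rfl : i₁ = -j₁ := by omega
    obtain rfl : i₂ = -j₂ := by omega
    rfl
  refine (finsum_eq_of_bijective e he fun s => ?_).symm
  have key := h.glue hP hl f s (e s).2.fst (e s).2.snd
  refine Eq.trans ?_ (map_smul E _ _).symm
  refine Eq.trans ?_ (congrArg (sgn k (e s).2.sign • ·) key.symm)
  simp only [smul_smul, ← sgn_add]
  refine sgn_smul_congr ?_ rfl
  have e₃ := congrArg (fun x : ℤ => (x : ZMod 2)) s.deg
  have := p.deg_mul_self
  have e₄ := p.cast_deg_flip
  simp only [BiSplit.sign, e]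
  push_cast at e₃ ⊢
  grind

/-- There are no loops in genus zero, and the factor `1 / 2` accounts for the two orientations of an
edge on both sides. -/
theorem Corresponds.edgeSum (hP : P.IsFiniteType) [CharZero k] {θ : ∀ c, TensorObj P A c 0}
    {γ : ∀ c i, P.dual.obj c i →ₗ[k] A.obj c i} (h : Corresponds θ γ) (a b : ℕ)
    (c : Vertex .cyclic) {i l : ℤ} (hl : i + 1 = l) (hs : -i + l = 1)
    (f : Module.Dual k (P.obj c (-i))) :
    tensorEval k (P.obj c (-i)) (A.obj c l) ((show TensorObj P A c 1 from
      -(1 / 2 : k) • GraphOperad.bracket (tensorOperad hP A) θ a b c) ⟨(-i, l), hs⟩) f =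
      sgn k i • -GraphOperad.edgeSum (P := P) (fun _ _ => LinearMap.id) γ a b hl f := by
  have : IsEmpty {c₁ : Vertex .cyclic // IsLoop a b c₁ c} := ⟨fun s => s.2.false⟩
  unfold GraphOperad.edgeSum
  rw [finsum_of_isEmpty (loopTerm (P := P) (fun _ _ => LinearMap.id) γ (a := a) (b := b) hl f),
    add_zero]
  refine (map_smul ((tensorEval k (P.obj c (-i)) (A.obj c l)).flip f) (-(1 / 2 : k)) _).trans ?_
  refine (congrArg (-(1 / 2 : k) • ·) (h.bracket hP a b c hl hs f)).trans ?_
  simp only [smul_smul, ← neg_smul]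
  congr 1
  ring

/-- Pairing both sides of the Maurer–Cartan equation with a functional gives the two sides of the
differential condition, up to the same invertible sign `(-1)^i` and a rearrangement of terms. -/
theorem Corresponds.maurerCartan (hP : P.IsFiniteType) [CharZero k] {θ : ∀ c, TensorObj P A c 0}
    {γ : ∀ c i, P.dual.obj c i →ₗ[k] A.obj c i} (h : Corresponds θ γ) :
    (∀ n, MaurerCartanBelow (tensorOperad hP A) θ n) ↔
      ∀ (a b : ℕ) (c : Vertex .cyclic), a ≠ b → a ∉ c.legs → b ∉ c.legs → ∀ (i l : ℤ)
        (hl : i + 1 = l) (f : Module.Dual k (P.obj c (-i))),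
        A.d hl (γ c i (P.dualMk c i f)) = γ c l (P.dual.d hl (P.dualMk c i f)) -
          GraphOperad.edgeSum (P := P) (fun _ _ => LinearMap.id) γ a b hl f := by
  have hu : ∀ (i : ℤ) {X : Type u} [AddCommGroup X] [Module k X] {x y : X},
      sgn k i • x = sgn k i • y → x = y := fun i X _ _ x y hxy => by
    have := congrArg (sgn k i • ·) hxy
    simpa only [smul_smul, sgn_mul_self, one_smul] using this
  constructor
  · intro hθ a b c hab ha hb i l hl f
    have e₁ := h.d hP c hl (by omega) f
    rw [hθ (c.legs.card + 1) a b c hab ha hb (Nat.lt_succ_self _)] at e₁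
    have e₂ := hu i (e₁.symm.trans (h.edgeSum hP a b c hl (by omega) f))
    rw [sub_eq_iff_eq_add] at e₂
    rw [e₂, sub_eq_add_neg, add_comm]
  · intro hγ n a b c hab ha hb _
    refine tensorObj_ext hP fun i l hs f => ?_
    have hl : i + 1 = l := by omega
    refine (h.d hP c hl hs f).trans (Eq.trans ?_ (h.edgeSum hP a b c hl hs f).symm)
    rw [hγ a b c hab ha hb i l hl f]
    congr 1
    abel

end Correspondence

/-! ### Feynman transforms of cyclic operads are cofibrant -/

section Cofibrant

variable {k : Type u} [Field k] [CharZero k] {p : Parity}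

/-- The Feynman transform of a cyclic operad is cofibrant. -/
theorem isCofibrant_feynmanObj {P : Operad k .cyclic p} (hP : P.IsFiniteType) :
    IsCofibrant (feynmanObj P) := by
  intro A B π hπ hs f
  -- The values of `f` on generators become a Maurer–Cartan element `β` of `P ⊗ B`, as `f` respects
  -- the action and the differential.
  let γ : ∀ c i, P.dual.obj c i →ₗ[k] B.obj c i := fun c i => f.app c i ∘ₗ feynmanGen P c i
  obtain ⟨β, hβ⟩ := exists_corresponds_left hP γ
  have hγ := (hβ.equivariant hP).2 fun σ c c' hc i x =>
    (f.app_act σ hc _).symm.trans (congrArg _ (feynmanGen_act P σ hc x))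
  have hγ' := (hβ.maurerCartan hP).2 fun a b c hab ha hb i l hl g => by
    refine (f.app_d hl _).symm.trans ?_
    rw [feynmanGen_d hP hab ha hb, map_sub, app_edgeSum hP]
    rfl
  -- The map `P ⊗ A → P ⊗ B` is again surjective with acyclic kernel, so `β` lifts to a solution in
  -- `P ⊗ A`, which is read back as a morphism to `A`.
  obtain ⟨θ, hθ, hθ', hθβ⟩ := exists_lift_maurerCartan
    (acyclicKernel_tensorMap hP (hπ.acyclicKernel hs) hs) (tensorMap_surjective hP hs) hγ hγ'
  obtain ⟨δ, hδ⟩ := exists_corresponds_right (P := P) (A := A) θ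
  refine ⟨feynmanLift hP δ ((hδ.equivariant hP).1 hθ) ((hδ.maurerCartan hP).1 hθ'), ?_⟩
  -- The lifting property is checked on generators, where it says that `θ` maps to `β`.
  refine feynmanObj_hom_ext fun c i x => ?_
  have e₁ := hδ c i x
  have e₂ := hβ c i x
  rw [← hθβ] at e₂
  exact (congrArg (π.app c i) e₁.symm).trans ((tensorEval_lTensor _ _ _).symm.trans e₂)

end Cofibrant

end GraphOperad

/-! ### Assembling the three statements -/

open GraphOperad in
theorem corollary8p2 (k : Type u) [Field k] [CharZero k] (p : Parity) :
    Nonempty ((forgetHigherFin k p).op ⋙ feynman k .cyclic p ≅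
      feynman k .modular p ⋙ forgetHigher k p.flip) ∧
    Nonempty ((extendZeroFin k p).op ⋙ feynman k .modular p ≅
      feynman k .cyclic p ⋙ envelope k p.flip) ∧
    ∀ (q : QuadraticData k .cyclic p) (hE : q.gens.IsFiniteType) (hO : finType k .cyclic p q.operad),
      weakEquiv k .cyclic p.flip (q.koszulMap hE hO) →
      (∃ (Q : Operad k .cyclic p.flip) (π : Q ⟶ q.dualOperad),
        IsCofibrant Q ∧ weakEquiv k .cyclic p.flip π) ∧
      ∀ (Q : Operad k .cyclic p.flip) (π : Q ⟶ q.dualOperad),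
        IsCofibrant Q → weakEquiv k .cyclic p.flip π →
        Nonempty ((weakEquiv k .modular p.flip).Q.obj ((envelope k p.flip).obj Q) ≅
          (weakEquiv k .modular p.flip).Q.obj ((feynman k .modular p).obj
            ((extendZeroFin k p).op.obj (Opposite.op ⟨q.operad, hO⟩)))) := by
  refine ⟨⟨feynmanForgetNatIso k p⟩, ⟨feynmanEnvelopeNatIso k p⟩, fun q hE hO hK => ?_⟩
  have hD : IsCofibrant (feynmanObj q.operad) := isCofibrant_feynmanObj hO
  -- Koszulness makes the Feynman transform itself a cofibrant replacement of the quadratic dual.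
  refine ⟨⟨feynmanObj q.operad, q.koszulMap hE hO, hD, hK⟩, fun Q π hQ hπ => ?_⟩
  obtain ⟨e⟩ := nonempty_envelope_iso hD hQ hK hπ
  -- The envelope of `D(O)` is replaced by `D(L^!(O))` through the isomorphism of the second
  -- statement.
  exact ⟨e ≪≫ (weakEquiv k .modular p.flip).Q.mapIso
    ((feynmanEnvelopeNatIso k p).app (Opposite.op ⟨q.operad, hO⟩)).symm⟩
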